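/- **Theorem C2 (kinematic Gauss–Bonnet; geometric phase).** Indices are cyclic mod 3. Let $m_1,m_2,m_3>0$, $m_1+m_2+m_3=1$. An *oriented m-triangle* is a pair $(X,\mathbf n)$, where $X=(\mathbf a_1,\mathbf a_2,\mathbf a_3)$ is a triple of vectors of $\mathbb R^3$ with $\sum m_i\mathbf a_i=0$ and $\mathbf n$ is a unit vector perpendicular to all $\mathbf a_i$. Put $I_i=m_i|\mathbf a_i|^2$, $I=I_1+I_2+I_3$, $\rho=\sqrt I$. The shape (class modulo rotation and scaling) of an oriented m-triangle with $X\neq0$ is a point of the shape sphere $M^*=S^2(1/2)$, the sphere of radius $1/2$, through the Hopf map applied to the Jacobi vectors of $X$; the northern hemisphere consists of the positively oriented triangles and the equator of the collinear ones. $dA$ is the area form of $S^2(1/2)$ for the outward orientation. Let $p_i\in M^*$ be the shape with $\mathbf a_i=0$. The kinematic 1-form $\Theta_i=I^{-1}(I_{i+2}\,d\alpha_{i+1}-I_{i+1}\,d\alpha_{i+2})$, where $\alpha_j$ is the angle from $\mathbf a_{j+1}$ to $\mathbf a_{j+2}$, extends to a smooth 1-form on $M^*\setminus\{p_i\}$.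 Let $(X(t),\mathbf n(t))$, $t_0\le t\le t_1$, be a piecewise $C^1$ motion of oriented m-triangles with $X(t)\ne 0$ and vanishing angular momentum, $\Omega=\sum m_i\,\mathbf a_i\times\dot{\mathbf a}_i=0$; assume that $\dot{\mathbf n}=0$ while the triangle is collinear (the normal does not spin about a collinear configuration). Assume that the shape curve $\gamma$ of the motion is closed and bounds the region $D\subset M^*$: $D$ is open and connected, $\partial D$ is the trace of $\gamma$, and $\gamma$ winds $\varepsilon$ times around each point of $D$ relative to each point outside $\overline D$, where $\varepsilon=1$ (positively oriented boundary) or $\varepsilon=-1$ (opposite orientation); the oriented area is $\varepsilon\,\mathrm{Area}(D)$. Then: 1. $\mathbf n(t)=\mathbf n(t_0)$ for all $t$; that is, the motion is planar. 2. The total change of position is the rotation about $\mathbf n(t_0)$ through twice the oriented area: for every $i$, the vector $\mathbf a_i(t_1)/\rho(t_1)$ is obtained from $\mathbf a_i(t_0)/\rho(t_0)$ by the rotation through the angle $\varepsilon\iint_D 2\,dA$. 3. $d\Theta_i=2\,dA$ on $M^*\setminus\{p_i\}$. 4. If $\mathbf a_i(t)\neq0$ for all $t$, then the total angle $\Delta\varphi_i$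 (a real number, not only modulo $2\pi$) through which the vector $\mathbf a_i$ turns is $$\Delta\varphi_i=\int_{t_0}^{t_1}\omega_i^0\,dt=\oint_\gamma\Theta_i,\qquad \omega_i^0=\frac{I_{i+2}\,\dot\alpha_{i+1}-I_{i+1}\,\dot\alpha_{i+2}}{I},$$ with both integrands integrable, and $$\oint_\gamma\Theta_i=\varepsilon\iint_D 2\,dA\quad\text{if }p_i\notin D,\qquad \oint_\gamma\Theta_i=\varepsilon\Bigl(\iint_D 2\,dA-2\pi\Bigr)\quad\text{if }p_i\in D.$$ -/

import Mathlib

open scoped Matrix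

noncomputable section

namespace ThreeBody

open MeasureTheory Set

/-- Euclidean 3-space. -/
abbrev E3 : Type := EuclideanSpace ℝ (Fin 3)

/-- The cross product of Euclidean 3-space. -/
def cross (u v : E3) : E3 := WithLp.toLp 2 (u.ofLp ⨯₃ v.ofLp)

/-- The right-handed rotation through the angle `φ` about the axis of the unit vector `n`. -/
def rot (n : E3) (φ : ℝ) (v : E3) : E3 :=
  Real.cos φ • v + Real.sin φ • cross n v + ((1 - Real.cos φ) * inner ℝ n v) • n

/-! ### m-triangles

The vertices `P₁, P₂, P₃` are indexed by `0, 1, 2 : Fin 3`; `i + 1`, `i + 2` are cyclic. -/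

/-- A normalized mass distribution. -/
def IsMassDistribution (m : Fin 3 → ℝ) : Prop :=
  (∀ i, 0 < m i) ∧ ∑ i, m i = 1

/-- `(X, n)` is an oriented m-triangle: `X` is the triple of position vectors in a centre of mass
frame, and `n` is a unit vector perpendicular to all of them. -/
def IsOrientedTriangle (m : Fin 3 → ℝ) (X : Fin 3 → E3) (n : E3) : Prop :=
  ∑ i, m i • X i = 0 ∧ ‖n‖ = 1 ∧ ∀ i, inner ℝ n (X i) = 0

/-- The individual polar moments of inertia `I_i = m_i |a_i|²`. -/
def inertia (m : Fin 3 → ℝ) (X : Fin 3 → E3) (i : Fin 3) : ℝ := m i * ‖X i‖ ^ 2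

/-- The polar moment of inertia `I = I₁ + I₂ + I₃`. -/
def totalInertia (m : Fin 3 → ℝ) (X : Fin 3 → E3) : ℝ := ∑ i, inertia m X i

/-- The size `ρ = √I`. -/
def size (m : Fin 3 → ℝ) (X : Fin 3 → E3) : ℝ := Real.sqrt (totalInertia m X)

/-- The angular momentum `Ω = ∑ m_i a_i × ȧ_i` at the configuration `X` with velocity `V`. -/
def angularMomentum (m : Fin 3 → ℝ) (X V : Fin 3 → E3) : E3 :=
  ∑ i, m i • cross (X i) (V i)

/-- The position vectors lie on one line (an eclipse configuration, or `X = 0`). -/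
def IsEclipse (X : Fin 3 → E3) : Prop := ∀ i j, cross (X i) (X j) = 0

/-! ### Shape space

Through the Jacobi vectors, m-triangles in a plane with unit normal `n` become pairs of plane
vectors (`ℝ⁴ = ℂ²`) in such a way that `I` is the squared length. The shape, i.e. the class modulo
rotation and scaling, is the image under the Hopf map, a point of the round sphere `S²(1/2)`. -/

/-- First Jacobi vector. -/
def jacobi₁ (m : Fin 3 → ℝ) (X : Fin 3 → E3) : E3 := Real.sqrt (m 0 / (1 - m 0)) • X 0

/-- Second Jacobi vector. -/
def jacobi₂ (m : Fin 3 → ℝ) (X : Fin 3 → E3) : E3 :=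
  Real.sqrt (m 1 * m 2 / (1 - m 0)) • (X 2 - X 1)

/-- The shape of the oriented m-triangle `(X, n)`, `X ≠ 0`, in `S²(1/2)`. The northern hemisphere
consists of the positively oriented triangles, the equator of the eclipse shapes, and the zero
meridian passes through the binary collision `a₂ = a₃`. -/
def shape (m : Fin 3 → ℝ) (X : Fin 3 → E3) (n : E3) : E3 :=
  (2 * totalInertia m X)⁻¹ •
    !₂[‖jacobi₁ m X‖ ^ 2 - ‖jacobi₂ m X‖ ^ 2,
       2 * inner ℝ (jacobi₁ m X) (jacobi₂ m X),
       2 * inner ℝ n (cross (jacobi₂ m X) (jacobi₁ m X))]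

/-- The shape sphere `M^* = S²(1/2)`. -/
abbrev ShapeSphere : Type := Metric.sphere (0 : E3) (1 / 2)

/-- Scaling the unit sphere to `S²(1/2)`. -/
def halfScale (u : Metric.sphere (0 : E3) 1) : ShapeSphere :=
  ⟨(1 / 2 : ℝ) • (u : E3), by
    have h : ‖(u : E3)‖ = 1 := by simp
    rw [mem_sphere_zero_iff_norm, norm_smul, h]; norm_num⟩

/-- The Riemannian area `dA` of `S²(1/2)`: one quarter of the area of the unit sphere. -/
def shapeArea : Measure ShapeSphere :=
  (1 / 4 : ENNReal) • ((volume : Measure E3).toSphere).map halfScale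

/-- The area 2-form of `S²(1/2)` at `s`, for the outward orientation. -/
def areaForm (s u v : E3) : ℝ := inner ℝ ((2 : ℝ) • s) (cross u v)

/-- The shape of the binary collision `a_{i+1} = a_{i+2}`. -/
def binaryCollision (m : Fin 3 → ℝ) (i : Fin 3) : E3 :=
  shape m (fun j => (if j = i then 1 - m i else -m i) • !₂[1, 0, 0]) !₂[0, 0, 1]

/-- The shape of the m-triangles with `a_i = 0`. -/
def vertexAtCenter (m : Fin 3 → ℝ) (i : Fin 3) : E3 :=
  shape m (fun j => (if j = i then 0 else if j = i + 1 then m (i + 2) else -m (i + 1)) •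
    !₂[1, 0, 0]) !₂[0, 0, 1]

/-! ### Kinematic 1-forms and angular velocities -/

/-- The kinematic 1-form `Θ_i` on `S²(1/2)` at the point `s`, evaluated on the tangent vector `v`.
This is the expression of `I⁻¹ (I_{i+2} dα_{i+1} - I_{i+1} dα_{i+2})` which is smooth
across the equator, except at the point `a_i = 0`; see `kinematicForm_eq`. -/
def kinematicForm (m : Fin 3 → ℝ) (i : Fin 3) (s v : E3) : ℝ :=
  4 * inner ℝ (binaryCollision m i) (cross s v) / (1 + 4 * inner ℝ (binaryCollision m i) s)

/-- The scalar angular velocity `ω_j` of `a_j` in the plane with unit normal `n`. -/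
def angularVelocity (X V : Fin 3 → E3) (n : E3) (j : Fin 3) : ℝ :=
  inner ℝ n (cross (X j) (V j)) / ‖X j‖ ^ 2

/-- The rate of change of the central angle `α_j` from `a_{j+1}` to `a_{j+2}`. -/
def centralAngleRate (X V : Fin 3 → E3) (n : E3) (j : Fin 3) : ℝ :=
  angularVelocity X V n (j + 2) - angularVelocity X V n (j + 1)

/-- `ω_i⁰ = I⁻¹ (I_{i+2} α̇_{i+1} - I_{i+1} α̇_{i+2})`. -/
def omegaZero (m : Fin 3 → ℝ) (X V : Fin 3 → E3) (n : E3) (i : Fin 3) : ℝ :=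
  (inertia m X (i + 2) * centralAngleRate X V n (i + 1)
    - inertia m X (i + 1) * centralAngleRate X V n (i + 2)) / totalInertia m X

/-- Along `t₀ ≤ t ≤ t₁` the nonvanishing vector `a t` of the plane with unit normal `n` turns
through the total angle `δ`: there is a continuous angle function `φ` from `a t₀` to `a t`, and
`δ = φ t₁`. -/
def HasTotalRotation (n : E3) (a : ℝ → E3) (t₀ t₁ δ : ℝ) : Prop :=
  ∃ φ : ℝ → ℝ, ContinuousOn φ (Icc t₀ t₁) ∧ φ t₀ = 0 ∧ φ t₁ = δ ∧
    ∀ t ∈ Icc t₀ t₁, ‖a t‖⁻¹ • a t = rot n (φ t) (‖a t₀‖⁻¹ • a t₀)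

/-! ### Curves and boundaries -/

/-- `f` is piecewise continuously differentiable on `[t₀, t₁]`: `C¹` on each closed interval of
some subdivision. -/
def PiecewiseC1 {F : Type*} [NormedAddCommGroup F] [NormedSpace ℝ F] (f : ℝ → F) (t₀ t₁ : ℝ) :
    Prop :=
  ∃ (N : ℕ) (τ : ℕ → ℝ), Monotone τ ∧ τ 0 = t₀ ∧ τ N = t₁ ∧
    ∀ k < N, ContDiffOn ℝ 1 f (Icc (τ k) (τ (k + 1)))

/-- The plane curve `c` on `[t₀, t₁]` avoids `w`, and has winding number `k` about `w`. -/
def HasWindingNumber (c : ℝ → ℂ) (t₀ t₁ : ℝ) (w : ℂ) (k : ℤ) : Prop :=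
  ∃ θ : ℝ → ℝ, ContinuousOn θ (Icc t₀ t₁) ∧ θ t₁ - θ t₀ = 2 * Real.pi * k ∧
    ∀ t ∈ Icc t₀ t₁, c t ≠ w ∧ c t - w = ‖c t - w‖ * Complex.exp (θ t * Complex.I)

/-- Stereographic projection of `S²(1/2)` from `q`, in the coordinates of the vectors `e₁, e₂`. -/
def stereo (q e₁ e₂ s : E3) : ℂ :=
  ⟨inner ℝ s e₁ / (1 / 2 - inner ℝ s ((2 : ℝ) • q)),
    inner ℝ s e₂ / (1 / 2 - inner ℝ s ((2 : ℝ) • q))⟩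

/-- The closed curve `γ` on `S²(1/2)` winds `k` times around `p` relative to `q`: this is the
winding number about `p` in the plane obtained from the sphere by stereographic projection
from `q`. The orthonormal frame `e₁ × e₂ = - 2q` makes the projection orientation preserving. -/
def HasIndex (γ : ℝ → E3) (t₀ t₁ : ℝ) (p q : E3) (k : ℤ) : Prop :=
  ∃ e₁ e₂ : E3, ‖e₁‖ = 1 ∧ ‖e₂‖ = 1 ∧ inner ℝ e₁ e₂ = 0 ∧ cross e₁ e₂ = -((2 : ℝ) • q) ∧
    HasWindingNumber (fun t => stereo q e₁ e₂ (γ t)) t₀ t₁ (stereo q e₁ e₂ p) k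

/-- The curve `γ : [t₀, t₁] → S²(1/2)` is the boundary of the region `D`, with sign `ε`: `D` is open
and connected, `γ` is closed, its trace is the topological boundary of `D`, and `γ` winds `ε` times
around the points of `D` relative to the points outside `D`. For `ε = 1` this says that `γ` is the
positively oriented boundary, for `ε = -1` that it is the boundary with the opposite
orientation. -/
def IsOrientedBoundary (γ : ℝ → E3) (t₀ t₁ : ℝ) (D : Set ShapeSphere) (ε : ℤ) : Prop :=
  IsOpen D ∧ IsConnected D ∧ γ t₀ = γ t₁ ∧
    (Subtype.val '' frontier D : Set E3) = γ '' Icc t₀ t₁ ∧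
    ∀ p ∈ D, ∀ q ∉ closure D, HasIndex γ t₀ t₁ p q ε

/-! ### Consistency of the definitions -/

theorem inner_eq (u v : E3) : inner ℝ u v = u 0 * v 0 + u 1 * v 1 + u 2 * v 2 := by
  simp [PiLp.inner_apply, Fin.sum_univ_three]; ring

theorem norm_sq_eq (u : E3) : ‖u‖ ^ 2 = u 0 ^ 2 + u 1 ^ 2 + u 2 ^ 2 := by
  rw [EuclideanSpace.norm_sq_eq]; simp [Fin.sum_univ_three]

@[simp] theorem cross_zero (u v : E3) : cross u v 0 = u 1 * v 2 - u 2 * v 1 := by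
  simp [cross, cross_apply]
@[simp] theorem cross_one (u v : E3) : cross u v 1 = u 2 * v 0 - u 0 * v 2 := by
  simp [cross, cross_apply]
@[simp] theorem cross_two (u v : E3) : cross u v 2 = u 0 * v 1 - u 1 * v 0 := by
  simp [cross, cross_apply]

theorem IsMassDistribution.pos {m : Fin 3 → ℝ} (hm : IsMassDistribution m) (i : Fin 3) :
    0 < m i ∧ 0 < 1 - m i := by
  obtain ⟨h, hs⟩ := hm
  rw [Fin.sum_univ_three] at hs
  refine ⟨h i, ?_⟩
  have := h 0; have := h 1; have := h 2
  fin_cases i <;> simp <;> linarith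

theorem norm_sq_jacobi {m : Fin 3 → ℝ} (hm : IsMassDistribution m) {X : Fin 3 → E3}
    (hX : ∑ i, m i • X i = 0) :
    ‖jacobi₁ m X‖ ^ 2 + ‖jacobi₂ m X‖ ^ 2 = totalInertia m X := by
  have hp := hm.pos
  have hs := hm.2
  rw [Fin.sum_univ_three] at hs
  have h0 := hp 0; have h1 := hp 1; have h2 := hp 2
  have hc : ∀ k, m 0 * X 0 k + m 1 * X 1 k + m 2 * X 2 k = 0 := by
    intro k
    have := congrArg (fun v : E3 => v k) hX
    simpa [Fin.sum_univ_three] using this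
  have key : ∀ x y z : ℝ, m 0 * x + m 1 * y + m 2 * z = 0 →
      m 0 / (1 - m 0) * x ^ 2 + m 1 * m 2 / (1 - m 0) * (z - y) ^ 2
        = m 0 * x ^ 2 + m 1 * y ^ 2 + m 2 * z ^ 2 := by
    intro x y z h
    have e : 1 - m 0 = m 1 + m 2 := by linarith
    have ne : m 1 + m 2 ≠ 0 := by linarith
    have hx : m 0 * x = -(m 1 * y + m 2 * z) := by linarith
    rw [e]
    field_simp
    have e0 : m 0 = 1 - m 1 - m 2 := by linarith
    have : m 0 * x ^ 2 * (1 - (m 1 + m 2)) = (m 1 * y + m 2 * z) ^ 2 := by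
      rw [show 1 - (m 1 + m 2) = m 0 by linarith]
      linear_combination (m 0 * x - (m 1 * y + m 2 * z)) * hx
    linear_combination this
  have hq : 0 ≤ m 0 / (1 - m 0) := by have := h0.2; have := h0.1; positivity
  have hr : 0 ≤ m 1 * m 2 / (1 - m 0) := by
    have := h0.2; have := h1.1; have := h2.1; positivity
  simp only [jacobi₁, jacobi₂, norm_smul, mul_pow, Real.norm_eq_abs, sq_abs, Real.sq_sqrt hq,
    Real.sq_sqrt hr, totalInertia, inertia, Fin.sum_univ_three, norm_sq_eq, PiLp.sub_apply]
  linear_combination key _ _ _ (hc 0) + key _ _ _ (hc 1) + key _ _ _ (hc 2)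

theorem totalInertia_pos {m : Fin 3 → ℝ} (hm : IsMassDistribution m) {X : Fin 3 → E3}
    (hX : X ≠ 0) : 0 < totalInertia m X := by
  obtain ⟨i, hi⟩ := Function.ne_iff.1 hX
  refine Finset.sum_pos' (fun j _ => mul_nonneg (hm.1 j).le (sq_nonneg _)) ⟨i, Finset.mem_univ _, ?_⟩
  exact mul_pos (hm.1 i) (pow_pos (norm_pos_iff.2 hi) 2)

/-- The shape is a point of `S²(1/2)`. -/
theorem shape_mem {m : Fin 3 → ℝ} (hm : IsMassDistribution m) {X : Fin 3 → E3} {n : E3}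
    (h : IsOrientedTriangle m X n) (hX : X ≠ 0) :
    shape m X n ∈ Metric.sphere (0 : E3) (1 / 2) := by
  obtain ⟨hc, hn, ho⟩ := h
  have hI := totalInertia_pos hm hX
  have hJ := norm_sq_jacobi hm hc
  have p₁ : inner ℝ n (jacobi₁ m X) = 0 := by simp [jacobi₁, inner_smul_right, ho]
  have p₂ : inner ℝ n (jacobi₂ m X) = 0 := by
    simp [jacobi₂, inner_smul_right, inner_sub_right, ho]
  have hn2 : ‖n‖ ^ 2 = 1 := by rw [hn]; norm_num
  rw [mem_sphere_zero_iff_norm]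
  have : ‖shape m X n‖ ^ 2 = (1 / 2) ^ 2 := by
    rw [norm_sq_eq]
    simp only [shape, PiLp.smul_apply, smul_eq_mul]
    generalize jacobi₁ m X = u at *
    generalize jacobi₂ m X = v at *
    rw [← hJ] at hI ⊢
    simp only [inner_eq, norm_sq_eq, cross_zero, cross_one, cross_two] at *
    simp
    have det : (n 0 * (v 1 * u 2 - v 2 * u 1) + n 1 * (v 2 * u 0 - v 0 * u 2)
        + n 2 * (v 0 * u 1 - v 1 * u 0)) ^ 2 =
        (u 0 ^ 2 + u 1 ^ 2 + u 2 ^ 2) * (v 0 ^ 2 + v 1 ^ 2 + v 2 ^ 2)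
          - (u 0 * v 0 + u 1 * v 1 + u 2 * v 2) ^ 2 := by
      linear_combination ((u 0 ^ 2 + u 1 ^ 2 + u 2 ^ 2) * (v 0 ^ 2 + v 1 ^ 2 + v 2 ^ 2)
          - (u 0 * v 0 + u 1 * v 1 + u 2 * v 2) ^ 2) * hn2
        - ((n 0 * u 0 + n 1 * u 1 + n 2 * u 2) * (v 0 ^ 2 + v 1 ^ 2 + v 2 ^ 2)
          - 2 * (n 0 * v 0 + n 1 * v 1 + n 2 * v 2) * (u 0 * v 0 + u 1 * v 1 + u 2 * v 2)) * p₁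
        - (n 0 * v 0 + n 1 * v 1 + n 2 * v 2) * (u 0 ^ 2 + u 1 ^ 2 + u 2 ^ 2) * p₂
    have hI' := hI.ne'
    field_simp
    linear_combination 4 * det
  exact (pow_left_inj₀ (norm_nonneg _) (by norm_num) (by norm_num)).1 this

theorem shape_coord {m : Fin 3 → ℝ} (hm : IsMassDistribution m) (X : Fin 3 → E3) (n : E3) :
    shape m X n = (2 * totalInertia m X)⁻¹ •
      !₂[m 0 / (1 - m 0) * ‖X 0‖ ^ 2 - m 1 * m 2 / (1 - m 0) * ‖X 2 - X 1‖ ^ 2,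
        2 * (Real.sqrt (m 0 * m 1 * m 2) / (1 - m 0)) * inner ℝ (X 0) (X 2 - X 1),
        2 * (Real.sqrt (m 0 * m 1 * m 2) / (1 - m 0)) * inner ℝ n (cross (X 2 - X 1) (X 0))] := by
  obtain ⟨h0, h0'⟩ := hm.pos 0
  have h1 := hm.1 1
  have h2 := hm.1 2
  have hq : 0 ≤ m 0 / (1 - m 0) := by positivity
  have hr : 0 ≤ m 1 * m 2 / (1 - m 0) := by positivity
  have hp : Real.sqrt (m 0 / (1 - m 0)) * Real.sqrt (m 1 * m 2 / (1 - m 0))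
      = Real.sqrt (m 0 * m 1 * m 2) / (1 - m 0) := by
    rw [← Real.sqrt_mul hq, ← Real.sqrt_sq h0'.le, ← Real.sqrt_div (by positivity),
      Real.sqrt_sq h0'.le]
    congr 1
    field_simp
  have hc : cross (jacobi₂ m X) (jacobi₁ m X) =
      (Real.sqrt (m 0 * m 1 * m 2) / (1 - m 0)) • cross (X 2 - X 1) (X 0) := by
    rw [← hp]
    ext k
    fin_cases k <;> simp [jacobi₁, jacobi₂] <;> ring
  rw [shape, hc, ← hp]
  congr 2
  simp only [jacobi₁, jacobi₂, norm_smul, mul_pow, Real.norm_eq_abs, sq_abs, Real.sq_sqrt hq,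
    Real.sq_sqrt hr, inner_smul_left, inner_smul_right]
  simp
  constructor <;> ring

theorem binaryCollision_coord {m : Fin 3 → ℝ} (hm : IsMassDistribution m) :
    binaryCollision m 0 = !₂[1 / 2, 0, 0] ∧
    binaryCollision m 1 = !₂[(m 0 * m 1 - m 2) / (2 * ((1 - m 0) * (1 - m 1))),
      Real.sqrt (m 0 * m 1 * m 2) / ((1 - m 0) * (1 - m 1)), 0] ∧
    binaryCollision m 2 = !₂[(m 0 * m 2 - m 1) / (2 * ((1 - m 0) * (1 - m 2))),
      -Real.sqrt (m 0 * m 1 * m 2) / ((1 - m 0) * (1 - m 2)), 0] := by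
  obtain ⟨h0, h0'⟩ := hm.pos 0
  obtain ⟨h1, h1'⟩ := hm.pos 1
  obtain ⟨h2, h2'⟩ := hm.pos 2
  have hs := hm.2
  rw [Fin.sum_univ_three] at hs
  have e2 : m 2 = 1 - m 0 - m 1 := by linarith
  refine ⟨?_, ?_, ?_⟩
  · rw [binaryCollision, shape_coord hm]
    have hI : totalInertia m (fun j => (if j = 0 then 1 - m 0 else -m 0) • !₂[1, 0, 0])
        = m 0 * (1 - m 0) := by
      simp [totalInertia, inertia, Fin.sum_univ_three, norm_sq_eq]
      rw [e2]; ring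
    rw [hI]
    ext k
    fin_cases k <;> simp [norm_sq_eq, inner_eq]
    field_simp
  · rw [binaryCollision, shape_coord hm]
    have hI : totalInertia m (fun j => (if j = 1 then 1 - m 1 else -m 1) • !₂[1, 0, 0])
        = m 1 * (1 - m 1) := by
      simp [totalInertia, inertia, Fin.sum_univ_three, norm_sq_eq]
      rw [e2]; ring
    rw [hI]
    ext k
    fin_cases k <;> simp [norm_sq_eq, inner_eq]
    · field_simp
      rw [e2]; ring
    · field_simp
      ring
  · rw [binaryCollision, shape_coord hm]
    have hI : totalInertia m (fun j => (if j = 2 then 1 - m 2 else -m 2) • !₂[1, 0, 0])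
        = m 2 * (1 - m 2) := by
      simp [totalInertia, inertia, Fin.sum_univ_three, norm_sq_eq]
      rw [e2]; ring
    rw [hI]
    ext k
    fin_cases k <;> simp [norm_sq_eq, inner_eq]
    · field_simp
    · field_simp
      try ring

/-- The individual moments of inertia are affine functions of the shape. -/
theorem inertia_eq {m : Fin 3 → ℝ} (hm : IsMassDistribution m) {X : Fin 3 → E3} {n : E3}
    (h : IsOrientedTriangle m X n) (hX : X ≠ 0) (i : Fin 3) :
    inertia m X i / totalInertia m X =
      (1 - m i) / 2 * (1 + 4 * inner ℝ (binaryCollision m i) (shape m X n)) := by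
  obtain ⟨h0, h0'⟩ := hm.pos 0
  obtain ⟨h1, h1'⟩ := hm.pos 1
  obtain ⟨h2, h2'⟩ := hm.pos 2
  have hs := hm.2
  rw [Fin.sum_univ_three] at hs
  have e2 : m 2 = 1 - m 0 - m 1 := by linarith
  have hI := totalInertia_pos hm hX
  have hI' : totalInertia m X = m 0 * ‖X 0‖ ^ 2 + m 1 * ‖X 1‖ ^ 2 + m 2 * ‖X 2‖ ^ 2 := by
    simp [totalInertia, inertia, Fin.sum_univ_three]
  have hc : ∀ k, m 0 * X 0 k + m 1 * X 1 k + m 2 * X 2 k = 0 := by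
    intro k
    have := congrArg (fun v : E3 => v k) h.1
    simpa [Fin.sum_univ_three] using this
  obtain ⟨b0, b1, b2⟩ := binaryCollision_coord hm
  have hr : Real.sqrt (m 0 * m 1 * m 2) ^ 2 = m 0 * m 1 * m 2 := Real.sq_sqrt (by positivity)
  have key : ∀ x y z : ℝ, m 0 * x + m 1 * y + m 2 * z = 0 →
      m 0 * (m 0 * x ^ 2) = m 1 ^ 2 * y ^ 2 + 2 * m 1 * m 2 * (y * z) + m 2 ^ 2 * z ^ 2 ∧
      m 0 * (x * (z - y)) = m 1 * y ^ 2 - m 2 * z ^ 2 + (m 2 - m 1) * (y * z) := by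
    intro x y z hxyz
    constructor
    · linear_combination (m 0 * x - m 1 * y - m 2 * z) * hxyz
    · linear_combination (z - y) * hxyz
  have hA : m 0 * (m 0 * ‖X 0‖ ^ 2) = m 1 ^ 2 * ‖X 1‖ ^ 2 + 2 * m 1 * m 2 * inner ℝ (X 1) (X 2)
      + m 2 ^ 2 * ‖X 2‖ ^ 2 := by
    simp only [norm_sq_eq, inner_eq]
    linear_combination (key _ _ _ (hc 0)).1 + (key _ _ _ (hc 1)).1 + (key _ _ _ (hc 2)).1
  have hB : m 0 * inner ℝ (X 0) (X 2 - X 1) = m 1 * ‖X 1‖ ^ 2 - m 2 * ‖X 2‖ ^ 2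
      + (m 2 - m 1) * inner ℝ (X 1) (X 2) := by
    simp only [norm_sq_eq, inner_eq, PiLp.sub_apply]
    linear_combination (key _ _ _ (hc 0)).2 + (key _ _ _ (hc 1)).2 + (key _ _ _ (hc 2)).2
  have hC : ‖X 2 - X 1‖ ^ 2 = ‖X 1‖ ^ 2 - 2 * inner ℝ (X 1) (X 2) + ‖X 2‖ ^ 2 := by
    simp only [norm_sq_eq, inner_eq, PiLp.sub_apply]
    ring
  rw [shape_coord hm, inertia, inner_eq]
  have hIn := hI.ne'
  generalize Real.sqrt (m 0 * m 1 * m 2) = r at *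
  generalize totalInertia m X = I at *
  generalize inner ℝ (X 0) (X 2 - X 1) = B at *
  generalize ‖X 2 - X 1‖ ^ 2 = C at *
  generalize inner ℝ (X 1) (X 2) = P at *
  have hx : ‖X 0‖ ^ 2 =
      (m 1 ^ 2 * ‖X 1‖ ^ 2 + 2 * m 1 * m 2 * P + m 2 ^ 2 * ‖X 2‖ ^ 2) / m 0 ^ 2 := by
    rw [eq_div_iff (by positivity)]; linarith
  have hB' : B = (m 1 * ‖X 1‖ ^ 2 - m 2 * ‖X 2‖ ^ 2 + (m 2 - m 1) * P) / m 0 := by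
    rw [eq_div_iff (by positivity)]; linarith
  have h12 : 0 < m 1 + m 2 := by linarith
  have e0 : m 0 = 1 - m 1 - m 2 := by linarith
  fin_cases i
  · simp [b0]
    field_simp
    rw [hC, hI', hx]
    field_simp
    rw [e2]; ring
  · simp [b1]
    field_simp
    rw [hr, hC, hI', hB', hx]
    field_simp
    rw [e2]; ring
  · simp [b2]
    field_simp
    rw [hr, hC, hI', hB', hx]
    field_simp
    rw [e2]; ring


/-- The signed area `Δ` of the unit size triangles of shape `s`. -/
def shapeSignedArea (m : Fin 3 → ℝ) (s : E3) : ℝ := s 2 / (2 * Real.sqrt (m 0 * m 1 * m 2))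

/-- `I_j` of the unit size triangles of shape `s`. -/
def shapeInertia (m : Fin 3 → ℝ) (j : Fin 3) (s : E3) : ℝ :=
  (1 - m j) / 2 * (1 + 4 * inner ℝ (binaryCollision m j) s)

/-- The differential of `shapeInertia`. -/
def shapeInertiaDiff (m : Fin 3 → ℝ) (j : Fin 3) (v : E3) : ℝ :=
  2 * (1 - m j) * inner ℝ (binaryCollision m j) v

/-- `C_j = -m_j I_j + m_{j+1} I_{j+1} + m_{j+2} I_{j+2}`. -/
def shapeC (m : Fin 3 → ℝ) (j : Fin 3) (s : E3) : ℝ :=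
  -(m j * shapeInertia m j s) + m (j + 1) * shapeInertia m (j + 1) s
    + m (j + 2) * shapeInertia m (j + 2) s

theorem kinematicForm_aux {a b c r X Y z x y w P₂ P₃ Q₂ Q₃ : ℝ}
    (ha : 0 < a) (hb : 0 < b) (hc : 0 < c) (hs : a + b + c = 1) (hr : r ^ 2 = a * b * c)
    (hX : X ^ 2 + Y ^ 2 + z ^ 2 = 1 / 4) (hx : X * x + Y * y + z * w = 0) (hz : z ≠ 0)
    (hP₂ : (1 - a) * (1 - b) * P₂ = (a * b - c) / 2 * X + r * Y)
    (hP₃ : (1 - a) * (1 - c) * P₃ = (a * c - b) / 2 * X - r * Y)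
    (hQ₂ : (1 - a) * (1 - b) * Q₂ = (a * b - c) / 2 * x + r * y)
    (hQ₃ : (1 - a) * (1 - c) * Q₃ = (a * c - b) / 2 * x - r * y)
    {J₁ J₂ J₃ : ℝ} (hJ₁ : J₁ = (1 - a) / 2 * (1 + 2 * X)) (hJ₂ : J₂ = (1 - b) / 2 * (1 + 4 * P₂))
    (hJ₃ : J₃ = (1 - c) / 2 * (1 + 4 * P₃)) :
    2 * (Y * w - z * y) / (1 + 2 * X) =
      (8 * (a * b * c) * (z / (2 * r)))⁻¹ *
        (((a * J₁ + b * J₂ - c * J₃) * J₃ - (c * J₃ + a * J₁ - b * J₂) * J₂) *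
            ((1 - a) * x / J₁)
          - (-(a * J₁) + b * J₂ + c * J₃ + 2 * b * J₃) * (2 * (1 - b) * Q₂)
          + (-(a * J₁) + b * J₂ + c * J₃ + 2 * c * J₂) * (2 * (1 - c) * Q₃)) := by
  have a1 : 0 < 1 - a := by linarith
  have b1 : 0 < 1 - b := by linarith
  have c1 : 0 < 1 - c := by linarith
  have hX1 : 0 < 1 + 2 * X := by
    have : 0 < z ^ 2 := by positivity
    nlinarith [sq_nonneg Y, sq_nonneg (1 + 2 * X)]
  have hP₂' : P₂ = ((a * b - c) / 2 * X + r * Y) / ((1 - a) * (1 - b)) := by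
    rw [eq_div_iff (by positivity)]; linarith
  have hP₃' : P₃ = ((a * c - b) / 2 * X - r * Y) / ((1 - a) * (1 - c)) := by
    rw [eq_div_iff (by positivity)]; linarith
  have hQ₂' : Q₂ = ((a * b - c) / 2 * x + r * y) / ((1 - a) * (1 - b)) := by
    rw [eq_div_iff (by positivity)]; linarith
  have hQ₃' : Q₃ = ((a * c - b) / 2 * x - r * y) / ((1 - a) * (1 - c)) := by
    rw [eq_div_iff (by positivity)]; linarith
  have hw : w = -(X * x + Y * y) / z := by
    rw [eq_div_iff hz]; linarith
  have hz2 : z ^ 2 = 1 / 4 - X ^ 2 - Y ^ 2 := by linarith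
  have hq : r ≠ 0 := by
    intro h
    have : 0 < a * b * c := by positivity
    rw [← hr, h] at this
    norm_num at this
  have e2 : c = 1 - a - b := by linarith
  clear hP₂ hP₃ hQ₂ hQ₃ hX hx
  subst hw hJ₁ hJ₂ hJ₃ hP₂' hP₃' hQ₂' hQ₃'
  have hX2 : 1 + 2 * X ≠ 0 := hX1.ne'
  field_simp
  rw [hz2]
  subst e2
  ring_nf
  simp only [hr]
  ring

/-- Off the equator, the kinematic form in terms of `I_j`, `dI_j` and `Δ`. -/
theorem kinematicForm_eq {m : Fin 3 → ℝ} (hm : IsMassDistribution m) (i : Fin 3) {s v : E3}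
    (hs : ‖s‖ = 1 / 2) (hv : inner ℝ s v = 0) (h2 : s 2 ≠ 0) :
    kinematicForm m i s v =
      (8 * m 0 * m 1 * m 2 * shapeSignedArea m s)⁻¹ *
        ((shapeC m (i + 2) s * shapeInertia m (i + 2) s
            - shapeC m (i + 1) s * shapeInertia m (i + 1) s)
              * (shapeInertiaDiff m i v / shapeInertia m i s)
          - (shapeC m i s + 2 * m (i + 1) * shapeInertia m (i + 2) s)
              * shapeInertiaDiff m (i + 1) v
          + (shapeC m i s + 2 * m (i + 2) * shapeInertia m (i + 1) s)
              * shapeInertiaDiff m (i + 2) v) := by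
  obtain ⟨h0, h0'⟩ := hm.pos 0
  obtain ⟨h1, h1'⟩ := hm.pos 1
  obtain ⟨hm2, hm2'⟩ := hm.pos 2
  have hsum := hm.2
  rw [Fin.sum_univ_three] at hsum
  have e2 : m 2 = 1 - m 0 - m 1 := by linarith
  obtain ⟨b0, b1, b2⟩ := binaryCollision_coord hm
  have hr : Real.sqrt (m 0 * m 1 * m 2) ^ 2 = m 0 * m 1 * m 2 := Real.sq_sqrt (by positivity)
  have hs' : s 0 ^ 2 + s 1 ^ 2 + s 2 ^ 2 = 1 / 4 := by rw [← norm_sq_eq, hs]; norm_num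
  rw [inner_eq] at hv
  have hrel : binaryCollision m i 2 = 0 ∧ binaryCollision m (i + 1) 2 = 0 ∧
      binaryCollision m (i + 2) 2 = 0 ∧
      binaryCollision m i 0 ^ 2 + binaryCollision m i 1 ^ 2 = 1 / 4 ∧
      (1 - m i) * (1 - m (i + 1)) * binaryCollision m (i + 1) 0 =
        (m i * m (i + 1) - m (i + 2)) * binaryCollision m i 0
          - 2 * Real.sqrt (m 0 * m 1 * m 2) * binaryCollision m i 1 ∧
      (1 - m i) * (1 - m (i + 1)) * binaryCollision m (i + 1) 1 =
        (m i * m (i + 1) - m (i + 2)) * binaryCollision m i 1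
          + 2 * Real.sqrt (m 0 * m 1 * m 2) * binaryCollision m i 0 ∧
      (1 - m i) * (1 - m (i + 2)) * binaryCollision m (i + 2) 0 =
        (m i * m (i + 2) - m (i + 1)) * binaryCollision m i 0
          + 2 * Real.sqrt (m 0 * m 1 * m 2) * binaryCollision m i 1 ∧
      (1 - m i) * (1 - m (i + 2)) * binaryCollision m (i + 2) 1 =
        (m i * m (i + 2) - m (i + 1)) * binaryCollision m i 1
          - 2 * Real.sqrt (m 0 * m 1 * m 2) * binaryCollision m i 0 ∧
      m i + m (i + 1) + m (i + 2) = 1 ∧ m i * m (i + 1) * m (i + 2) = m 0 * m 1 * m 2 := by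
    generalize Real.sqrt (m 0 * m 1 * m 2) = r at *
    fin_cases i
    · simp [b0, b1, b2]
      refine ⟨by norm_num, ?_, ?_, ?_, ?_, ?_⟩ <;> field_simp <;> linarith
    · simp [b0, b1, b2]
      refine ⟨?_, ?_, ?_, ?_, ?_, ?_, ?_⟩ <;> field_simp <;> (try rw [hr]) <;> (try rw [e2]) <;> ring
    · simp [b0, b1, b2]
      refine ⟨?_, ?_, ?_, ?_, ?_, ?_, ?_⟩ <;> field_simp <;> (try rw [hr]) <;> (try rw [e2]) <;> ring
  obtain ⟨z0, z1, z2, hn, r1, r2, r3, r4, hsum', hprod⟩ := hrel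
  have hP : 8 * m 0 * m 1 * m 2 = 8 * (m i * m (i + 1) * m (i + 2)) := by rw [hprod]; ring
  have hr' := hr.trans hprod.symm
  have ht : i + 1 + 2 = i ∧ i + 1 + 1 = i + 2 ∧ i + 2 + 1 = i ∧ i + 2 + 2 = i + 1 := by
    fin_cases i <;> simp
  obtain ⟨t1, t2, t3, t4⟩ := ht
  have core := kinematicForm_aux
    (X := 2 * (binaryCollision m i 0 * s 0 + binaryCollision m i 1 * s 1))
    (Y := 2 * (binaryCollision m i 0 * s 1 - binaryCollision m i 1 * s 0))
    (x := 2 * (binaryCollision m i 0 * v 0 + binaryCollision m i 1 * v 1))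
    (y := 2 * (binaryCollision m i 0 * v 1 - binaryCollision m i 1 * v 0))
    (P₂ := inner ℝ (binaryCollision m (i + 1)) s) (P₃ := inner ℝ (binaryCollision m (i + 2)) s)
    (Q₂ := inner ℝ (binaryCollision m (i + 1)) v) (Q₃ := inner ℝ (binaryCollision m (i + 2)) v)
    (z := s 2) (w := v 2)
    (hm.1 i) (hm.1 (i + 1)) (hm.1 (i + 2)) hsum' hr'
    (by linear_combination hs' + 4 * (s 0 ^ 2 + s 1 ^ 2) * hn)
    (by linear_combination hv + 4 * (s 0 * v 0 + s 1 * v 1) * hn) h2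
    (by rw [inner_eq, z1]; linear_combination s 0 * r1 + s 1 * r2)
    (by rw [inner_eq, z2]; linear_combination s 0 * r3 + s 1 * r4)
    (by rw [inner_eq, z1]; linear_combination v 0 * r1 + v 1 * r2)
    (by rw [inner_eq, z2]; linear_combination v 0 * r3 + v 1 * r4) rfl rfl rfl
  have e1 : kinematicForm m i s v = 2 * (2 * (binaryCollision m i 0 * s 1
      - binaryCollision m i 1 * s 0) * v 2 - s 2 * (2 * (binaryCollision m i 0 * v 1
      - binaryCollision m i 1 * v 0))) /
      (1 + 2 * (2 * (binaryCollision m i 0 * s 0 + binaryCollision m i 1 * s 1))) := by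
    simp only [kinematicForm, inner_eq, cross_zero, cross_one, cross_two, z0]
    congr 1 <;> ring
  rw [e1, core]
  simp only [shapeC, shapeInertia, shapeInertiaDiff, shapeSignedArea, t1, t2, t3, t4, hP]
  have eI : 2 * (2 * (binaryCollision m i 0 * s 0 + binaryCollision m i 1 * s 1))
      = 4 * inner ℝ (binaryCollision m i) s := by rw [inner_eq, z0]; ring
  have eD : (1 - m i) * (2 * (binaryCollision m i 0 * v 0 + binaryCollision m i 1 * v 1))
      = 2 * (1 - m i) * inner ℝ (binaryCollision m i) v := by rw [inner_eq, z0]; ring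
  rw [eI, eD]
  congr 1
  ring

theorem norm_binaryCollision {m : Fin 3 → ℝ} (hm : IsMassDistribution m) (i : Fin 3) :
    ‖binaryCollision m i‖ = 1 / 2 := by
  have hs := hm.2
  rw [Fin.sum_univ_three] at hs
  rw [← mem_sphere_zero_iff_norm]
  refine shape_mem hm ⟨?_, ?_, ?_⟩ ?_
  · ext k
    fin_cases i <;> fin_cases k <;> simp [Fin.sum_univ_three] <;>
      first
        | linear_combination (-m 0) * hs
        | linear_combination (-m 1) * hs
        | linear_combination (-m 2) * hs
  · simp [EuclideanSpace.norm_eq, Fin.sum_univ_three]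
  · intro j
    simp only [inner_eq]
    split_ifs <;> simp
  · intro h
    have := congrArg (fun v : E3 => v 0) (congrFun h i)
    have h' := (hm.pos i).2
    simp at this
    linarith

/-- The shape is the point `-binaryCollision m i` exactly when `a_i = 0`. -/
theorem shape_eq_neg_iff {m : Fin 3 → ℝ} (hm : IsMassDistribution m) {X : Fin 3 → E3} {n : E3}
    (h : IsOrientedTriangle m X n) (hX : X ≠ 0) (i : Fin 3) :
    shape m X n = -binaryCollision m i ↔ X i = 0 := by
  have hI := totalInertia_pos hm hX
  have hi := inertia_eq hm h hX i
  have hb := norm_binaryCollision hm i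
  have hs : ‖shape m X n‖ = 1 / 2 := mem_sphere_zero_iff_norm.1 (shape_mem hm h hX)
  have hmi := hm.pos i
  constructor
  · intro e
    rw [e, inner_neg_right, real_inner_self_eq_norm_sq, hb] at hi
    have h0 : inertia m X i = 0 := by
      have : inertia m X i / totalInertia m X = 0 := by rw [hi]; norm_num
      rcases div_eq_zero_iff.1 this with h | h
      · exact h
      · exact absurd h hI.ne'
    rw [inertia] at h0
    rcases mul_eq_zero.1 h0 with h | h
    · exact absurd h hmi.1.ne'
    · exact norm_eq_zero.1 (pow_eq_zero_iff two_ne_zero |>.1 h)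
  · intro e
    have h0 : 1 + 4 * inner ℝ (binaryCollision m i) (shape m X n) = 0 := by
      have : (1 - m i) / 2 * (1 + 4 * inner ℝ (binaryCollision m i) (shape m X n)) = 0 := by
        rw [← hi, inertia, e]; simp
      rcases mul_eq_zero.1 this with h | h
      · exact absurd h (half_pos hmi.2).ne'
      · exact h
    have : ‖shape m X n + binaryCollision m i‖ ^ 2 = 0 := by
      rw [norm_add_sq_real, hs, hb, real_inner_comm]
      linarith
    exact eq_neg_of_add_eq_zero_left (norm_eq_zero.1 (pow_eq_zero_iff two_ne_zero |>.1 this))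

theorem vertexAtCenter_eq {m : Fin 3 → ℝ} (hm : IsMassDistribution m) (i : Fin 3) :
    vertexAtCenter m i = -binaryCollision m i := by
  refine (shape_eq_neg_iff hm ⟨?_, ?_, ?_⟩ ?_ i).2 ?_
  · ext k
    fin_cases i <;> fin_cases k <;> simp [Fin.sum_univ_three] <;> ring
  · simp [EuclideanSpace.norm_eq, Fin.sum_univ_three]
  · intro j
    simp only [inner_eq]
    split_ifs <;> simp
  · intro h
    have := congrArg (fun v : E3 => v 0) (congrFun h (i + 1))
    have h' := (hm.pos (i + 2)).1.ne'
    simp at this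
    exact h' this
  · simp

end ThreeBody

end

/-! The normal is fixed because angular momentum controls its derivative. Differentiating `n · a_i =
0` and pairing `Ω = 0` with `n × ṅ` gives `∑ m_i (ṅ · a_i)² = 0`. So `ṅ` is orthogonal to every
`a_i` and to `n`, and vanishes unless the triangle is collinear, where its vanishing is assumed
(`normal_eq`).

The motion then lies in one plane, identified with `ℂ`. The Jacobi vectors form a curve in `ℂ² \
{0}` over the shape curve `γ`, and `Ω = 0` says that this curve is horizontal for the Hopf fibration
(`im_conj_jacobi`). Along a horizontal curve, every Hermitian coordinate `⟨d, z⟩` turns with the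
speed given by a form `poleForm` on the sphere, which depends only on `γ` and has its pole at the
shape where the coordinate vanishes (`angularSpeed_herm`). The vector `m_i a_i` is such a
coordinate, with `d` the Jacobi coordinates of a binary collision (`herm_collisionCoord`), and its
form is `Θ_i`. The formula for `dΘ_i` is a direct computation (`poleForm_fderiv`).

It remains to integrate a pole form along the boundary of `D`. Since `D` is an arbitrary region
whose boundary is the trace of a piecewise `C¹` curve, an averaging argument takes the place of
Stokes' theorem. Let `P(q)` be the integral along `γ` of the form with pole `q`. The forms with
poles `q` and `p` differ by the differential of the angle seen from `p` in the stereographic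
projection from `q`, so `P(q) - P(p)` is `2π` times the index of `γ` about `p` relative to `q`.
Hence `P` is a constant `a` outside the closure of `D` and `a - 2πε` on `D`. The mean of `P` over
all poles is zero, because for each tangent vector a reflection changes the sign of the integrand
(`integral_poleForm_radial`), and the curve itself is null. The sphere has area `π`, so `π a = 2πε
Area(D)` and `a = 2ε Area(D)` (`poleIntegral_eq`).

For the change of position, a pole `p` in `D` is never met by `γ`. It yields one coordinate whose
turning is known modulo `2π`. The endpoints of the lift lie over the same shape, hence are
proportional, and this coordinate determines the common factor (`exists_holonomy`). -/

noncomputable section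

namespace ThreeBody

open MeasureTheory Set

/-! ### Piecewise `C¹` functions -/

section PiecewiseC1

variable {F G : Type*} [NormedAddCommGroup F] [NormedSpace ℝ F] [NormedAddCommGroup G]
  [NormedSpace ℝ G] {f : ℝ → F} {t₀ t₁ : ℝ}

/-- The subdivision of `f` serves for `g` as well. Asking for the implication on every subset of the
interval keeps pointwise facts, such as nonvanishing denominators, available to the user. -/
theorem PiecewiseC1.comp {g : ℝ → G} (h : PiecewiseC1 f t₀ t₁)
    (hg : ∀ s ⊆ Icc t₀ t₁, ContDiffOn ℝ 1 f s → ContDiffOn ℝ 1 g s) : PiecewiseC1 g t₀ t₁ := by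
  obtain ⟨N, τ, hτ, h0, h1, h⟩ := h
  refine ⟨N, τ, hτ, h0, h1, fun k hk => hg _ (Icc_subset_Icc ?_ ?_) (h k hk)⟩
  · exact h0 ▸ hτ (Nat.zero_le k)
  · exact h1 ▸ hτ hk

theorem PiecewiseC1.continuousOn (h : PiecewiseC1 f t₀ t₁) : ContinuousOn f (Icc t₀ t₁) := by
  obtain ⟨N, τ, hτ, rfl, rfl, h⟩ := h
  have : ∀ k ≤ N, ContinuousOn f (Icc (τ 0) (τ k)) := by
    intro k
    induction k with
    | zero => intro; simp
    | succ k ih =>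
      intro hk
      rw [← Icc_union_Icc_eq_Icc (hτ (Nat.zero_le k)) (hτ (Nat.le_succ k))]
      exact (ih (by omega)).union_of_isClosed (h k hk).continuousOn isClosed_Icc isClosed_Icc
  exact this N le_rfl

/-- The one-sided derivative is continuous on the compact interval and agrees with `deriv` in the
interior. -/
theorem ContDiffOn.exists_deriv_bound {a b : ℝ} (h : ContDiffOn ℝ 1 f (Icc a b)) :
    ∃ C, ∀ t ∈ Ioo a b, ‖deriv f t‖ ≤ C := by
  rcases le_or_gt b a with hab | hab
  · exact ⟨0, fun t ht => by simp [Ioo_eq_empty (not_lt.2 hab)] at ht⟩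
  · have hc := h.continuousOn_derivWithin (uniqueDiffOn_Icc hab) le_rfl
    obtain ⟨C, hC⟩ := isCompact_Icc.exists_bound_of_continuousOn hc
    refine ⟨C, fun t ht => ?_⟩
    rw [← derivWithin_of_mem_nhds (Icc_mem_nhds ht.1 ht.2)]
    exact hC t (Ioo_subset_Icc_self ht)

/-- Off a finite set, a piecewise `C¹` function has a continuous and bounded derivative. -/
theorem PiecewiseC1.exists_regular (h : PiecewiseC1 f t₀ t₁) :
    ∃ S : Set ℝ, S.Finite ∧ ∃ C, ∀ t ∈ Ioo t₀ t₁ \ S,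
      HasDerivAt f (deriv f t) t ∧ ContinuousAt (deriv f) t ∧ ‖deriv f t‖ ≤ C := by
  obtain ⟨N, τ, hτ, rfl, rfl, h⟩ := h
  have hb : ∀ k, ∃ C, k < N → ∀ t ∈ Ioo (τ k) (τ (k + 1)), ‖deriv f t‖ ≤ C := by
    intro k
    by_cases hk : k < N
    · obtain ⟨C, hC⟩ := ContDiffOn.exists_deriv_bound (h k hk)
      exact ⟨C, fun _ => hC⟩
    · exact ⟨0, fun h => absurd h hk⟩
  choose C hC using hb
  -- The exceptional set consists of the breakpoints. The sum of the bounds on the pieces dominates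
  -- each one of them.
  refine ⟨τ '' (Finset.range (N + 1)), (Finset.finite_toSet _).image _,
    ∑ k ∈ Finset.range N, |C k|, ?_⟩
  rintro t ⟨ht, htS⟩
  have hne : ∀ k ≤ N, τ k ≠ t := fun k hk e =>
    htS ⟨k, by simpa using Nat.lt_succ_of_le hk, e⟩
  -- The piece containing `t` ends at the first breakpoint beyond `t`; this is not `τ 0`, so it has
  -- a predecessor.
  obtain ⟨k, hk, hkt⟩ : ∃ k < N, t ∈ Ioo (τ k) (τ (k + 1)) := by
    have hex : ∃ k, t < τ k := ⟨N, ht.2⟩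
    classical
    obtain ⟨k, hk⟩ : ∃ k, Nat.find hex = k + 1 := by
      refine Nat.exists_eq_succ_of_ne_zero fun h0 => ?_
      have := Nat.find_spec hex
      rw [h0] at this
      exact lt_asymm this ht.1
    have hlt : Nat.find hex ≤ N := Nat.find_le ht.2
    have h1 : ¬ t < τ k := Nat.find_min hex (by omega)
    have h2 := Nat.find_spec hex
    rw [hk] at h2
    exact ⟨k, by omega, lt_of_le_of_ne (not_lt.1 h1) (hne k (by omega)), h2⟩
  have hopen := (h k hk).mono Ioo_subset_Icc_self
  refine ⟨?_, ?_, ?_⟩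
  · exact ((hopen.differentiableOn one_ne_zero).differentiableAt
      (isOpen_Ioo.mem_nhds hkt)).hasDerivAt
  · exact (hopen.continuousOn_deriv_of_isOpen isOpen_Ioo le_rfl).continuousAt
      (isOpen_Ioo.mem_nhds hkt)
  · calc ‖deriv f t‖ ≤ C k := hC k hk t hkt
      _ ≤ |C k| := le_abs_self _
      _ ≤ _ := Finset.single_le_sum (f := fun k => |C k|) (fun _ _ => abs_nonneg _)
        (Finset.mem_range.2 hk)

theorem ae_restrict_uIoc_of_finite {S : Set ℝ} (hS : S.Finite) (ht : t₀ ≤ t₁) {p : ℝ → Prop}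
    (h : ∀ t ∈ Ioo t₀ t₁ \ S, p t) : ∀ᵐ t ∂(volume.restrict (uIoc t₀ t₁)), p t := by
  rw [uIoc_of_le ht, restrict_Ioo_eq_restrict_Ioc.symm]
  rw [ae_restrict_iff' measurableSet_Ioo]
  have : ∀ᵐ t : ℝ, t ∉ S := (hS.countable.ae_notMem volume)
  filter_upwards [this] with t h1 h2 using h t ⟨h2, h1⟩

theorem PiecewiseC1.intervalIntegrable_deriv [FiniteDimensional ℝ F] [MeasurableSpace F]
    [BorelSpace F] (h : PiecewiseC1 f t₀ t₁) (ht : t₀ ≤ t₁) :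
    IntervalIntegrable (deriv f) volume t₀ t₁ := by
  have := FiniteDimensional.complete ℝ F
  have := FiniteDimensional.proper ℝ F
  obtain ⟨S, hS, C, hC⟩ := h.exists_regular
  refine (intervalIntegrable_const (c := C)).mono_fun (measurable_deriv f).aestronglyMeasurable ?_
  refine ae_restrict_uIoc_of_finite hS ht fun t ht => ?_
  exact (hC t ht).2.2.trans (le_abs_self C)

end PiecewiseC1

/-! ### Angular speed, continuous arguments and winding numbers -/

/-- A nonvanishing piecewise `C¹` plane curve is the exponential of the primitive of its
logarithmic derivative. -/
theorem eq_exp_integral {c : ℝ → ℂ} {t₀ t₁ : ℝ} (ht : t₀ ≤ t₁) (hc : PiecewiseC1 c t₀ t₁)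
    (h0 : ∀ t ∈ Icc t₀ t₁, c t ≠ 0) :
    IntervalIntegrable (fun t => deriv c t / c t) volume t₀ t₁ ∧
    ∀ t ∈ Icc t₀ t₁, c t = Complex.exp (∫ τ in t₀..t, deriv c τ / c τ) * c t₀ := by
  have hcont := hc.continuousOn
  have hint : IntervalIntegrable (fun t => deriv c t / c t) volume t₀ t₁ := by
    simp only [div_eq_mul_inv]
    refine (hc.intervalIntegrable_deriv ht).mul_continuousOn ?_
    rw [uIcc_of_le ht]
    exact hcont.inv₀ h0
  refine ⟨hint, ?_⟩
  obtain ⟨S, hS, C, hC⟩ := hc.exists_regular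
  set ψ : ℝ → ℂ := fun t => ∫ τ in t₀..t, deriv c τ / c τ with hψ
  have hψc : ContinuousOn ψ (Icc t₀ t₁) := by
    have := intervalIntegral.continuousOn_primitive_interval' hint left_mem_uIcc
    rwa [uIcc_of_le ht] at this
  have hmeas : ∀ s ∈ Ioo t₀ t₁ \ S, HasDerivAt ψ (deriv c s / c s) s := by
    intro s hs
    have hs' := Ioo_subset_Icc_self hs.1
    refine intervalIntegral.integral_hasDerivAt_right ?_ ?_ ?_
    · exact hint.mono_set (by rw [uIcc_of_le ht, uIcc_of_le hs'.1]; exact Icc_subset_Icc_right hs'.2)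
    · refine ⟨Icc t₀ t₁, Icc_mem_nhds hs.1.1 hs.1.2, ?_⟩
      exact ((measurable_deriv c).aemeasurable.div
        (hcont.aestronglyMeasurable measurableSet_Icc).aemeasurable).aestronglyMeasurable
    · exact (hC s hs).2.1.div (hC s hs).1.continuousAt (h0 s hs')
  intro t htt
  -- The product `c · exp (-ψ)` is continuous with zero derivative off a finite set, hence constant.
  have hd : ∀ s ∈ Ioo (min t₀ t) (max t₀ t) \ S,
      HasDerivAt (fun s => c s * Complex.exp (-ψ s)) 0 s := by
    intro s hs
    rw [min_eq_left htt.1, max_eq_right htt.1] at hs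
    have hs2 : s ∈ Ioo t₀ t₁ \ S := ⟨⟨hs.1.1, hs.1.2.trans_le htt.2⟩, hs.2⟩
    have h1 := (hC s hs2).1.mul (hmeas s hs2).neg.cexp
    have := h0 s (Ioo_subset_Icc_self hs2.1)
    have e : deriv c s * Complex.exp (-ψ s) +
        c s * (Complex.exp (-ψ s) * -(deriv c s / c s)) = 0 := by
      field_simp
      ring
    exact e ▸ h1
  have key := integral_eq_of_hasDerivAt_off_countable (fun s => c s * Complex.exp (-ψ s))
    (fun _ => 0) (a := t₀) (b := t) hS.countable
    (by
      rw [uIcc_of_le htt.1]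
      exact (hcont.mul hψc.neg.cexp).mono (Icc_subset_Icc_right htt.2)) hd (by simp)
  simp only [intervalIntegral.integral_zero] at key
  have hψ0 : ψ t₀ = 0 := by simp [hψ]
  rw [hψ0] at key
  have : c t * Complex.exp (-ψ t) = c t₀ := by
    have := sub_eq_zero.1 key.symm
    simpa using this
  change c t = Complex.exp (ψ t) * c t₀
  rw [← this, mul_comm, mul_assoc, ← Complex.exp_add]
  simp

/-- The angular speed of a plane curve. -/
def angularSpeed (c : ℝ → ℂ) (t : ℝ) : ℝ :=
  ((starRingEnd ℂ) (c t) * deriv c t).im / ‖c t‖ ^ 2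

/-- Here `conj c / |c|² = c⁻¹`. Where `c` vanishes both sides are `0` by the convention for
division, so no hypothesis is needed. -/
theorem angularSpeed_eq (c : ℝ → ℂ) (t : ℝ) : angularSpeed c t = (deriv c t / c t).im := by
  rw [angularSpeed, Complex.div_im, Complex.sq_norm]
  simp
  ring

/-- The direction of a nonvanishing piecewise `C¹` plane curve turns through the integral of its
angular speed. -/
theorem turning {c : ℝ → ℂ} {t₀ t₁ : ℝ} (ht : t₀ ≤ t₁) (hc : PiecewiseC1 c t₀ t₁)
    (h0 : ∀ t ∈ Icc t₀ t₁, c t ≠ 0) :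
    IntervalIntegrable (angularSpeed c) volume t₀ t₁ ∧
    ContinuousOn (fun t => ∫ τ in t₀..t, angularSpeed c τ) (Icc t₀ t₁) ∧
    ∀ t ∈ Icc t₀ t₁, c t = ((‖c t‖ / ‖c t₀‖ : ℝ) : ℂ) *
      Complex.exp ((∫ τ in t₀..t, angularSpeed c τ : ℝ) * Complex.I) * c t₀ := by
  obtain ⟨hi, he⟩ := eq_exp_integral ht hc h0
  have hi' : IntervalIntegrable (angularSpeed c) volume t₀ t₁ := by
    have : angularSpeed c = fun t => Complex.imCLM (deriv c t / c t) := by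
      ext t; rw [angularSpeed_eq]; rfl
    rw [this]
    exact ⟨Complex.imCLM.integrable_comp hi.1, Complex.imCLM.integrable_comp hi.2⟩
  refine ⟨hi', ?_, ?_⟩
  · have := intervalIntegral.continuousOn_primitive_interval' hi' left_mem_uIcc
    rwa [uIcc_of_le ht] at this
  · intro t htt
    have hm : IntervalIntegrable (fun t => deriv c t / c t) volume t₀ t :=
      hi.mono_set (by rw [uIcc_of_le ht, uIcc_of_le htt.1]; exact Icc_subset_Icc_right htt.2)
    have him : (∫ τ in t₀..t, angularSpeed c τ) = (∫ τ in t₀..t, deriv c τ / c τ).im := by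
      have := Complex.imCLM.intervalIntegral_comp_comm hm
      simp only [Complex.imCLM_apply] at this
      rw [← this]
      exact intervalIntegral.integral_congr fun τ _ => angularSpeed_eq c τ
    have e := he t htt
    have hc0 : ‖c t₀‖ ≠ 0 := norm_ne_zero_iff.2 (h0 t₀ ⟨le_rfl, ht⟩)
    rw [him]
    generalize (∫ τ in t₀..t, deriv c τ / c τ) = w at e
    -- The real part of the logarithm accounts for the change of modulus, the imaginary part for the
    -- turning.
    have hn : ‖c t‖ / ‖c t₀‖ = Real.exp w.re := by
      rw [e, norm_mul, Complex.norm_exp]; field_simp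
    rw [hn, Complex.ofReal_exp, ← Complex.exp_add, Complex.re_add_im]
    exact e

/-- The integers are totally disconnected in `ℝ`, so the preconnected image is a single point. -/
theorem _root_.IsPreconnected.eq_of_forall_exists_int {α : Type*} [TopologicalSpace α] {s : Set α}
    (hs : IsPreconnected s) {f : α → ℝ} (hf : ContinuousOn f s) (h : ∀ x ∈ s, ∃ n : ℤ, f x = n)
    {x y : α} (hx : x ∈ s) (hy : y ∈ s) : f x = f y := by
  have himg : f '' s ⊆ range ((↑) : ℤ → ℝ) := by
    rintro _ ⟨z, hz, rfl⟩
    obtain ⟨n, hn⟩ := h z hz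
    exact ⟨n, hn.symm⟩
  have hsub : (f '' s).Subsingleton :=
    Int.isClosedEmbedding_coe_real.isEmbedding.isTotallyDisconnected_range.mpr inferInstance
      _ himg (hs.image _ hf)
  exact hsub ⟨x, hx, rfl⟩ ⟨y, hy, rfl⟩

/-- A continuous argument of a piecewise `C¹` curve varies by the integral of the angular speed. -/
theorem HasWindingNumber.integral {c : ℝ → ℂ} {t₀ t₁ : ℝ} (ht : t₀ ≤ t₁) {w : ℂ} {k : ℤ}
    (hc : PiecewiseC1 (fun t => c t - w) t₀ t₁) (h : HasWindingNumber c t₀ t₁ w k) :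
    ∫ t in t₀..t₁, angularSpeed (fun t => c t - w) t = 2 * Real.pi * k := by
  obtain ⟨θ, hθ, hk, h⟩ := h
  have h0 : ∀ t ∈ Icc t₀ t₁, c t - w ≠ 0 := fun t ht => sub_ne_zero.2 (h t ht).1
  obtain ⟨-, hφ, he⟩ := turning ht hc h0
  set φ : ℝ → ℝ := fun t => ∫ τ in t₀..t, angularSpeed (fun t => c t - w) τ with hφd
  have h00 : t₀ ∈ Icc t₀ t₁ := ⟨le_rfl, ht⟩
  have h11 : t₁ ∈ Icc t₀ t₁ := ⟨ht, le_rfl⟩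
  -- The given argument and the integral of the angular speed are both continuous and differ by
  -- whole turns; connectedness of the interval makes this number of turns constant.
  have key : ∀ t ∈ Icc t₀ t₁, ∃ n : ℤ, (θ t - θ t₀ - φ t) / (2 * Real.pi) = n := by
    intro t htt
    have e1 := (h t htt).2
    have e2 := (h t₀ h00).2
    have e3 := he t htt
    have n1 : (‖c t - w‖ : ℂ) ≠ 0 := by
      exact_mod_cast norm_ne_zero_iff.2 (h0 t htt)
    have n2 : (‖c t₀ - w‖ : ℂ) ≠ 0 := by
      exact_mod_cast norm_ne_zero_iff.2 (h0 t₀ h00)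
    have e4 : Complex.exp (θ t * Complex.I)
        = Complex.exp (φ t * Complex.I) * Complex.exp (θ t₀ * Complex.I) := by
      apply mul_left_cancel₀ n1
      have e5 := e1.symm.trans e3
      rw [e5]
      clear e5 e3 e1
      change _ * Complex.exp (φ t * Complex.I) * _ = _
      generalize ‖c t - w‖ = r at *
      generalize ‖c t₀ - w‖ = r₀ at *
      rw [e2]
      push_cast
      field_simp
    rw [← Complex.exp_add, Complex.exp_eq_exp_iff_exists_int] at e4
    obtain ⟨n, hn⟩ := e4
    refine ⟨n, ?_⟩
    have : (θ t - θ t₀ - φ t : ℝ) = n * (2 * Real.pi) := by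
      have := congrArg Complex.im hn
      simp at this
      linarith
    rw [this]
    field_simp
  have hcont : ContinuousOn (fun t => (θ t - θ t₀ - φ t) / (2 * Real.pi)) (Icc t₀ t₁) :=
    ((hθ.sub continuousOn_const).sub hφ).div_const _
  have := isPreconnected_Icc.eq_of_forall_exists_int hcont key h11 h00
  have hφ0 : φ t₀ = 0 := by simp [hφd]
  simp only [hφ0, sub_self, zero_div] at this
  have hpi : 2 * Real.pi ≠ 0 := by positivity
  have h3 : θ t₁ - θ t₀ - φ t₁ = 0 := by
    rcases div_eq_zero_iff.1 this with h | h
    · exact h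
    · exact absurd h hpi
  change φ t₁ = _
  linarith

/-- The total turning of a closed curve is a multiple of `2π`. -/
theorem exists_int_integral_angularSpeed {c : ℝ → ℂ} {t₀ t₁ : ℝ} (ht : t₀ ≤ t₁)
    (hc : PiecewiseC1 c t₀ t₁) (h0 : ∀ t ∈ Icc t₀ t₁, c t ≠ 0) (hcl : c t₀ = c t₁) :
    ∃ k : ℤ, ∫ t in t₀..t₁, angularSpeed c t = 2 * Real.pi * k := by
  have e := (turning ht hc h0).2.2 t₁ ⟨ht, le_rfl⟩
  have n0 : c t₀ ≠ 0 := h0 t₀ ⟨le_rfl, ht⟩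
  rw [← hcl, div_self (norm_ne_zero_iff.2 n0)] at e
  have : Complex.exp ((∫ τ in t₀..t₁, angularSpeed c τ : ℝ) * Complex.I) = 1 := by
    apply mul_right_cancel₀ n0
    rw [one_mul]
    conv_rhs => rw [e]
    simp
  rw [Complex.exp_eq_one_iff] at this
  obtain ⟨n, hn⟩ := this
  refine ⟨n, ?_⟩
  have := congrArg Complex.im hn
  simp at this
  linarith

/-! ### Positively oriented orthonormal frames -/

theorem exists_orthonormalBasis_cross {e₁ e₂ : E3} (h₁ : ‖e₁‖ = 1) (h₂ : ‖e₂‖ = 1)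
    (h : inner ℝ e₁ e₂ = 0) :
    ∃ b : OrthonormalBasis (Fin 3) ℝ E3, b 0 = e₁ ∧ b 1 = e₂ ∧ b 2 = cross e₁ e₂ := by
  have s₁ : ‖e₁‖ ^ 2 = 1 := by rw [h₁]; norm_num
  have s₂ : ‖e₂‖ ^ 2 = 1 := by rw [h₂]; norm_num
  have c₁ : inner ℝ e₁ (cross e₁ e₂) = 0 := by
    simp only [inner_eq, cross_zero, cross_one, cross_two]; ring
  have c₂ : inner ℝ e₂ (cross e₁ e₂) = 0 := by
    simp only [inner_eq, cross_zero, cross_one, cross_two]; ring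
  have c₃ : ‖cross e₁ e₂‖ = 1 := by
    have : ‖cross e₁ e₂‖ ^ 2 = 1 := by
      rw [norm_sq_eq] at s₁ s₂ ⊢
      rw [inner_eq] at h
      simp only [cross_zero, cross_one, cross_two]
      -- Lagrange's identity `|e₁ × e₂|² = |e₁|² |e₂|² - (e₁ · e₂)²`.
      linear_combination s₂ * (e₁ 0 ^ 2 + e₁ 1 ^ 2 + e₁ 2 ^ 2) + s₁
        - (e₁ 0 * e₂ 0 + e₁ 1 * e₂ 1 + e₁ 2 * e₂ 2) * h
    exact (pow_eq_one_iff_of_nonneg (norm_nonneg _) two_ne_zero).1 this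
  have hon : Orthonormal ℝ ![e₁, e₂, cross e₁ e₂] := by
    constructor
    · intro i; fin_cases i <;> simp [h₁, h₂, c₃]
    · intro i j hij
      fin_cases i <;> fin_cases j <;> simp [real_inner_comm] at hij ⊢ <;>
        assumption
  obtain ⟨b, hb⟩ := Orthonormal.exists_orthonormalBasis_extension_of_card_eq (𝕜 := ℝ) (E := E3)
    (ι := Fin 3) (by simp) (v := ![e₁, e₂, cross e₁ e₂]) (s := univ)
    (hon.comp _ Subtype.val_injective)
  exact ⟨b, hb 0 trivial, hb 1 trivial, hb 2 trivial⟩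

section Frame

variable {e₁ e₂ : E3} (h₁ : ‖e₁‖ = 1) (h₂ : ‖e₂‖ = 1) (h : inner ℝ e₁ e₂ = 0)
include h₁ h₂ h

theorem inner_frame (x y : E3) : inner ℝ x y = inner ℝ x e₁ * inner ℝ y e₁
    + inner ℝ x e₂ * inner ℝ y e₂ + inner ℝ x (cross e₁ e₂) * inner ℝ y (cross e₁ e₂) := by
  obtain ⟨b, b0, b1, b2⟩ := exists_orthonormalBasis_cross h₁ h₂ h
  rw [← b.sum_inner_mul_inner x y, Fin.sum_univ_three, b0, b1, b2, real_inner_comm y e₁,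
    real_inner_comm y e₂, real_inner_comm y (cross e₁ e₂)]

theorem eq_frame (x : E3) : x = inner ℝ x e₁ • e₁ + inner ℝ x e₂ • e₂
    + inner ℝ x (cross e₁ e₂) • cross e₁ e₂ := by
  obtain ⟨b, b0, b1, b2⟩ := exists_orthonormalBasis_cross h₁ h₂ h
  conv_lhs => rw [← b.sum_repr' x, Fin.sum_univ_three, b0, b1, b2]
  simp only [real_inner_comm]

theorem triple_frame (x y z : E3) : inner ℝ x (cross y z) =
    inner ℝ x e₁ * (inner ℝ y e₂ * inner ℝ z (cross e₁ e₂)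
        - inner ℝ y (cross e₁ e₂) * inner ℝ z e₂)
      + inner ℝ x e₂ * (inner ℝ y (cross e₁ e₂) * inner ℝ z e₁
        - inner ℝ y e₁ * inner ℝ z (cross e₁ e₂))
      + inner ℝ x (cross e₁ e₂) * (inner ℝ y e₁ * inner ℝ z e₂
        - inner ℝ y e₂ * inner ℝ z e₁) := by
  obtain ⟨b, b0, b1, b2⟩ := exists_orthonormalBasis_cross h₁ h₂ h
  have hd : inner ℝ (cross e₁ e₂) (cross e₁ e₂) = 1 := by
    rw [← b2, real_inner_self_eq_norm_sq]; simp
  generalize hf : cross e₁ e₂ = f at *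
  rw [← hf] at hd
  -- Multiplicativity of determinants: the right side is the determinant of the Gram matrix of `x,
  -- y, z` against the frame, and the factor `1` is the determinant of the frame itself.
  rw [← mul_one (inner ℝ x (cross y z)), ← hd, hf]
  simp only [inner_eq, cross_zero, cross_one, cross_two]
  rw [← hf]
  simp only [cross_zero, cross_one, cross_two]
  ring

end Frame

theorem norm_cross_le (u v : E3) : ‖cross u v‖ ≤ ‖u‖ * ‖v‖ := by
  refine (pow_le_pow_iff_left₀ (norm_nonneg _) (by positivity) two_ne_zero).1 ?_
  rw [mul_pow, norm_sq_eq, norm_sq_eq, norm_sq_eq]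
  simp only [cross_zero, cross_one, cross_two]
  nlinarith [sq_nonneg (u 0 * v 0 + u 1 * v 1 + u 2 * v 2)]

theorem inner_cross_left (b s v : E3) : inner ℝ b (cross s v) = inner ℝ (cross b s) v := by
  simp only [inner_eq, cross_zero, cross_one, cross_two]; ring

/-! ### Forms with one pole and stereographic projection -/

/-- The 1-form on `S²(1/2)` with a pole at `-b` and exterior derivative `2 dA`. -/
def poleForm (b s v : E3) : ℝ := 4 * inner ℝ b (cross s v) / (1 + 4 * inner ℝ b s)

theorem kinematicForm_eq_poleForm (m : Fin 3 → ℝ) (i : Fin 3) (s v : E3) :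
    kinematicForm m i s v = poleForm (binaryCollision m i) s v := rfl

/-- This exhibits `-b` as the only zero on the sphere of the denominator of `poleForm`. -/
theorem one_add_four_inner {b s : E3} (hb : ‖b‖ = 1 / 2) (hs : ‖s‖ = 1 / 2) :
    1 + 4 * inner ℝ b s = 2 * ‖s + b‖ ^ 2 := by
  rw [norm_add_sq_real, hb, hs, real_inner_comm]; ring

theorem one_add_four_inner_pos {b s : E3} (hb : ‖b‖ = 1 / 2) (hs : ‖s‖ = 1 / 2) (h : s ≠ -b) :
    0 < 1 + 4 * inner ℝ b s := by
  rw [one_add_four_inner hb hs]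
  have : s + b ≠ 0 := fun e => h (eq_neg_of_add_eq_zero_left e)
  have := norm_pos_iff.2 this
  positivity

/-- The coordinate form of `angularSpeed_stereo`, in a frame whose third vector is `-2q`: `(x, y,
z)` is the point of the curve, `u` its velocity and `(a, b, c)` the point `p`. Projection divides by
`1/2 + z`. On the left stands the angular speed about the image of `p`, on the right the form with
pole `q` minus the form with pole `p`. -/
theorem stereo_angle_aux {x y z u₁ u₂ u₃ a b c : ℝ} (hs : x ^ 2 + y ^ 2 + z ^ 2 = 1 / 4)
    (hp : a ^ 2 + b ^ 2 + c ^ 2 = 1 / 4) (hv : x * u₁ + y * u₂ + z * u₃ = 0)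
    (hz : 1 / 2 + z ≠ 0) (hc : 1 / 2 + c ≠ 0) (hne : 1 - 4 * (a * x + b * y + c * z) ≠ 0) :
    ((x / (1 / 2 + z) - a / (1 / 2 + c)) * ((u₂ * (1 / 2 + z) - y * u₃) / (1 / 2 + z) ^ 2)
      - (y / (1 / 2 + z) - b / (1 / 2 + c)) * ((u₁ * (1 / 2 + z) - x * u₃) / (1 / 2 + z) ^ 2))
      / ((x / (1 / 2 + z) - a / (1 / 2 + c)) ^ 2 + (y / (1 / 2 + z) - b / (1 / 2 + c)) ^ 2)
    = 2 * (x * u₂ - y * u₁) / (1 + 2 * z)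
      + 4 * (a * (y * u₃ - z * u₂) + b * (z * u₁ - x * u₃) + c * (x * u₂ - y * u₁))
        / (1 - 4 * (a * x + b * y + c * z)) := by
  have hz' : 1 + 2 * z ≠ 0 := fun h => hz (by linarith)
  -- The squared distance of the two images, simplified by both sphere equations.
  have hA : (x / (1 / 2 + z) - a / (1 / 2 + c)) ^ 2 + (y / (1 / 2 + z) - b / (1 / 2 + c)) ^ 2
      = (1 - 4 * (a * x + b * y + c * z)) / (2 * (1 / 2 + z) * (1 / 2 + c)) := by
    generalize hZ : 1 / 2 + z = Z at *
    generalize hC : 1 / 2 + c = C at *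
    obtain rfl : z = Z - 1 / 2 := by linarith
    obtain rfl : c = C - 1 / 2 := by linarith
    field_simp
    linear_combination 8 * C ^ 2 * hs + 8 * Z ^ 2 * hp
  -- The area spanned by the difference of the images and the velocity; tangency enters here.
  have hB : (x / (1 / 2 + z) - a / (1 / 2 + c)) * ((u₂ * (1 / 2 + z) - y * u₃) / (1 / 2 + z) ^ 2)
      - (y / (1 / 2 + z) - b / (1 / 2 + c)) * ((u₁ * (1 / 2 + z) - x * u₃) / (1 / 2 + z) ^ 2)
      = ((1 / 2 - 2 * (a * x + b * y + c * z)) * (x * u₂ - y * u₁) + 2 * (1 / 2 + z) *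
        (a * (y * u₃ - z * u₂) + b * (z * u₁ - x * u₃) + c * (x * u₂ - y * u₁)))
        / ((1 / 2 + z) ^ 2 * (1 / 2 + c)) := by
    generalize hZ : 1 / 2 + z = Z at *
    generalize hC : 1 / 2 + c = C at *
    obtain rfl : z = Z - 1 / 2 := by linarith
    obtain rfl : c = C - 1 / 2 := by linarith
    field_simp
    linear_combination 2 * Z * (a * (2 * u₂ * hs - 2 * y * hv) + b * (-2 * u₁ * hs + 2 * x * hv))
  rw [hA, hB]
  have e : 1 + 2 * z = 2 * (1 / 2 + z) := by ring
  rw [e]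
  generalize (1 / 2 + z) = Z at *
  generalize (1 / 2 + c) = C at *
  obtain ⟨R, hR⟩ : ∃ R, R = 1 - 4 * (a * x + b * y + c * z) := ⟨_, rfl⟩
  have hP : 1 / 2 - 2 * (a * x + b * y + c * z) = R / 2 := by rw [hR]; ring
  rw [hP, ← hR]
  rw [← hR] at hne
  field_simp
  ring

theorem stereo_eq {q e₁ e₂ : E3} (hf : cross e₁ e₂ = -((2 : ℝ) • q)) (s : E3) :
    stereo q e₁ e₂ s = ((inner ℝ s e₁ / (1 / 2 + inner ℝ s (cross e₁ e₂)) : ℝ) : ℂ)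
      + ((inner ℝ s e₂ / (1 / 2 + inner ℝ s (cross e₁ e₂)) : ℝ) : ℂ) * Complex.I := by
  rw [hf, inner_neg_right, ← sub_eq_add_neg, stereo, Complex.mk_eq_add_mul_I]

theorem half_add_inner_eq {q e₁ e₂ : E3} (hf : cross e₁ e₂ = -((2 : ℝ) • q)) (s : E3) :
    1 / 2 + inner ℝ s (cross e₁ e₂) = (1 + 4 * inner ℝ (-q) s) / 2 := by
  rw [hf, inner_neg_right, inner_neg_left, inner_smul_right, real_inner_comm]; ring

/-- The angular speed of the stereographic image of a spherical curve. -/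
theorem angularSpeed_stereo {q e₁ e₂ p v : E3} {γ : ℝ → E3} {t : ℝ} (h₁ : ‖e₁‖ = 1)
    (h₂ : ‖e₂‖ = 1) (h : inner ℝ e₁ e₂ = 0) (hf : cross e₁ e₂ = -((2 : ℝ) • q))
    (hγ : HasDerivAt γ v t) (hs : ‖γ t‖ = 1 / 2) (hv : inner ℝ (γ t) v = 0) (hp : ‖p‖ = 1 / 2)
    (hq : ‖q‖ = 1 / 2) (hsq : γ t ≠ q) (hpq : p ≠ q) (hsp : γ t ≠ p) :
    angularSpeed (fun τ => stereo q e₁ e₂ (γ τ) - stereo q e₁ e₂ p) t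
      = poleForm (-q) (γ t) v - poleForm (-p) (γ t) v := by
  have hq' : ‖-q‖ = 1 / 2 := by rwa [norm_neg]
  have hp' : ‖-p‖ = 1 / 2 := by rwa [norm_neg]
  have n1 := one_add_four_inner_pos hq' hs (by rwa [neg_neg])
  have n2 := one_add_four_inner_pos hq' hp (by rwa [neg_neg])
  have n3 := one_add_four_inner_pos hp' hs (by rwa [neg_neg])
  have z1 : 1 / 2 + inner ℝ (γ t) (cross e₁ e₂) ≠ 0 := by rw [half_add_inner_eq hf]; positivity
  have z2 : 1 / 2 + inner ℝ p (cross e₁ e₂) ≠ 0 := by rw [half_add_inner_eq hf]; positivity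
  have d : ∀ w : E3, HasDerivAt (fun τ => inner ℝ (γ τ) w) (inner ℝ v w) t := by
    intro w
    simpa using hγ.inner ℝ (hasDerivAt_const t w)
  have dc := (((d e₁).div ((d (cross e₁ e₂)).const_add (1 / 2)) z1).ofReal_comp.add
    (((d e₂).div ((d (cross e₁ e₂)).const_add (1 / 2)) z1).ofReal_comp.mul_const
      Complex.I)).sub_const (stereo q e₁ e₂ p)
  have dc' : deriv (fun τ => stereo q e₁ e₂ (γ τ) - stereo q e₁ e₂ p) t =
      (((inner ℝ v e₁ * (1 / 2 + inner ℝ (γ t) (cross e₁ e₂))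
        - inner ℝ (γ t) e₁ * inner ℝ v (cross e₁ e₂))
        / (1 / 2 + inner ℝ (γ t) (cross e₁ e₂)) ^ 2 : ℝ) : ℂ)
      + (((inner ℝ v e₂ * (1 / 2 + inner ℝ (γ t) (cross e₁ e₂))
        - inner ℝ (γ t) e₂ * inner ℝ v (cross e₁ e₂))
        / (1 / 2 + inner ℝ (γ t) (cross e₁ e₂)) ^ 2 : ℝ) : ℂ) * Complex.I := by
    simp only [stereo_eq hf (γ _)]
    exact dc.deriv
  have hF := inner_frame h₁ h₂ h
  have hT := triple_frame h₁ h₂ h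
  have hs2 : inner ℝ (γ t) (γ t) = 1 / 4 := by rw [real_inner_self_eq_norm_sq, hs]; norm_num
  have hp2 : inner ℝ p p = 1 / 4 := by rw [real_inner_self_eq_norm_sq, hp]; norm_num
  -- Since `-q` is half the third frame vector, this form involves only the rotation about that
  -- axis.
  have eq1 : poleForm (-q) (γ t) v = 2 * (inner ℝ (γ t) e₁ * inner ℝ v e₂
      - inner ℝ (γ t) e₂ * inner ℝ v e₁) / (1 + 2 * inner ℝ (γ t) (cross e₁ e₂)) := by
    have hqf : -q = (1 / 2 : ℝ) • cross e₁ e₂ := by rw [hf]; simp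
    have o1 : inner ℝ (cross e₁ e₂) e₁ = 0 := by
      simp only [inner_eq, cross_zero, cross_one, cross_two]; ring
    have o2 : inner ℝ (cross e₁ e₂) e₂ = 0 := by
      simp only [inner_eq, cross_zero, cross_one, cross_two]; ring
    have o3 : inner ℝ (cross e₁ e₂) (cross e₁ e₂) = 1 := by
      rw [hf, inner_neg_neg, inner_smul_left, inner_smul_right, real_inner_self_eq_norm_sq, hq]
      norm_num
    rw [poleForm, hqf, inner_smul_left, inner_smul_left, hT (cross e₁ e₂) (γ t) v, o1, o2, o3,
      real_inner_comm (γ t) (cross e₁ e₂)]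
    congr 1
    · simp; ring
    · simp; ring
  have n3' : 1 - 4 * inner ℝ p (γ t) ≠ 0 := by
    rw [inner_neg_left] at n3; linarith
  have eq2 : poleForm (-p) (γ t) v = -(4 * inner ℝ p (cross (γ t) v)
      / (1 - 4 * inner ℝ p (γ t))) := by
    rw [poleForm, inner_neg_left, inner_neg_left]
    ring
  rw [eq1, eq2, sub_neg_eq_add, hT p, hF p (γ t)]
  rw [hF] at hs2 hp2 hv n3'
  have key := stereo_angle_aux (by linear_combination hs2) (by linear_combination hp2) hv z1 z2 n3'
  rw [← key, angularSpeed, dc', Complex.sq_norm, Complex.normSq_apply, stereo_eq hf (γ t),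
    stereo_eq hf p]
  simp only [Complex.sub_re, Complex.sub_im, Complex.add_re, Complex.add_im, Complex.mul_re,
    Complex.mul_im, Complex.ofReal_re, Complex.ofReal_im, Complex.I_re, Complex.I_im,
    Complex.conj_re, Complex.conj_im, map_sub]
  congr 1 <;> ring

/-! ### Integrals of pole forms along spherical curves -/

section SphericalCurve

variable {γ : ℝ → E3} {t₀ t₁ : ℝ}

theorem inner_deriv_eq_zero (hs : ∀ t ∈ Icc t₀ t₁, ‖γ t‖ = 1 / 2) {t : ℝ} (ht : t ∈ Ioo t₀ t₁)
    (hd : HasDerivAt γ (deriv γ t) t) : inner ℝ (γ t) (deriv γ t) = 0 := by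
  have h1 := hd.inner ℝ hd
  have h2 : HasDerivAt (fun τ => inner ℝ (γ τ) (γ τ)) 0 t := by
    refine (hasDerivAt_const t (1 / 4 : ℝ)).congr_of_eventuallyEq ?_
    filter_upwards [Icc_mem_nhds ht.1 ht.2] with τ hτ
    rw [real_inner_self_eq_norm_sq, hs τ hτ]; norm_num
  have := h1.unique h2
  rw [real_inner_comm (γ t)] at this
  linarith

theorem intervalIntegrable_inner {ψ g : ℝ → E3} (hψ : ContinuousOn ψ (uIcc t₀ t₁))
    (hg : IntervalIntegrable g volume t₀ t₁) :
    IntervalIntegrable (fun t => inner ℝ (ψ t) (g t)) volume t₀ t₁ := by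
  simp only [inner_eq]
  have hg' : ∀ i, IntervalIntegrable (fun t => g t i) volume t₀ t₁ := fun i =>
    ⟨(EuclideanSpace.proj (𝕜 := ℝ) i).integrable_comp hg.1,
      (EuclideanSpace.proj (𝕜 := ℝ) i).integrable_comp hg.2⟩
  have hψ' : ∀ i, ContinuousOn (fun t => ψ t i) (uIcc t₀ t₁) := fun i =>
    (EuclideanSpace.proj (𝕜 := ℝ) i).continuous.comp_continuousOn hψ
  exact (((hg' 0).continuousOn_mul (hψ' 0)).add ((hg' 1).continuousOn_mul (hψ' 1))).add
    ((hg' 2).continuousOn_mul (hψ' 2))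

theorem continuous_cross : Continuous (fun x : E3 × E3 => cross x.1 x.2) := by
  have : Continuous fun x : E3 × E3 => (x.1.ofLp ⨯₃ x.2.ofLp : Fin 3 → ℝ) := by
    refine continuous_pi fun i => ?_
    fin_cases i <;> simp [cross_apply] <;> fun_prop
  exact (PiLp.continuous_toLp 2 (fun _ : Fin 3 => ℝ)).comp this

theorem intervalIntegrable_poleForm (ht : t₀ ≤ t₁) (hγ : PiecewiseC1 γ t₀ t₁)
    (hs : ∀ t ∈ Icc t₀ t₁, ‖γ t‖ = 1 / 2) {b : E3} (hb : ‖b‖ = 1 / 2)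
    (hbγ : ∀ t ∈ Icc t₀ t₁, γ t ≠ -b) :
    IntervalIntegrable (fun t => poleForm b (γ t) (deriv γ t)) volume t₀ t₁ := by
  -- Written as the pairing of `v` with a vector field in `s` that is continuous off the pole, the
  -- form is integrable because the velocity is.
  have e : ∀ s v, poleForm b s v = inner ℝ ((4 / (1 + 4 * inner ℝ b s)) • cross b s) v := by
    intro s v
    rw [poleForm, inner_cross_left, inner_smul_left]
    simp; ring
  simp only [e]
  refine intervalIntegrable_inner ?_ (hγ.intervalIntegrable_deriv ht)
  rw [uIcc_of_le ht]
  have hc := hγ.continuousOn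
  have h1 : ContinuousOn (fun t => 4 / (1 + 4 * inner ℝ b (γ t))) (Icc t₀ t₁) := by
    refine ContinuousOn.div continuousOn_const ?_ ?_
    · exact continuousOn_const.add
        (continuousOn_const.mul (continuousOn_const.inner hc))
    · exact fun t htt => (one_add_four_inner_pos hb (hs t htt) (hbγ t htt)).ne'
  have h2 : ContinuousOn (fun t => cross b (γ t)) (Icc t₀ t₁) :=
    continuous_cross.comp_continuousOn (continuousOn_const.prodMk hc)
  exact h1.smul h2

/-- The integral along `γ` of the form with pole at `q`. -/
def poleIntegral (γ : ℝ → E3) (t₀ t₁ : ℝ) (q : E3) : ℝ :=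
  ∫ t in t₀..t₁, poleForm (-q) (γ t) (deriv γ t)

theorem piecewiseC1_stereo (hγ : PiecewiseC1 γ t₀ t₁) (hs : ∀ t ∈ Icc t₀ t₁, ‖γ t‖ = 1 / 2)
    {q e₁ e₂ : E3} (hf : cross e₁ e₂ = -((2 : ℝ) • q)) (hq : ‖q‖ = 1 / 2)
    (hqγ : ∀ t ∈ Icc t₀ t₁, γ t ≠ q) (w : ℂ) :
    PiecewiseC1 (fun t => stereo q e₁ e₂ (γ t) - w) t₀ t₁ := by
  refine hγ.comp fun s hsub hc => ?_
  simp only [stereo_eq hf]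
  have hz : ∀ t ∈ s, 1 / 2 + inner ℝ (γ t) (cross e₁ e₂) ≠ 0 := by
    intro t ht
    rw [half_add_inner_eq hf]
    have := one_add_four_inner_pos (b := -q) (by rwa [norm_neg]) (hs t (hsub ht))
      (by rw [neg_neg]; exact hqγ t (hsub ht))
    positivity
  have hi : ∀ w, ContDiffOn ℝ 1 (fun t => inner ℝ (γ t) w) s := fun w =>
    hc.inner ℝ contDiffOn_const
  have hd : ∀ w, ContDiffOn ℝ 1
      (fun t => ((inner ℝ (γ t) w / (1 / 2 + inner ℝ (γ t) (cross e₁ e₂)) : ℝ) : ℂ)) s :=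
    fun w => Complex.ofRealCLM.contDiff.comp_contDiffOn
      ((hi w).div (contDiffOn_const.add (hi _)) hz)
  exact ((hd e₁).add ((hd e₂).mul contDiffOn_const)).sub contDiffOn_const

/-- With `Z = 1/2 + z` the sphere equation reads `x² + y² = Z - Z²`, so the image has squared
modulus `1/Z - 1`. This recovers the height, and then the other two coordinates. -/
theorem stereo_injective_on {q e₁ e₂ s p : E3} (h₁ : ‖e₁‖ = 1) (h₂ : ‖e₂‖ = 1)
    (h : inner ℝ e₁ e₂ = 0) (hf : cross e₁ e₂ = -((2 : ℝ) • q)) (hs : ‖s‖ = 1 / 2)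
    (hp : ‖p‖ = 1 / 2) (hq : ‖q‖ = 1 / 2) (hsq : s ≠ q) (hpq : p ≠ q)
    (e : stereo q e₁ e₂ s = stereo q e₁ e₂ p) : s = p := by
  have n1 := one_add_four_inner_pos (b := -q) (by rwa [norm_neg]) hs (by rwa [neg_neg])
  have n2 := one_add_four_inner_pos (b := -q) (by rwa [norm_neg]) hp (by rwa [neg_neg])
  have z1 : 0 < 1 / 2 + inner ℝ s (cross e₁ e₂) := by rw [half_add_inner_eq hf]; positivity
  have z2 : 0 < 1 / 2 + inner ℝ p (cross e₁ e₂) := by rw [half_add_inner_eq hf]; positivity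
  have hs2 : inner ℝ s s = 1 / 4 := by rw [real_inner_self_eq_norm_sq, hs]; norm_num
  have hp2 : inner ℝ p p = 1 / 4 := by rw [real_inner_self_eq_norm_sq, hp]; norm_num
  have hF := inner_frame h₁ h₂ h
  rw [hF] at hs2 hp2
  rw [stereo_eq hf, stereo_eq hf] at e
  have er := congrArg Complex.re e
  have ei := congrArg Complex.im e
  simp only [Complex.add_re, Complex.add_im, Complex.mul_re,
    Complex.mul_im, Complex.ofReal_re, Complex.ofReal_im, Complex.I_re, Complex.I_im] at er ei
  rw [eq_frame h₁ h₂ h s, eq_frame h₁ h₂ h p]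
  generalize inner ℝ s e₁ = x at *
  generalize inner ℝ s e₂ = y at *
  generalize inner ℝ s (cross e₁ e₂) = z at *
  generalize inner ℝ p e₁ = a at *
  generalize inner ℝ p e₂ = b at *
  generalize inner ℝ p (cross e₁ e₂) = c at *
  have er' : x / (1 / 2 + z) = a / (1 / 2 + c) := by linarith
  have ei' : y / (1 / 2 + z) = b / (1 / 2 + c) := by linarith
  have aux : ∀ {x y Z : ℝ}, Z ≠ 0 → x ^ 2 + y ^ 2 = Z - Z ^ 2 →
      (x / Z) ^ 2 + (y / Z) ^ 2 = 1 / Z - 1 := by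
    intro x y Z hZ h
    field_simp
    linear_combination h
  have k1 : (x / (1 / 2 + z)) ^ 2 + (y / (1 / 2 + z)) ^ 2 = 1 / (1 / 2 + z) - 1 :=
    aux z1.ne' (by linear_combination hs2)
  have k2 : (a / (1 / 2 + c)) ^ 2 + (b / (1 / 2 + c)) ^ 2 = 1 / (1 / 2 + c) - 1 :=
    aux z2.ne' (by linear_combination hp2)
  rw [er', ei', k2] at k1
  have hzc : 1 / 2 + z = 1 / 2 + c := by
    have : 1 / (1 / 2 + z) = 1 / (1 / 2 + c) := by linarith
    simpa using this
  rw [hzc] at er' ei'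
  have hx : x = a := (div_left_inj' z2.ne').1 er'
  have hy : y = b := (div_left_inj' z2.ne').1 ei'
  have hz : z = c := by linarith
  rw [hx, hy, hz]

theorem integral_angularSpeed_stereo (ht : t₀ ≤ t₁) (hγ : PiecewiseC1 γ t₀ t₁)
    (hs : ∀ t ∈ Icc t₀ t₁, ‖γ t‖ = 1 / 2) {p q e₁ e₂ : E3} (h₁ : ‖e₁‖ = 1) (h₂ : ‖e₂‖ = 1)
    (h : inner ℝ e₁ e₂ = 0) (hf : cross e₁ e₂ = -((2 : ℝ) • q)) (hp : ‖p‖ = 1 / 2)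
    (hq : ‖q‖ = 1 / 2) (hpq : p ≠ q) (hpγ : ∀ t ∈ Icc t₀ t₁, γ t ≠ p)
    (hqγ : ∀ t ∈ Icc t₀ t₁, γ t ≠ q) :
    ∫ t in t₀..t₁, angularSpeed (fun τ => stereo q e₁ e₂ (γ τ) - stereo q e₁ e₂ p) t
      = poleIntegral γ t₀ t₁ q - poleIntegral γ t₀ t₁ p := by
  rw [poleIntegral, poleIntegral, ← intervalIntegral.integral_sub]
  · obtain ⟨S, hS, C, hC⟩ := hγ.exists_regular
    refine intervalIntegral.integral_congr_ae_restrict ?_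
    refine ae_restrict_uIoc_of_finite hS ht fun t htt => ?_
    have hI := Ioo_subset_Icc_self htt.1
    exact angularSpeed_stereo h₁ h₂ h hf (hC t htt).1 (hs t hI)
      (inner_deriv_eq_zero hs htt.1 (hC t htt).1) hp hq (hqγ t hI) hpq (hpγ t hI)
  · exact intervalIntegrable_poleForm ht hγ hs (by rwa [norm_neg]) (by simpa using hqγ)
  · exact intervalIntegrable_poleForm ht hγ hs (by rwa [norm_neg]) (by simpa using hpγ)

/-- Moving the pole changes the integral only by the turning of the stereographic image, which the
index counts. -/
theorem poleIntegral_sub_of_hasIndex (ht : t₀ ≤ t₁) (hγ : PiecewiseC1 γ t₀ t₁)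
    (hs : ∀ t ∈ Icc t₀ t₁, ‖γ t‖ = 1 / 2) {p q : E3} (hp : ‖p‖ = 1 / 2) (hq : ‖q‖ = 1 / 2)
    (hpq : p ≠ q) (hpγ : ∀ t ∈ Icc t₀ t₁, γ t ≠ p) (hqγ : ∀ t ∈ Icc t₀ t₁, γ t ≠ q) {k : ℤ}
    (hk : HasIndex γ t₀ t₁ p q k) :
    poleIntegral γ t₀ t₁ q - poleIntegral γ t₀ t₁ p = 2 * Real.pi * k := by
  obtain ⟨e₁, e₂, h₁, h₂, h, hf, hw⟩ := hk
  rw [← integral_angularSpeed_stereo ht hγ hs h₁ h₂ h hf hp hq hpq hpγ hqγ]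
  exact HasWindingNumber.integral (c := fun t => stereo q e₁ e₂ (γ t)) ht
    (piecewiseC1_stereo hγ hs hf hq hqγ _) hw

theorem exists_frame {n : E3} (hn : ‖n‖ = 1) :
    ∃ e₁ e₂ : E3, ‖e₁‖ = 1 ∧ ‖e₂‖ = 1 ∧ inner ℝ e₁ e₂ = 0 ∧ cross e₁ e₂ = n := by
  obtain ⟨b, hb⟩ := Orthonormal.exists_orthonormalBasis_extension_of_card_eq (𝕜 := ℝ) (E := E3)
    (ι := Fin 3) (by simp) (v := fun _ => n) (s := {0}) (by
      constructor
      · intro i; simpa using hn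
      · intro i j hij; exact absurd (Subsingleton.elim i j) hij)
  have b0 := hb 0 rfl
  have o1 : inner ℝ n (b 1) = 0 := by rw [← b0]; exact b.orthonormal.2 (by decide)
  have n1 : ‖b 1‖ = 1 := b.orthonormal.1 1
  -- Any unit vector `e₁ ⊥ n` may start the frame; expanding the double product shows that `e₂ = n ×
  -- e₁` closes it up with the right orientation.
  have hne : cross (b 1) (cross n (b 1)) = n := by
    have s1 : inner ℝ (b 1) (b 1) = 1 := by rw [real_inner_self_eq_norm_sq, n1]; norm_num
    rw [inner_eq] at o1 s1
    ext i
    fin_cases i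
    · simp; linear_combination n 0 * s1 - b 1 0 * o1
    · simp; linear_combination n 1 * s1 - b 1 1 * o1
    · simp; linear_combination n 2 * s1 - b 1 2 * o1
  obtain ⟨b', c0, c1, c2⟩ := exists_orthonormalBasis_cross hn n1 o1
  refine ⟨b 1, cross n (b 1), n1, ?_, ?_, hne⟩
  · rw [← c2]; exact b'.orthonormal.1 2
  · rw [← c2, ← c1]; exact b'.orthonormal.2 (by decide)

/-- The index hypothesis compares only points of `D` with exterior points. For two points of `D`
this integrality, together with continuity in the pole, gives equal integrals. -/
theorem exists_int_poleIntegral_sub (ht : t₀ ≤ t₁) (hγ : PiecewiseC1 γ t₀ t₁)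
    (hs : ∀ t ∈ Icc t₀ t₁, ‖γ t‖ = 1 / 2) (hcl : γ t₀ = γ t₁) {p q : E3} (hp : ‖p‖ = 1 / 2)
    (hq : ‖q‖ = 1 / 2) (hpγ : ∀ t ∈ Icc t₀ t₁, γ t ≠ p) (hqγ : ∀ t ∈ Icc t₀ t₁, γ t ≠ q) :
    ∃ k : ℤ, poleIntegral γ t₀ t₁ q - poleIntegral γ t₀ t₁ p = 2 * Real.pi * k := by
  by_cases hpq : p = q
  · exact ⟨0, by simp [hpq]⟩
  obtain ⟨e₁, e₂, h₁, h₂, h, hf⟩ := exists_frame (n := -((2 : ℝ) • q))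
    (by rw [norm_neg, norm_smul, hq]; norm_num)
  rw [← integral_angularSpeed_stereo ht hγ hs h₁ h₂ h hf hp hq hpq hpγ hqγ]
  refine exists_int_integral_angularSpeed ht (piecewiseC1_stereo hγ hs hf hq hqγ _) ?_ ?_
  · intro t htt e
    exact hpγ t htt (stereo_injective_on h₁ h₂ h hf (hs t htt) hp hq (hqγ t htt) hpq
      (sub_eq_zero.1 e))
  · simp only [hcl]

/-- Dominated convergence: a pole off the compact trace keeps the denominators away from zero,
uniformly for nearby poles. -/
theorem continuousAt_poleIntegral (ht : t₀ ≤ t₁) (hγ : PiecewiseC1 γ t₀ t₁)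
    (hs : ∀ t ∈ Icc t₀ t₁, ‖γ t‖ = 1 / 2) {q : E3} (hq : ‖q‖ = 1 / 2)
    (hqγ : ∀ t ∈ Icc t₀ t₁, γ t ≠ q) : ContinuousAt (poleIntegral γ t₀ t₁) q := by
  obtain ⟨S, hS, C, hC⟩ := hγ.exists_regular
  have hpos : ∀ t ∈ Icc t₀ t₁, 0 < 1 + 4 * inner ℝ (-q) (γ t) := fun t htt =>
    one_add_four_inner_pos (by rwa [norm_neg]) (hs t htt) (by rw [neg_neg]; exact hqγ t htt)
  obtain ⟨δ, hδ, hmin⟩ : ∃ δ > 0, ∀ t ∈ Icc t₀ t₁, 2 * δ ≤ 1 + 4 * inner ℝ (-q) (γ t) := by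
    obtain ⟨T, hT, hm⟩ := isCompact_Icc.exists_isMinOn (nonempty_Icc.2 ht)
      (f := fun t => 1 + 4 * inner ℝ (-q) (γ t))
      (continuousOn_const.add (continuousOn_const.mul (continuousOn_const.inner hγ.continuousOn)))
    refine ⟨(1 + 4 * inner ℝ (-q) (γ T)) / 2, by have := hpos T hT; positivity, fun t htt => ?_⟩
    have := hm htt
    simp only [mem_ofPred_eq] at this
    linarith
  -- As `‖γ t‖ = 1/2`, a displacement of the pole by less than `δ/2` moves the denominator by less
  -- than `δ`, from at least `2δ`. The bound `1` keeps `‖x‖ ≤ 3/2`.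
  have hnear : ∀ᶠ x in nhds q, ‖x - q‖ < min (δ / 2) 1 := by
    have := Metric.ball_mem_nhds q (lt_min (half_pos hδ) one_pos)
    filter_upwards [this] with x hx
    rwa [← dist_eq_norm]
  have hden : ∀ x, ‖x - q‖ < min (δ / 2) 1 → ∀ t ∈ Icc t₀ t₁, δ ≤ 1 + 4 * inner ℝ (-x) (γ t) := by
    intro x hx t htt
    have h1 := hmin t htt
    have h2 := abs_le.1 (abs_real_inner_le_norm (x - q) (γ t))
    have h3 : ‖x - q‖ < δ / 2 := hx.trans_le (min_le_left _ _)
    rw [hs t htt, inner_sub_left] at h2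
    rw [inner_neg_left] at h1 ⊢
    linarith [h2.2]
  refine intervalIntegral.continuousAt_of_dominated_interval
    (bound := fun _ => 4 * (3 / 2 * (1 / 2 * C)) / δ) ?_ ?_ intervalIntegrable_const ?_
  · refine Filter.Eventually.of_forall fun x => ?_
    have hm : AEMeasurable γ (volume.restrict (uIoc t₀ t₁)) := by
      rw [uIoc_of_le ht]
      exact (hγ.continuousOn.mono Ioc_subset_Icc_self).aemeasurable measurableSet_Ioc
    have hm2 : AEMeasurable (deriv γ) (volume.restrict (uIoc t₀ t₁)) :=
      (measurable_deriv γ).aemeasurable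
    refine AEMeasurable.aestronglyMeasurable ?_
    unfold poleForm
    refine AEMeasurable.div ?_ ?_
    · exact (aemeasurable_const.inner
        (continuous_cross.measurable.comp_aemeasurable (hm.prodMk hm2))).const_mul 4
    · exact ((aemeasurable_const.inner hm).const_mul 4).const_add 1
  · filter_upwards [hnear] with x hx
    rw [← ae_restrict_iff' measurableSet_uIoc]
    refine ae_restrict_uIoc_of_finite hS ht fun t htt => ?_
    have hI := Ioo_subset_Icc_self htt.1
    have h1 := hden x hx t hI
    have hC' := (hC t htt).2.2
    have hxn : ‖x‖ ≤ 3 / 2 := by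
      have := norm_le_norm_add_norm_sub' x q
      have := hx.trans_le (min_le_right _ _)
      linarith
    rw [poleForm, norm_div, norm_mul, Real.norm_of_nonneg (by norm_num : (0 : ℝ) ≤ 4),
      Real.norm_of_nonneg (hδ.le.trans h1)]
    have hin : ‖inner ℝ (-x) (cross (γ t) (deriv γ t))‖ ≤ 3 / 2 * (1 / 2 * C) := by
      refine (norm_inner_le_norm _ _).trans ?_
      rw [norm_neg]
      refine mul_le_mul hxn ?_ (norm_nonneg _) (by norm_num)
      refine (norm_cross_le _ _).trans ?_
      rw [hs t hI]
      gcongr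
    have : 0 ≤ C := (norm_nonneg _).trans hC'
    gcongr
  · refine Filter.Eventually.of_forall fun t htt => ?_
    rw [uIoc_of_le ht] at htt
    unfold poleForm
    refine ContinuousAt.div (by fun_prop) (by fun_prop) (hpos t (Ioc_subset_Icc_self htt)).ne'

end SphericalCurve

/-! ### Averaging over the pole -/

/-- Radial projection to `S²(1/2)`. -/
def radial (x : E3) : E3 := (2 * ‖x‖)⁻¹ • x

theorem norm_radial {x : E3} (hx : x ≠ 0) : ‖radial x‖ = 1 / 2 := by
  have := norm_pos_iff.2 hx
  rw [radial, norm_smul, norm_inv, norm_mul, norm_norm, Real.norm_ofNat]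
  field_simp

/-- The reflection that reverses `s × v` fixes `s` and preserves the ball. It changes the sign of
the numerator and leaves the denominator alone, so the integral equals its own negative;
integrability is not needed. -/
theorem integral_poleForm_radial (s v : E3) :
    ∫ x in Metric.ball (0 : E3) 1, poleForm (-radial x) s v = 0 := by
  set w := cross s v with hw
  set R := (ℝ ∙ w)ᗮ.reflection with hR
  have hRw : R w = -w := Submodule.reflection_orthogonalComplement_singleton_eq_neg w
  have hRs : R s = s := by
    refine Submodule.reflection_mem_subspace_eq_self ?_
    rw [Submodule.mem_orthogonal_singleton_iff_inner_right, hw]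
    simp only [inner_eq, cross_zero, cross_one, cross_two]; ring
  have hodd : ∀ x, poleForm (-radial (R x)) s v = -poleForm (-radial x) s v := by
    intro x
    have e1 : inner ℝ (R x) w = -inner ℝ x w := by
      have h := R.inner_map_map x w
      rw [hRw, inner_neg_right] at h
      linarith
    have e2 : inner ℝ (R x) s = inner ℝ x s := by
      have h := R.inner_map_map x s
      rwa [hRs] at h
    simp only [poleForm, radial, inner_neg_left, inner_smul_left, ← hw, e1, e2,
      LinearIsometryEquiv.norm_map]
    ring
  have h := R.measurePreserving.setIntegral_preimage_emb
    R.toHomeomorph.measurableEmbedding (fun x => poleForm (-radial x) s v) (Metric.ball 0 1)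
  have hpre : R ⁻¹' Metric.ball 0 1 = Metric.ball 0 1 := by
    ext x; simp
  rw [hpre] at h
  simp only [hodd, integral_neg] at h
  linarith

theorem exists_basis_last {n : E3} (hn : ‖n‖ = 1) :
    ∃ b : OrthonormalBasis (Fin 3) ℝ E3, b 2 = n := by
  obtain ⟨e₁, e₂, h₁, h₂, h, hc⟩ := exists_frame hn
  obtain ⟨b, -, -, hb⟩ := exists_orthonormalBasis_cross h₁ h₂ h
  exact ⟨b, hb.trans hc⟩

/-- An integrable function of one variable with a singularity at `0`. -/
def halfPower (y : ℝ) : ℝ := (Icc (-1 : ℝ) 1).indicator (fun y => |y| ^ (-(1 / 2) : ℝ)) y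

/-- A product of functions of one variable dominating the kernel. -/
def dominator (i : Fin 3) : ℝ → ℝ :=
  if i = 2 then (Icc (-1 : ℝ) 1).indicator (fun _ => 1) else halfPower

/-- The exponent `-1/2` exceeds `-1`, so the singularity at `0` is integrable. -/
theorem integrable_halfPower : Integrable halfPower := by
  have h1 : IntervalIntegrable (fun y : ℝ => |y| ^ (-(1 / 2) : ℝ)) volume 0 1 := by
    have h : IntervalIntegrable (fun y : ℝ => y ^ (-(1 / 2) : ℝ)) volume 0 1 :=
      intervalIntegral.intervalIntegrable_rpow' (by norm_num)
    refine h.congr fun y hy => ?_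
    rw [uIoc_of_le zero_le_one] at hy
    simp only [abs_of_pos hy.1]
  have h2 : IntervalIntegrable (fun y : ℝ => |y| ^ (-(1 / 2) : ℝ)) volume (-1) 0 := by
    have := h1.comp_mul_left (c := -1)
    simpa using this.symm
  have h3 := (h2.trans h1).1
  rw [← integrableOn_Icc_iff_integrableOn_Ioc] at h3
  exact h3.integrable_indicator measurableSet_Icc

theorem integrable_dominator (i : Fin 3) : Integrable (dominator i) := by
  unfold dominator
  split_ifs
  · exact IntegrableOn.integrable_indicator (by simp) measurableSet_Icc
  · exact integrable_halfPower

/-- Orthonormal coordinates preserve volume, and the integral of the product splits. Its value does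
not depend on `b`, which makes the later bound uniform along a curve. -/
theorem integrable_prod_dominator (b : OrthonormalBasis (Fin 3) ℝ E3) :
    Integrable (fun x : E3 => ∏ i, dominator i (inner ℝ (b i) x)) ∧
    ∫ x : E3, ∏ i, dominator i (inner ℝ (b i) x) = ∏ i, ∫ y, dominator i y := by
  have hmp : MeasurePreserving (fun x : E3 => (b.repr x).ofLp) volume volume :=
    (PiLp.volume_preserving_ofLp (Fin 3)).comp b.measurePreserving_repr
  have hemb : MeasurableEmbedding (fun x : E3 => (b.repr x).ofLp) :=
    ((MeasurableEquiv.toLp 2 (Fin 3 → ℝ)).symm.measurableEmbedding).comp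
      b.repr.toHomeomorph.measurableEmbedding
  have hint : Integrable (fun y : Fin 3 → ℝ => ∏ i, dominator i (y i)) volume :=
    Integrable.fintype_prod (fun i => integrable_dominator i)
  have e : ∀ x : E3, ∏ i, dominator i (inner ℝ (b i) x)
      = (fun y : Fin 3 → ℝ => ∏ i, dominator i (y i)) ((b.repr x).ofLp) := by
    intro x
    simp only [b.repr_apply_apply]
  rw [funext e]
  refine ⟨(hmp.integrable_comp_emb hemb).2 hint, ?_⟩
  refine (hmp.integral_comp hemb (fun y : Fin 3 → ℝ => ∏ i, dominator i (y i))).trans ?_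
  exact integral_fintype_prod_eq_prod (fun i => dominator i)

/-- Let `ρ² = x₀² + x₁²` be the squared distance from the singular axis. The numerator is at most `ρ
V`, while `N - x₂ = ρ² / (N + x₂) ≥ ρ² / 2` because `N < 1`. The quotient is thus at most `2V / ρ`,
and `ρ² ≥ |x₀| |x₁|` separates the variables. -/
theorem poleForm_radial_aux {N x₀ x₁ x₂ P V : ℝ} (hN : 0 < N) (hN1 : N < 1) (hV : 0 ≤ V)
    (hx : N ^ 2 = x₀ ^ 2 + x₁ ^ 2 + x₂ ^ 2) (h0 : x₀ ≠ 0) (h1 : x₁ ≠ 0)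
    (hP : P ^ 2 ≤ (x₀ ^ 2 + x₁ ^ 2) * V ^ 2 / 4) :
    |2 * P / (N - x₂)| ≤ 2 * V * (|x₀| ^ (-(1 / 2) : ℝ) * |x₁| ^ (-(1 / 2) : ℝ)) := by
  have hρ : 0 < x₀ ^ 2 + x₁ ^ 2 := by positivity
  have hx2 : |x₂| < N := by
    refine abs_lt_of_sq_lt_sq ?_ hN.le
    linarith
  obtain ⟨hl, hr⟩ := abs_lt.1 hx2
  have hd : 0 < N - x₂ := by linarith
  have a0 : 0 < |x₀| := abs_pos.2 h0
  have a1 : 0 < |x₁| := abs_pos.2 h1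
  have e : |x₀| ^ (-(1 / 2) : ℝ) * |x₁| ^ (-(1 / 2) : ℝ) = (Real.sqrt (|x₀| * |x₁|))⁻¹ := by
    rw [← Real.mul_rpow a0.le a1.le, Real.rpow_neg (by positivity), Real.sqrt_eq_rpow]
  have hsq : |x₀| * |x₁| ≤ x₀ ^ 2 + x₁ ^ 2 := by
    rw [← sq_abs x₀, ← sq_abs x₁]
    nlinarith [sq_nonneg (|x₀| - |x₁|), sq_nonneg (|x₀|), sq_nonneg (|x₁|)]
  rw [e, abs_div, abs_of_pos hd, abs_mul, abs_two, ← div_eq_mul_inv, div_le_div_iff₀ hd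
    (Real.sqrt_pos.2 (by positivity))]
  have hP' : |P| ≤ Real.sqrt (x₀ ^ 2 + x₁ ^ 2) * V / 2 := by
    refine abs_le_of_sq_le_sq ?_ (by positivity)
    rw [div_pow, mul_pow, Real.sq_sqrt hρ.le]
    linarith
  have hdl : (x₀ ^ 2 + x₁ ^ 2) / 2 ≤ N - x₂ := by
    have : x₀ ^ 2 + x₁ ^ 2 = (N - x₂) * (N + x₂) := by linarith
    rw [this]
    nlinarith
  calc 2 * |P| * Real.sqrt (|x₀| * |x₁|)
      ≤ 2 * (Real.sqrt (x₀ ^ 2 + x₁ ^ 2) * V / 2) * Real.sqrt (x₀ ^ 2 + x₁ ^ 2) := by gcongr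
    _ = V * (x₀ ^ 2 + x₁ ^ 2) := by
      have := Real.mul_self_sqrt hρ.le
      linear_combination V * this
    _ = 2 * V * ((x₀ ^ 2 + x₁ ^ 2) / 2) := by ring
    _ ≤ 2 * V * (N - x₂) := by gcongr

theorem ae_inner_ne_zero {e : E3} (he : ‖e‖ = 1) : ∀ᵐ x : E3, inner ℝ e x ≠ 0 := by
  have h := Measure.addHaar_submodule (volume : Measure E3) (ℝ ∙ e)ᗮ (by
    intro h
    have hm : e ∈ (ℝ ∙ e)ᗮ := by rw [h]; trivial
    rw [Submodule.mem_orthogonal_singleton_iff_inner_right, real_inner_self_eq_norm_sq, he] at hm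
    norm_num at hm)
  refine measure_mono_null (fun x hx => ?_) h
  simp only [mem_compl_iff, mem_ofPred_eq, not_not] at hx
  exact Submodule.mem_orthogonal_singleton_iff_inner_right.2 hx

theorem norm_sq_cross (u v : E3) : ‖cross u v‖ ^ 2 = ‖u‖ ^ 2 * ‖v‖ ^ 2 - (inner ℝ u v) ^ 2 := by
  rw [norm_sq_eq, norm_sq_eq, norm_sq_eq, inner_eq]
  simp only [cross_zero, cross_one, cross_two]
  ring

theorem norm_poleForm_radial_le {s : E3} (v : E3) {b : OrthonormalBasis (Fin 3) ℝ E3}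
    (hb : b 2 = (2 : ℝ) • s) {x : E3} (hx : x ∈ Metric.ball (0 : E3) 1)
    (h0 : inner ℝ (b 0) x ≠ 0) (h1 : inner ℝ (b 1) x ≠ 0) :
    ‖poleForm (-radial x) s v‖ ≤ 2 * ‖v‖ * ∏ i, dominator i (inner ℝ (b i) x) := by
  have hx0 : x ≠ 0 := by rintro rfl; simp at h0
  have hN := norm_pos_iff.2 hx0
  have hN1 : ‖x‖ < 1 := by simpa using hx
  have hcoord : ∀ i, inner ℝ (b i) x ∈ Icc (-1 : ℝ) 1 := by
    intro i
    have := abs_real_inner_le_norm (b i) x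
    rw [b.orthonormal.1 i, one_mul] at this
    exact abs_le.1 (this.trans hN1.le)
  have hs : s = (1 / 2 : ℝ) • b 2 := by rw [hb, smul_smul]; norm_num
  have hsum : ‖x‖ ^ 2 = inner ℝ (b 0) x ^ 2 + inner ℝ (b 1) x ^ 2 + inner ℝ (b 2) x ^ 2 := by
    rw [← b.sum_sq_inner_right x, Fin.sum_univ_three]
  have hP : inner ℝ x (cross s v) ^ 2
      ≤ (inner ℝ (b 0) x ^ 2 + inner ℝ (b 1) x ^ 2) * ‖v‖ ^ 2 / 4 := by
    -- Since `s` is half a unit vector, `|x × s|` is half the distance of `x` from the axis of `s`.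
    have e1 : ‖cross x s‖ ^ 2 = (inner ℝ (b 0) x ^ 2 + inner ℝ (b 1) x ^ 2) / 4 := by
      rw [norm_sq_cross, hsum, hs, norm_smul, inner_smul_right, b.orthonormal.1 2,
        real_inner_comm (b 2)]
      norm_num
      ring
    rw [inner_cross_left]
    have := abs_real_inner_le_norm (cross x s) v
    calc inner ℝ (cross x s) v ^ 2 = |inner ℝ (cross x s) v| ^ 2 := (sq_abs _).symm
      _ ≤ (‖cross x s‖ * ‖v‖) ^ 2 := by gcongr
      _ = _ := by rw [mul_pow, e1]; ring
  have key := poleForm_radial_aux hN hN1 (norm_nonneg v) hsum h0 h1 hP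
  have e : poleForm (-radial x) s v = -(2 * inner ℝ x (cross s v) / (‖x‖ - inner ℝ (b 2) x)) := by
    have e2 : inner ℝ x s = inner ℝ (b 2) x / 2 := by
      rw [hs, inner_smul_right, real_inner_comm]; ring
    have hx2 : ‖x‖ - inner ℝ (b 2) x ≠ 0 := by
      intro h
      have : inner ℝ (b 0) x ^ 2 + inner ℝ (b 1) x ^ 2 = 0 := by
        have h' : ‖x‖ = inner ℝ (b 2) x := by linarith
        rw [h'] at hsum
        linarith
      have : 0 < inner ℝ (b 0) x ^ 2 := by positivity
      nlinarith [sq_nonneg (inner ℝ (b 1) x)]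
    have hd : 1 + 4 * -((2 * ‖x‖)⁻¹ * (inner ℝ (b 2) x / 2))
        = (‖x‖ - inner ℝ (b 2) x) / ‖x‖ := by field_simp; ring
    simp only [poleForm, radial, inner_neg_left, inner_smul_left, e2, conj_trivial]
    rw [hd]
    field_simp
    ring
  rw [e, norm_neg, Real.norm_eq_abs]
  refine key.trans (le_of_eq ?_)
  rw [Fin.prod_univ_three]
  have hp : ∀ i, halfPower (inner ℝ (b i) x) = |inner ℝ (b i) x| ^ (-(1 / 2) : ℝ) :=
    fun i => indicator_of_mem (hcoord i) _
  have d0 : dominator 0 = halfPower := by simp [dominator]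
  have d1 : dominator 1 = halfPower := by simp [dominator]
  have d2 : dominator 2 (inner ℝ (b 2) x) = 1 := by
    simp only [dominator, if_true]
    exact indicator_of_mem (hcoord 2) _
  rw [d0, d1, d2, hp, hp, mul_one]

theorem measurable_poleForm_radial : Measurable (fun x : E3 × E3 × E3 =>
    poleForm (-radial x.1) x.2.1 x.2.2) := by
  unfold poleForm radial
  refine Measurable.div ?_ ?_
  · exact ((((measurable_fst.norm.const_mul 2).inv.smul measurable_fst).neg).inner
      (continuous_cross.measurable.comp measurable_snd)).const_mul 4
  · exact (((((measurable_fst.norm.const_mul 2).inv.smul measurable_fst).neg).inner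
      (measurable_fst.comp measurable_snd)).const_mul 4).const_add 1

theorem measurable_poleForm_radial_left (s v : E3) :
    Measurable (fun x : E3 => poleForm (-radial x) s v) := by
  unfold poleForm radial
  have h : Measurable (fun x : E3 => (-((2 * ‖x‖)⁻¹ • x))) :=
    ((measurable_norm.const_mul 2).inv.smul measurable_id).neg
  refine Measurable.div ?_ ?_
  · exact (h.inner measurable_const).const_mul 4
  · exact ((h.inner measurable_const).const_mul 4).const_add 1

theorem aestronglyMeasurable_poleForm_radial {α : Type*} [MeasurableSpace α] {μ : Measure α}
    {x s v : α → E3} (hx : AEMeasurable x μ) (hs : AEMeasurable s μ) (hv : AEMeasurable v μ) :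
    AEStronglyMeasurable (fun a => poleForm (-radial (x a)) (s a) (v a)) μ := by
  have h : AEMeasurable (fun a => (x a, s a, v a)) μ := hx.prodMk (hs.prodMk hv)
  have h2 := Measurable.comp_aemeasurable
    (g := fun x : E3 × E3 × E3 => poleForm (-radial x.1) x.2.1 x.2.2)
    measurable_poleForm_radial h
  exact AEMeasurable.aestronglyMeasurable h2

/-- The bound is uniform in `s` and linear in `‖v‖`, which is what Fubini's theorem requires along a
curve with integrable speed. -/
theorem integrableOn_poleForm_radial {s : E3} (hs : ‖s‖ = 1 / 2) (v : E3) :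
    IntegrableOn (fun x => poleForm (-radial x) s v) (Metric.ball 0 1) ∧
    ∫ x in Metric.ball (0 : E3) 1, ‖poleForm (-radial x) s v‖
      ≤ 2 * ‖v‖ * ∏ i, ∫ y, dominator i y := by
  obtain ⟨b, hb⟩ := exists_basis_last (n := (2 : ℝ) • s) (by rw [norm_smul, hs]; norm_num)
  obtain ⟨hi, he⟩ := integrable_prod_dominator b
  have hbd : ∀ᵐ x ∂(volume.restrict (Metric.ball (0 : E3) 1)),
      ‖poleForm (-radial x) s v‖ ≤ 2 * ‖v‖ * ∏ i, dominator i (inner ℝ (b i) x) := by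
    rw [ae_restrict_iff' measurableSet_ball]
    filter_upwards [ae_inner_ne_zero (b.orthonormal.1 0), ae_inner_ne_zero (b.orthonormal.1 1)]
      with x h0 h1 hx using norm_poleForm_radial_le v hb hx h0 h1
  have hm : AEStronglyMeasurable (fun x => poleForm (-radial x) s v)
      (volume.restrict (Metric.ball (0 : E3) 1)) :=
    (measurable_poleForm_radial_left s v).aestronglyMeasurable
  have hint : IntegrableOn (fun x => poleForm (-radial x) s v) (Metric.ball 0 1) :=
    ((hi.const_mul (2 * ‖v‖)).integrableOn).mono' hm hbd
  refine ⟨hint, ?_⟩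
  have hnn : ∀ i y, 0 ≤ dominator i y := by
    intro i y
    unfold dominator halfPower
    split_ifs <;> exact indicator_nonneg (fun _ _ => by positivity) _
  calc ∫ x in Metric.ball (0 : E3) 1, ‖poleForm (-radial x) s v‖
      ≤ ∫ x in Metric.ball (0 : E3) 1, 2 * ‖v‖ * ∏ i, dominator i (inner ℝ (b i) x) :=
        integral_mono_ae hint.norm ((hi.const_mul (2 * ‖v‖)).integrableOn) hbd
    _ ≤ ∫ x : E3, 2 * ‖v‖ * ∏ i, dominator i (inner ℝ (b i) x) := by
        refine setIntegral_le_integral (hi.const_mul _) (Filter.Eventually.of_forall fun x => ?_)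
        have := Finset.prod_nonneg (s := Finset.univ)
          (fun i (_ : i ∈ Finset.univ) => hnn i (inner ℝ (b i) x))
        simp only [Pi.zero_apply]
        positivity
    _ = _ := by rw [integral_const_mul, he]

/-- The average over all poles of the integrals along a curve vanishes. -/
theorem integral_poleIntegral_radial {γ : ℝ → E3} {t₀ t₁ : ℝ} (ht : t₀ ≤ t₁)
    (hγ : PiecewiseC1 γ t₀ t₁) (hs : ∀ t ∈ Icc t₀ t₁, ‖γ t‖ = 1 / 2) :
    ∫ x in Metric.ball (0 : E3) 1, poleIntegral γ t₀ t₁ (radial x) = 0 := by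
  have hm : AEMeasurable γ (volume.restrict (Ioc t₀ t₁)) :=
    (hγ.continuousOn.mono Ioc_subset_Icc_self).aemeasurable measurableSet_Ioc
  have hjm : AEStronglyMeasurable
      (Function.uncurry fun (x : E3) (t : ℝ) => poleForm (-radial x) (γ t) (deriv γ t))
      ((volume.restrict (Metric.ball (0 : E3) 1)).prod (volume.restrict (Ioc t₀ t₁))) := by
    have h1 := aestronglyMeasurable_poleForm_radial
      (μ := (volume.restrict (Metric.ball (0 : E3) 1)).prod (volume.restrict (Ioc t₀ t₁)))
      (x := fun z => z.1) (s := fun z => γ z.2) (v := fun z => deriv γ z.2)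
      measurable_fst.aemeasurable hm.comp_snd
      ((measurable_deriv γ).comp measurable_snd).aemeasurable
    exact h1
  have hint : Integrable
      (Function.uncurry fun (x : E3) (t : ℝ) => poleForm (-radial x) (γ t) (deriv γ t))
      ((volume.restrict (Metric.ball (0 : E3) 1)).prod (volume.restrict (Ioc t₀ t₁))) := by
    refine (integrable_prod_iff' hjm).2 ⟨?_, ?_⟩
    · refine (ae_restrict_iff' measurableSet_Ioc).2 (Filter.Eventually.of_forall fun t htt => ?_)
      have h := (integrableOn_poleForm_radial (hs t (Ioc_subset_Icc_self htt)) (deriv γ t)).1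
      exact h
    · have hd := (hγ.intervalIntegrable_deriv ht).1.norm
      have hd2 := hd.const_mul (2 * ∏ i, ∫ y, dominator i y)
      refine Integrable.mono' hd2 hjm.norm.prod_swap.integral_prod_right' ?_
      refine (ae_restrict_iff' measurableSet_Ioc).2 (Filter.Eventually.of_forall fun t htt => ?_)
      have h := (integrableOn_poleForm_radial (hs t (Ioc_subset_Icc_self htt)) (deriv γ t)).2
      rw [Real.norm_of_nonneg (integral_nonneg fun _ => norm_nonneg _)]
      refine h.trans (le_of_eq ?_)
      ring
  simp only [poleIntegral, intervalIntegral.integral_of_le ht]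
  -- With the pole integrated first, the inner integral vanishes at every time.
  rw [integral_integral_swap hint]
  simp only [integral_poleForm_radial, integral_zero]

/-! ### Cones over subsets of the sphere -/

/-- Almost no ray meets a piecewise `C¹` curve. -/
theorem ae_radial_notMem {γ : ℝ → E3} {t₀ t₁ : ℝ} (hγ : PiecewiseC1 γ t₀ t₁)
    (hs : ∀ t ∈ Icc t₀ t₁, ‖γ t‖ = 1 / 2) :
    ∀ᵐ x : E3, x ≠ 0 → radial x ∉ γ '' Icc t₀ t₁ := by
  obtain ⟨S, hS, C, hC⟩ := hγ.exists_regular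
  set A : Set E3 := {y | y 1 ∈ Ioo t₀ t₁ \ S} with hA
  -- This map parametrizes the cone over the regular part of the curve and ignores the third
  -- coordinate. Its derivative is therefore singular, and its image is null.
  set Φ : E3 → E3 := fun y => y 0 • γ (y 1) with hΦ
  have hreg : volume (Φ '' A) = 0 := by
    refine addHaar_image_eq_zero_of_det_fderivWithin_eq_zero (E := E3) volume
      (f' := fun y => y 0 • ((EuclideanSpace.proj (𝕜 := ℝ) (1 : Fin 3)).smulRight (deriv γ (y 1)))
        + (EuclideanSpace.proj (𝕜 := ℝ) (0 : Fin 3)).smulRight (γ (y 1))) ?_ ?_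
    · intro y hy
      have h0 : HasFDerivAt (fun y : E3 => y 0) (EuclideanSpace.proj (𝕜 := ℝ) (0 : Fin 3)) y :=
        (EuclideanSpace.proj (𝕜 := ℝ) (0 : Fin 3)).hasFDerivAt
      have h1 : HasFDerivAt (fun y : E3 => y 1) (EuclideanSpace.proj (𝕜 := ℝ) (1 : Fin 3)) y :=
        (EuclideanSpace.proj (𝕜 := ℝ) (1 : Fin 3)).hasFDerivAt
      have h2 : HasFDerivAt (fun y : E3 => γ (y 1))
          ((EuclideanSpace.proj (𝕜 := ℝ) (1 : Fin 3)).smulRight (deriv γ (y 1))) y := by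
        have := (hC (y 1) hy).1.hasFDerivAt.comp y h1
        refine this.congr_fderiv ?_
        ext v; simp
      exact (h0.smul h2).hasFDerivWithinAt
    · intro y _
      refine LinearMap.det_eq_zero_iff_ker_ne_bot.2 fun h => ?_
      have hm : (EuclideanSpace.single (2 : Fin 3) (1 : ℝ) : E3) ∈ (⊥ : Submodule ℝ E3) := by
        rw [← h, LinearMap.mem_ker]
        simp
      simp at hm
  -- Finitely many times remain, the breakpoints and the endpoints; each contributes a ray,
  -- contained in a null plane.
  have hray : ∀ t ∈ Icc t₀ t₁, ∀ᵐ x : E3, x ≠ 0 → radial x ≠ γ t := by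
    intro t htt
    obtain ⟨b, hb⟩ := exists_basis_last (n := (2 : ℝ) • γ t)
      (by rw [norm_smul, hs t htt]; norm_num)
    filter_upwards [ae_inner_ne_zero (b.orthonormal.1 0)] with x hx hx0 e
    have h1 : inner ℝ (b 0) (b 2) = 0 := b.orthonormal.2 (by decide)
    rw [hb, ← e, radial, inner_smul_right, inner_smul_right] at h1
    have := norm_pos_iff.2 hx0
    have h2 : (2 : ℝ) * (2 * ‖x‖)⁻¹ ≠ 0 := by positivity
    rw [← mul_assoc] at h1
    exact hx ((mul_eq_zero.1 h1).resolve_left h2)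
  have hfin : ∀ᵐ x : E3, ∀ t ∈ (S ∪ {t₀, t₁}) ∩ Icc t₀ t₁, x ≠ 0 → radial x ≠ γ t := by
    refine (ae_ball_iff ?_).2 fun t ht => hray t ht.2
    exact (((hS.union (by simp)).subset inter_subset_left)).countable
  have hnot : ∀ᵐ x : E3, x ∉ Φ '' A := by
    rw [ae_iff]; simp only [not_not]; exact hreg
  filter_upwards [hfin, hnot] with x h1 h2 hx0
  rintro ⟨t, htt, e⟩
  by_cases ht : t ∈ S ∪ {t₀, t₁}
  · exact h1 t ⟨ht, htt⟩ hx0 e.symm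
  · simp only [mem_union, mem_insert_iff, mem_singleton_iff, not_or] at ht
    refine h2 ⟨!₂[2 * ‖x‖, t, 0], ?_, ?_⟩
    · refine ⟨⟨lt_of_le_of_ne htt.1 ?_, lt_of_le_of_ne htt.2 ?_⟩, ?_⟩
      · simpa using fun h => ht.2.1 h.symm
      · simpa using ht.2.2
      · simpa using ht.1
    · have := norm_pos_iff.2 hx0
      simp only [hΦ]
      change (2 * ‖x‖) • γ t = x
      rw [e, radial, smul_smul, mul_inv_cancel₀ (by positivity), one_smul]

/-- The part of the unit ball over a subset of `S²(1/2)`. -/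
def coneOver (D : Set ShapeSphere) : Set E3 :=
  {x | x ∈ Metric.ball 0 1 ∧ x ≠ 0 ∧ radial x ∈ Subtype.val '' D}

theorem continuous_halfScale : Continuous halfScale :=
  Continuous.subtype_mk (f := fun u : Metric.sphere (0 : E3) 1 => (1 / 2 : ℝ) • (u : E3))
    (by fun_prop) _

-- This is the form of a cone in terms of which `Measure.toSphere` is expressed.
open scoped Pointwise in
theorem coneOver_eq (D : Set ShapeSphere) :
    coneOver D = Ioo (0 : ℝ) 1 • (Subtype.val '' (halfScale ⁻¹' D) : Set E3) := by
  ext x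
  rw [Set.mem_smul]
  constructor
  · rintro ⟨hb, h0, p, hp, e⟩
    have hN := norm_pos_iff.2 h0
    have hu : ‖‖x‖⁻¹ • x‖ = 1 := by
      rw [norm_smul, norm_inv, norm_norm, inv_mul_cancel₀ hN.ne']
    refine ⟨‖x‖, ⟨hN, by simpa using hb⟩, ‖x‖⁻¹ • x,
      ⟨⟨‖x‖⁻¹ • x, by simpa using hu⟩, ?_, rfl⟩, ?_⟩
    · have : halfScale ⟨‖x‖⁻¹ • x, by simpa using hu⟩ = p := by
        apply Subtype.ext
        rw [e, radial]
        simp only [halfScale]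
        rw [smul_smul, mul_inv]
        norm_num
      rw [mem_preimage, this]
      exact hp
    · rw [smul_smul, mul_inv_cancel₀ hN.ne', one_smul]
  · rintro ⟨r, hr, _, ⟨u, hu, rfl⟩, rfl⟩
    have hu1 : ‖(u : E3)‖ = 1 := by simp
    have hn : ‖r • (u : E3)‖ = r := by rw [norm_smul, hu1, mul_one, Real.norm_of_nonneg hr.1.le]
    refine ⟨by simpa [hn] using hr.2, ?_, halfScale u, hu, ?_⟩
    · rw [← norm_pos_iff, hn]; exact hr.1
    · rw [radial, hn, smul_smul]
      simp only [halfScale]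
      congr 1
      have := hr.1.ne'
      field_simp

theorem measurableSet_coneOver {D : Set ShapeSphere} (hD : IsOpen D) :
    MeasurableSet (coneOver D) := by
  obtain ⟨U, hU, rfl⟩ := isOpen_induced_iff.1 hD
  have hm : Measurable radial :=
    (measurable_norm.const_mul 2).inv.smul measurable_id
  have : coneOver (Subtype.val ⁻¹' U) = Metric.ball 0 1 ∩ ({0}ᶜ ∩ radial ⁻¹' U) := by
    ext x
    simp only [coneOver, Subtype.image_preimage_coe, mem_inter_iff, mem_compl_iff,
      mem_singleton_iff, mem_preimage]
    constructor
    · rintro ⟨h1, h2, h3, h4⟩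
      exact ⟨h1, h2, h4⟩
    · rintro ⟨h1, h2, h3⟩
      exact ⟨h1, h2, by simpa using norm_radial h2, h3⟩
  rw [this]
  exact measurableSet_ball.inter ((measurableSet_singleton 0).compl.inter (hm hU.measurableSet))

/-- The area on the unit sphere is `3` times the volume of the cone; radius `1/2` contributes the
factor `1/4`. -/
theorem shapeArea_real {D : Set ShapeSphere} (hD : IsOpen D) :
    shapeArea.real D = 3 / 4 * volume.real (coneOver D) := by
  have hm : MeasurableSet (halfScale ⁻¹' D) := continuous_halfScale.measurable hD.measurableSet
  rw [Measure.real, shapeArea, Measure.smul_apply,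
    Measure.map_apply continuous_halfScale.measurable hD.measurableSet,
    Measure.toSphere_apply' _ hm, ← coneOver_eq, Measure.real]
  simp
  ring

/-! ### The pole integral along the boundary of a region -/

/-- The integral of a form with a pole along the oriented boundary of a region. -/
theorem poleIntegral_eq {γ : ℝ → E3} {t₀ t₁ : ℝ} (ht : t₀ ≤ t₁)
    (hγ : PiecewiseC1 γ t₀ t₁) (hs : ∀ t ∈ Icc t₀ t₁, ‖γ t‖ = 1 / 2) {D : Set ShapeSphere} {ε : ℤ}
    (hD : IsOrientedBoundary γ t₀ t₁ D ε) {q : E3} (hq : ‖q‖ = 1 / 2)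
    (hqγ : ∀ t ∈ Icc t₀ t₁, γ t ≠ q) :
    (q ∈ Subtype.val '' D →
      poleIntegral γ t₀ t₁ q = ε * (2 * shapeArea.real D - 2 * Real.pi)) ∧
    (q ∉ Subtype.val '' D → poleIntegral γ t₀ t₁ q = ε * (2 * shapeArea.real D)) := by
  obtain ⟨hop, hconn, hcl, hfr, hind⟩ := hD
  have hnorm : ∀ p : ShapeSphere, ‖(p : E3)‖ = 1 / 2 := fun p => by simp
  have hDγ : ∀ p ∈ D, ∀ t ∈ Icc t₀ t₁, γ t ≠ p := by
    intro p hp t htt e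
    have : (p : E3) ∈ Subtype.val '' frontier D := by rw [hfr]; exact ⟨t, htt, e⟩
    obtain ⟨p', hp', e'⟩ := this
    rw [Subtype.ext e'] at hp'
    have hmem : p ∈ D ∩ frontier D := ⟨hp, hp'⟩
    rw [hop.inter_frontier_eq] at hmem
    exact hmem
  have hEγ : ∀ p : ShapeSphere, p ∉ closure D → ∀ t ∈ Icc t₀ t₁, γ t ≠ p := by
    intro p hp t htt e
    have : (p : E3) ∈ Subtype.val '' frontier D := by rw [hfr]; exact ⟨t, htt, e⟩
    obtain ⟨p', hp', e'⟩ := this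
    rw [Subtype.ext e'] at hp'
    exact hp (frontier_subset_closure hp')
  -- Off the trace of `γ`, which is the frontier of `D`, every point lies in `D` or outside its
  -- closure.
  have hdich : ∀ p : ShapeSphere, (p : E3) ∉ γ '' Icc t₀ t₁ → p ∉ D → p ∉ closure D := by
    intro p hp hpD hpc
    refine hp ?_
    rw [← hfr]
    exact ⟨p, ⟨hpc, by rwa [hop.interior_eq]⟩, rfl⟩
  obtain ⟨a, haD, haE⟩ : ∃ a, (∀ p ∈ D, poleIntegral γ t₀ t₁ p = a - 2 * Real.pi * ε) ∧
      ∀ p ∉ closure D, poleIntegral γ t₀ t₁ p = a := by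
    have hjump : ∀ p ∈ D, ∀ r ∉ closure D,
        poleIntegral γ t₀ t₁ r - poleIntegral γ t₀ t₁ p = 2 * Real.pi * ε := by
      intro p hp r hr
      refine poleIntegral_sub_of_hasIndex ht hγ hs (hnorm p) (hnorm r) ?_ (hDγ p hp) (hEγ r hr)
        (hind p hp r hr)
      intro e
      rw [Subtype.ext e] at hp
      exact hr (subset_closure hp)
    obtain ⟨p₀, hp₀⟩ := hconn.nonempty
    -- The constant is read off at a point of `D`, which is nonempty, whereas the exterior may be
    -- empty. This is why constancy on `D` is proved without comparison to an exterior point.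
    refine ⟨poleIntegral γ t₀ t₁ p₀ + 2 * Real.pi * ε, fun p hp => ?_, fun r hr => ?_⟩
    · have hpi : 2 * Real.pi ≠ 0 := by positivity
      have := hconn.isPreconnected.eq_of_forall_exists_int
        (f := fun p : ShapeSphere =>
          (poleIntegral γ t₀ t₁ p - poleIntegral γ t₀ t₁ p₀) / (2 * Real.pi)) ?_ ?_ hp hp₀
      · rw [sub_self, zero_div, div_eq_zero_iff] at this
        have := this.resolve_right hpi
        linarith
      · refine ContinuousOn.div_const (ContinuousOn.sub ?_ continuousOn_const) _
        intro p hp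
        exact ((continuousAt_poleIntegral ht hγ hs (hnorm p) (hDγ p hp)).comp
          continuous_subtype_val.continuousAt).continuousWithinAt
      · intro p hp
        obtain ⟨k, hk⟩ := exists_int_poleIntegral_sub ht hγ hs hcl (hnorm p₀) (hnorm p)
          (hDγ p₀ hp₀) (hDγ p hp)
        refine ⟨k, ?_⟩
        rw [hk]
        field_simp
    · linarith [hjump p₀ hp₀ r hr]
  have havg := integral_poleIntegral_radial ht hγ hs
  have hae : ∀ᵐ x ∂(volume.restrict (Metric.ball (0 : E3) 1)), poleIntegral γ t₀ t₁ (radial x)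
      = a - (coneOver D).indicator (fun _ => 2 * Real.pi * ε) x := by
    rw [ae_restrict_iff' measurableSet_ball]
    have h0 : ∀ᵐ x : E3, x ≠ 0 := by
      rw [ae_iff]; simp
    filter_upwards [ae_radial_notMem hγ hs, h0] with x h1 h2 hx
    have hr : radial x ∈ Metric.sphere (0 : E3) (1 / 2) := by simpa using norm_radial h2
    by_cases hxD : (⟨radial x, hr⟩ : ShapeSphere) ∈ D
    · have h := haD ⟨radial x, hr⟩ hxD
      rw [indicator_of_mem (show x ∈ coneOver D from ⟨hx, h2, _, hxD, rfl⟩)]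
      exact h
    · rw [indicator_of_notMem, sub_zero]
      · have h := haE ⟨radial x, hr⟩ (hdich ⟨radial x, hr⟩ (h1 h2) hxD)
        exact h
      · rintro ⟨-, -, p, hp, e⟩
        exact hxD (by rwa [← show p = ⟨radial x, hr⟩ from Subtype.ext e])
  have hsub : coneOver D ⊆ Metric.ball 0 1 := fun x hx => hx.1
  have hmeas := measurableSet_coneOver hop
  have hvol : volume.real (Metric.ball (0 : E3) 1) = Real.pi * 4 / 3 := by
    rw [Measure.real, EuclideanSpace.volume_ball_fin_three]
    simp
    positivity
  have : IsFiniteMeasure (volume.restrict (Metric.ball (0 : E3) 1)) :=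
    isFiniteMeasure_restrict.2 measure_ball_lt_top.ne
  rw [integral_congr_ae hae, integral_sub (integrable_const a) ?_, setIntegral_const,
    setIntegral_indicator hmeas, setIntegral_const, inter_eq_right.2 hsub, hvol] at havg
  · have hA := shapeArea_real hop
    simp only [smul_eq_mul] at havg
    -- The vanishing mean reads `(4π/3) a = 2πε vol(cone)`, and the area is `3/4` of that volume.
    have ha : a = ε * (2 * shapeArea.real D) := by
      rw [hA]
      have : Real.pi * (a * 4 / 3 - volume.real (coneOver D) * (2 * ε)) = 0 := by
        linear_combination havg
      have := (mul_eq_zero.1 this).resolve_left Real.pi_pos.ne'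
      linarith
    constructor
    · rintro ⟨p, hp, rfl⟩
      rw [haD p hp, ha]; ring
    · intro hqD
      have hq' : q ∈ Metric.sphere (0 : E3) (1 / 2) := by simpa using hq
      rw [← ha]
      refine haE ⟨q, hq'⟩ (hdich _ ?_ fun h => hqD ⟨_, h, rfl⟩)
      rintro ⟨t, htt, e⟩
      exact hqγ t htt e
  · refine (integrable_indicator_iff hmeas).2 ?_
    exact integrableOn_const (measure_ne_top _ _)

/-! ### The normal of a motion with vanishing angular momentum -/

/-- Here `N` stands for `ṅ`. The Binet–Cauchy identity turns the pairing of `n × N` with the angular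
momentum into `-∑ m_i (n · V_i)(N · X_i)`, which is `∑ m_i (N · X_i)²` by `h2`. -/
theorem inner_normal_deriv_eq_zero {m : Fin 3 → ℝ} (hm : IsMassDistribution m)
    {X V : Fin 3 → E3} {n N : E3} (h1 : ∀ i, inner ℝ n (X i) = 0)
    (h2 : ∀ i, inner ℝ N (X i) + inner ℝ n (V i) = 0) (hΩ : angularMomentum m X V = 0) (i : Fin 3) :
    inner ℝ N (X i) = 0 := by
  have h : ∑ i, m i * inner ℝ N (X i) ^ 2 = 0 := by
    have e : inner ℝ (cross n N) (angularMomentum m X V) = 0 := by rw [hΩ, inner_zero_right]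
    rw [angularMomentum, inner_sum] at e
    rw [← e]
    refine Finset.sum_congr rfl fun i _ => ?_
    have key : inner ℝ (cross n N) (cross (X i) (V i))
        = inner ℝ n (X i) * inner ℝ N (V i) - inner ℝ n (V i) * inner ℝ N (X i) := by
      simp only [inner_eq, cross_zero, cross_one, cross_two]; ring
    rw [inner_smul_right, key, h1]
    linear_combination m i * inner ℝ N (X i) * h2 i
  rw [Finset.sum_eq_zero_iff_of_nonneg
    (fun i _ => mul_nonneg (hm.1 i).le (sq_nonneg _))] at h
  have := (mul_eq_zero.1 (h i (Finset.mem_univ i))).resolve_left (hm.1 i).ne'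
  exact pow_eq_zero_iff two_ne_zero |>.1 this

/-- Independent `u` and `v` span the plane orthogonal to `n`, so `N` is parallel to `n` as well as
orthogonal to it. -/
theorem eq_zero_of_inner_eq_zero {u v n N : E3} (hu : inner ℝ N u = 0) (hv : inner ℝ N v = 0)
    (hn : ‖n‖ = 1) (hnN : inner ℝ n N = 0) (hnu : inner ℝ n u = 0) (hnv : inner ℝ n v = 0)
    (hc : cross u v ≠ 0) : N = 0 := by
  have cc : ∀ a : E3, inner ℝ a u = 0 → inner ℝ a v = 0 → cross a (cross u v) = 0 := by
    intro a h1 h2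
    rw [inner_eq] at h1 h2
    ext k
    fin_cases k
    · simp; linear_combination u 0 * h2 - v 0 * h1
    · simp; linear_combination u 1 * h2 - v 1 * h1
    · simp; linear_combination u 2 * h2 - v 2 * h1
  have e1 := norm_sq_cross N (cross u v)
  rw [cc N hu hv] at e1
  have h0 : inner ℝ N (cross u v) = 0 := by
    have hpar : cross u v = inner ℝ n (cross u v) • n := by
      have hz : cross (cross n (cross u v)) n = 0 := by
        rw [cc n hnu hnv]; ext k; fin_cases k <;> simp
      have hn2 : ‖n‖ ^ 2 = 1 := by rw [hn]; norm_num
      rw [norm_sq_eq] at hn2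
      generalize cross u v = c at *
      have hz' := fun k => congrArg (fun w : E3 => w k) hz
      ext k
      have := hz' k
      fin_cases k <;> simp [inner_eq] at this ⊢
      · linear_combination this - c 0 * hn2
      · linear_combination this - c 1 * hn2
      · linear_combination this - c 2 * hn2
    rw [hpar, inner_smul_right, real_inner_comm n N, hnN, mul_zero]
  rw [h0, norm_zero] at e1
  have hc' := norm_pos_iff.2 hc
  have : ‖N‖ ^ 2 = 0 := by
    have : ‖N‖ ^ 2 * ‖cross u v‖ ^ 2 = 0 := by linarith
    exact (mul_eq_zero.1 this).resolve_right (by positivity)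
  exact norm_eq_zero.1 (pow_eq_zero_iff two_ne_zero |>.1 this)

theorem normal_eq {m : Fin 3 → ℝ} (hm : IsMassDistribution m) {t₀ t₁ : ℝ}
    {X : ℝ → Fin 3 → E3} {n : ℝ → E3}
    (hM : ∀ t ∈ Icc t₀ t₁, IsOrientedTriangle m (X t) (n t))
    (hX : PiecewiseC1 X t₀ t₁) (hn : PiecewiseC1 n t₀ t₁)
    (hΩ : ∀ t ∈ Ioo t₀ t₁, angularMomentum m (X t) (deriv X t) = 0)
    (he : ∀ t ∈ Ioo t₀ t₁, IsEclipse (X t) → deriv n t = 0) : ∀ t ∈ Icc t₀ t₁, n t = n t₀ := by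
  obtain ⟨S, hS, C, hC⟩ := hX.exists_regular
  obtain ⟨S', hS', C', hC'⟩ := hn.exists_regular
  have hd : ∀ t ∈ Ioo t₀ t₁ \ (S ∪ S'), HasDerivAt n 0 t := by
    rintro t ⟨htt, hts⟩
    simp only [mem_union, not_or] at hts
    have dX := (hC t ⟨htt, hts.1⟩).1
    have dn := (hC' t ⟨htt, hts.2⟩).1
    have hI := Ioo_subset_Icc_self htt
    have hev : ∀ᶠ τ in nhds t, τ ∈ Icc t₀ t₁ := Icc_mem_nhds htt.1 htt.2
    have dn0 : inner ℝ (n t) (deriv n t) = 0 := by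
      have h1 := dn.inner ℝ dn
      have h2 : HasDerivAt (fun τ => inner ℝ (n τ) (n τ)) 0 t := by
        refine (hasDerivAt_const t (1 : ℝ)).congr_of_eventuallyEq ?_
        filter_upwards [hev] with τ hτ
        rw [real_inner_self_eq_norm_sq, (hM τ hτ).2.1]; norm_num
      have := h1.unique h2
      rw [real_inner_comm (n t)] at this
      linarith
    have dnX : ∀ i, inner ℝ (deriv n t) (X t i) + inner ℝ (n t) (deriv X t i) = 0 := by
      intro i
      have h1 := dn.inner ℝ (hasDerivAt_pi.1 dX i)
      have h2 : HasDerivAt (fun τ => inner ℝ (n τ) (X τ i)) 0 t := by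
        refine (hasDerivAt_const t (0 : ℝ)).congr_of_eventuallyEq ?_
        filter_upwards [hev] with τ hτ using (hM τ hτ).2.2 i
      have := h1.unique h2
      linarith
    have hperp := inner_normal_deriv_eq_zero hm (hM t hI).2.2 dnX (hΩ t htt)
    -- Only at a collinear configuration do the position vectors leave `ṅ` undetermined.
    have : deriv n t = 0 := by
      by_cases hE : IsEclipse (X t)
      · exact he t htt hE
      · simp only [IsEclipse, not_forall] at hE
        obtain ⟨i, j, hij⟩ := hE
        exact eq_zero_of_inner_eq_zero (hperp i) (hperp j) (hM t hI).2.1 dn0 ((hM t hI).2.2 i)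
          ((hM t hI).2.2 j) hij
    rwa [this] at dn
  intro t htt
  have key := integral_eq_of_hasDerivAt_off_countable n (fun _ => (0 : E3)) (a := t₀) (b := t)
    (hS.union hS').countable (by
      rw [uIcc_of_le htt.1]
      exact hn.continuousOn.mono (Icc_subset_Icc_right htt.2))
    (by
      rw [min_eq_left htt.1, max_eq_right htt.1]
      exact fun s hs => hd s ⟨⟨hs.1.1, hs.1.2.trans_le htt.2⟩, hs.2⟩) (by simp)
  simp only [intervalIntegral.integral_zero] at key
  exact sub_eq_zero.1 key.symm

/-! ### Plane coordinates -/

/-- The complex coordinate with respect to the frame `e₁, e₂`. -/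
def planeCoord (e₁ e₂ v : E3) : ℂ := ⟨inner ℝ v e₁, inner ℝ v e₂⟩

theorem planeCoord_smul (e₁ e₂ : E3) (r : ℝ) (v : E3) :
    planeCoord e₁ e₂ (r • v) = r * planeCoord e₁ e₂ v := by
  apply Complex.ext <;> simp [planeCoord, inner_smul_left]

theorem planeCoord_sub (e₁ e₂ u v : E3) :
    planeCoord e₁ e₂ (u - v) = planeCoord e₁ e₂ u - planeCoord e₁ e₂ v := by
  apply Complex.ext <;> simp [planeCoord, inner_sub_left]

section PlaneCoord

variable {e₁ e₂ : E3} (h₁ : ‖e₁‖ = 1) (h₂ : ‖e₂‖ = 1) (h : inner ℝ e₁ e₂ = 0)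
include h₁ h₂ h

theorem norm_sq_planeCoord {v : E3} (hv : inner ℝ (cross e₁ e₂) v = 0) :
    ‖planeCoord e₁ e₂ v‖ ^ 2 = ‖v‖ ^ 2 := by
  rw [← real_inner_self_eq_norm_sq v, inner_frame h₁ h₂ h v v, real_inner_comm (cross e₁ e₂), hv,
    Complex.sq_norm, Complex.normSq_apply]
  simp [planeCoord]

theorem norm_planeCoord {v : E3} (hv : inner ℝ (cross e₁ e₂) v = 0) :
    ‖planeCoord e₁ e₂ v‖ = ‖v‖ :=
  (pow_left_inj₀ (norm_nonneg _) (norm_nonneg _) two_ne_zero).1 (norm_sq_planeCoord h₁ h₂ h hv)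

theorem re_conj_planeCoord {u v : E3} (hu : inner ℝ (cross e₁ e₂) u = 0) :
    ((starRingEnd ℂ) (planeCoord e₁ e₂ u) * planeCoord e₁ e₂ v).re = inner ℝ u v := by
  rw [inner_frame h₁ h₂ h u v, real_inner_comm (cross e₁ e₂) u, hu]
  simp [planeCoord]

theorem im_conj_planeCoord (u v : E3) :
    ((starRingEnd ℂ) (planeCoord e₁ e₂ u) * planeCoord e₁ e₂ v).im
      = inner ℝ (cross e₁ e₂) (cross u v) := by
  have o1 : inner ℝ (cross e₁ e₂) e₁ = 0 := by
    simp only [inner_eq, cross_zero, cross_one, cross_two]; ring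
  have o2 : inner ℝ (cross e₁ e₂) e₂ = 0 := by
    simp only [inner_eq, cross_zero, cross_one, cross_two]; ring
  have o3 : inner ℝ (cross e₁ e₂) (cross e₁ e₂) = 1 := by
    obtain ⟨b, -, -, b2⟩ := exists_orthonormalBasis_cross h₁ h₂ h
    rw [← b2, real_inner_self_eq_norm_sq]; simp
  rw [triple_frame h₁ h₂ h, o1, o2, o3]
  simp [planeCoord]
  ring

theorem eq_of_planeCoord_eq {u v : E3} (hu : inner ℝ (cross e₁ e₂) u = 0)
    (hv : inner ℝ (cross e₁ e₂) v = 0) (e : planeCoord e₁ e₂ u = planeCoord e₁ e₂ v) : u = v := by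
  rw [eq_frame h₁ h₂ h u, eq_frame h₁ h₂ h v, real_inner_comm (cross e₁ e₂), hu,
    real_inner_comm (cross e₁ e₂), hv]
  have er := congrArg Complex.re e
  have ei := congrArg Complex.im e
  simp only [planeCoord] at er ei
  rw [er, ei]

/-- Rotation about `e₁ × e₂` is multiplication by `exp (iφ)`: the axis acts by `e₁ ↦ e₂ ↦ -e₁`. -/
theorem rot_eq_iff {u v : E3} (hu : inner ℝ (cross e₁ e₂) u = 0)
    (hv : inner ℝ (cross e₁ e₂) v = 0) (r φ : ℝ) :
    u = r • rot (cross e₁ e₂) φ v ↔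
      planeCoord e₁ e₂ u = r * Complex.exp (φ * Complex.I) * planeCoord e₁ e₂ v := by
  have hrot : rot (cross e₁ e₂) φ v = Real.cos φ • v + Real.sin φ • cross (cross e₁ e₂) v := by
    simp [rot, hv]
  have hn : inner ℝ (cross e₁ e₂) (cross (cross e₁ e₂) v) = 0 := by
    simp only [inner_eq, cross_zero, cross_one, cross_two]; ring
  have hperp : inner ℝ (cross e₁ e₂) (r • rot (cross e₁ e₂) φ v) = 0 := by
    rw [hrot, inner_smul_right, inner_add_right, inner_smul_right, inner_smul_right, hv, hn]
    ring
  have n1 : ‖e₁‖ ^ 2 = 1 := by rw [h₁]; norm_num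
  have n2 : ‖e₂‖ ^ 2 = 1 := by rw [h₂]; norm_num
  have c1 : inner ℝ (cross (cross e₁ e₂) v) e₁ = -inner ℝ v e₂ := by
    have : inner ℝ (cross (cross e₁ e₂) v) e₁
        = inner ℝ e₁ e₂ * inner ℝ v e₁ - ‖e₁‖ ^ 2 * inner ℝ v e₂ := by
      simp only [norm_sq_eq, inner_eq, cross_zero, cross_one, cross_two]; ring
    rw [this, h, n1]; ring
  have c2 : inner ℝ (cross (cross e₁ e₂) v) e₂ = inner ℝ v e₁ := by
    have : inner ℝ (cross (cross e₁ e₂) v) e₂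
        = ‖e₂‖ ^ 2 * inner ℝ v e₁ - inner ℝ e₁ e₂ * inner ℝ v e₂ := by
      simp only [norm_sq_eq, inner_eq, cross_zero, cross_one, cross_two]; ring
    rw [this, h, n2]; ring
  have key : planeCoord e₁ e₂ (r • rot (cross e₁ e₂) φ v)
      = r * Complex.exp (φ * Complex.I) * planeCoord e₁ e₂ v := by
    rw [planeCoord_smul, mul_assoc, Complex.exp_mul_I, ← Complex.ofReal_cos, ← Complex.ofReal_sin]
    congr 1
    apply Complex.ext
    · simp [planeCoord, hrot, inner_add_left, inner_smul_left, c1]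
      rw [Complex.cos_ofReal_re, Complex.sin_ofReal_re]; ring
    · simp [planeCoord, hrot, inner_add_left, inner_smul_left, c2]
      rw [Complex.cos_ofReal_re, Complex.sin_ofReal_re]
  rw [← key]
  exact ⟨fun e => congrArg _ e, eq_of_planeCoord_eq h₁ h₂ h hu hperp⟩

end PlaneCoord

/-! ### The Hopf map -/

/-- The Hopf map onto `S²(1/2)`, homogeneous of degree `0`. -/
def hopf (z₁ z₂ : ℂ) : E3 := (2 * (‖z₁‖ ^ 2 + ‖z₂‖ ^ 2))⁻¹ •
  !₂[‖z₁‖ ^ 2 - ‖z₂‖ ^ 2, 2 * ((starRingEnd ℂ) z₁ * z₂).re, 2 * ((starRingEnd ℂ) z₂ * z₁).im]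

/-- The Hermitian product of `ℂ²`. -/
def herm (d₁ d₂ z₁ z₂ : ℂ) : ℂ := (starRingEnd ℂ) d₁ * z₁ + (starRingEnd ℂ) d₂ * z₂

/-- If `θ` is the angle between the Hopf images, then `|⟨d, z⟩|² = |d|² |z|² cos² (θ/2)`. In
particular the coordinate vanishes exactly over the antipode of `hopf d₁ d₂`. -/
theorem norm_sq_herm {d₁ d₂ z₁ z₂ : ℂ} (hd : ‖d₁‖ ^ 2 + ‖d₂‖ ^ 2 ≠ 0)
    (hz : ‖z₁‖ ^ 2 + ‖z₂‖ ^ 2 ≠ 0) :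
    ‖herm d₁ d₂ z₁ z₂‖ ^ 2 = (‖d₁‖ ^ 2 + ‖d₂‖ ^ 2) * (‖z₁‖ ^ 2 + ‖z₂‖ ^ 2)
      * (1 + 4 * inner ℝ (hopf d₁ d₂) (hopf z₁ z₂)) / 2 := by
  have e : inner ℝ (hopf d₁ d₂) (hopf z₁ z₂) = (4 * (‖d₁‖ ^ 2 + ‖d₂‖ ^ 2) *
      (‖z₁‖ ^ 2 + ‖z₂‖ ^ 2))⁻¹ * ((‖d₁‖ ^ 2 - ‖d₂‖ ^ 2) * (‖z₁‖ ^ 2 - ‖z₂‖ ^ 2)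
      + 4 * (((starRingEnd ℂ) d₁ * d₂).re * ((starRingEnd ℂ) z₁ * z₂).re)
      + 4 * (((starRingEnd ℂ) d₂ * d₁).im * ((starRingEnd ℂ) z₂ * z₁).im)) := by
    rw [hopf, hopf, inner_smul_left, inner_smul_right, inner_eq]
    simp
    field_simp
    ring
  rw [e]
  field_simp
  simp only [Complex.sq_norm, Complex.normSq_apply, herm]
  simp
  ring

/-- The real form of the identity behind `angularSpeed_herm`: `z = x + iy` has velocity `a + ib`, `d
= p + iq`, `N = |z|²` has derivative `N'`, and `g` is the Hopf point with velocity `v`. -/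
theorem hopf_pole_aux {x₁ y₁ x₂ y₂ a₁ b₁ a₂ b₂ p₁ q₁ p₂ q₂ N M g₀ g₁ g₂ v₀ v₁ v₂ : ℝ}
    (hN : N = x₁ ^ 2 + y₁ ^ 2 + (x₂ ^ 2 + y₂ ^ 2)) (hN0 : N ≠ 0)
    (hM0 : M ≠ 0)
    (hor : x₁ * b₁ - y₁ * a₁ + (x₂ * b₂ - y₂ * a₂) = 0)
    (hg₀ : 2 * N * g₀ = x₁ ^ 2 + y₁ ^ 2 - (x₂ ^ 2 + y₂ ^ 2))
    (hg₁ : 2 * N * g₁ = 2 * (x₁ * x₂ + y₁ * y₂))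
    (hg₂ : 2 * N * g₂ = 2 * (x₂ * y₁ - y₂ * x₁))
    {N' : ℝ}
    (hv₀ : 2 * N' * g₀ + 2 * N * v₀ = 2 * (x₁ * a₁ + y₁ * b₁) - 2 * (x₂ * a₂ + y₂ * b₂))
    (hv₁ : 2 * N' * g₁ + 2 * N * v₁ = 2 * (a₁ * x₂ + x₁ * a₂ + (b₁ * y₂ + y₁ * b₂)))
    (hv₂ : 2 * N' * g₂ + 2 * N * v₂ = 2 * (a₂ * y₁ + x₂ * b₁ - (b₂ * x₁ + y₂ * a₁))) :
    2 * M * N * (2 * M)⁻¹ * ((p₁ ^ 2 + q₁ ^ 2 - (p₂ ^ 2 + q₂ ^ 2)) * (g₁ * v₂ - g₂ * v₁)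
      + 2 * (p₁ * p₂ + q₁ * q₂) * (g₂ * v₀ - g₀ * v₂)
      + 2 * (p₂ * q₁ - q₂ * p₁) * (g₀ * v₁ - g₁ * v₀))
    = (p₁ * x₁ + q₁ * y₁ + (p₂ * x₂ + q₂ * y₂)) * (p₁ * b₁ - q₁ * a₁ + (p₂ * b₂ - q₂ * a₂))
      - (p₁ * y₁ - q₁ * x₁ + (p₂ * y₂ - q₂ * x₂)) * (p₁ * a₁ + q₁ * b₁ + (p₂ * a₂ + q₂ * b₂)) := by
  set H₀ := x₁ ^ 2 + y₁ ^ 2 - (x₂ ^ 2 + y₂ ^ 2) with h0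
  set H₁ := 2 * (x₁ * x₂ + y₁ * y₂) with h1
  set H₂ := 2 * (x₂ * y₁ - y₂ * x₁) with h2
  set K₀ := 2 * (x₁ * a₁ + y₁ * b₁) - 2 * (x₂ * a₂ + y₂ * b₂) with k0
  set K₁ := 2 * (a₁ * x₂ + x₁ * a₂ + (b₁ * y₂ + y₁ * b₂)) with k1
  set K₂ := 2 * (a₂ * y₁ + x₂ * b₁ - (b₂ * x₁ + y₂ * a₁)) with k2
  -- The vectors `H = 2N g` and `K = Ḣ` are quadratic in `z` and its velocity. In `H × K = 4N² g ×
  -- v` the term with `N'` drops out.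
  have c0 : 4 * N ^ 2 * (g₁ * v₂ - g₂ * v₁) = H₁ * K₂ - H₂ * K₁ := by
    rw [← hg₁, ← hg₂, ← hv₁, ← hv₂]; ring
  have c1 : 4 * N ^ 2 * (g₂ * v₀ - g₀ * v₂) = H₂ * K₀ - H₀ * K₂ := by
    rw [← hg₀, ← hg₂, ← hv₀, ← hv₂]; ring
  have c2 : 4 * N ^ 2 * (g₀ * v₁ - g₁ * v₀) = H₀ * K₁ - H₁ * K₀ := by
    rw [← hg₀, ← hg₁, ← hv₀, ← hv₁]; ring
  have e : 2 * M * N * (2 * M)⁻¹ = N := by field_simp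
  rw [e]
  have hN4 : 4 * N ≠ 0 := by positivity
  apply mul_left_cancel₀ hN4
  have key : (p₁ ^ 2 + q₁ ^ 2 - (p₂ ^ 2 + q₂ ^ 2)) * (H₁ * K₂ - H₂ * K₁)
      + 2 * (p₁ * p₂ + q₁ * q₂) * (H₂ * K₀ - H₀ * K₂)
      + 2 * (p₂ * q₁ - q₂ * p₁) * (H₀ * K₁ - H₁ * K₀) = 4 * N *
      ((p₁ * x₁ + q₁ * y₁ + (p₂ * x₂ + q₂ * y₂)) * (p₁ * b₁ - q₁ * a₁ + (p₂ * b₂ - q₂ * a₂))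
      - (p₁ * y₁ - q₁ * x₁ + (p₂ * y₂ - q₂ * x₂)) * (p₁ * a₁ + q₁ * b₁ + (p₂ * a₂ + q₂ * b₂))) := by
    rw [hN, h0, h1, h2, k0, k1, k2]
    -- Horizontality is used here, with factor `-4 |⟨d, z⟩|²`.
    linear_combination (-4 * ((p₁ * x₁ + q₁ * y₁ + (p₂ * x₂ + q₂ * y₂)) ^ 2
      + (p₁ * y₁ - q₁ * x₁ + (p₂ * y₂ - q₂ * x₂)) ^ 2)) * hor
  linear_combination key + (p₁ ^ 2 + q₁ ^ 2 - (p₂ ^ 2 + q₂ ^ 2)) * c0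
    + 2 * (p₁ * p₂ + q₁ * q₂) * c1 + 2 * (p₂ * q₁ - q₂ * p₁) * c2

/-- Along a horizontal curve of `ℂ²` the angular speed of a linear coordinate is given by the form
on the Hopf sphere with pole at the zero of the coordinate. -/
theorem angularSpeed_herm {z₁ z₂ : ℝ → ℂ} {w₁ w₂ : ℂ} {γ : ℝ → E3} {v : E3} {t : ℝ}
    (hz₁ : HasDerivAt z₁ w₁ t) (hz₂ : HasDerivAt z₂ w₂ t) (hγ : HasDerivAt γ v t)
    (he : ∀ᶠ τ in nhds t, ‖z₁ τ‖ ^ 2 + ‖z₂ τ‖ ^ 2 ≠ 0 ∧ γ τ = hopf (z₁ τ) (z₂ τ))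
    (hor : ((starRingEnd ℂ) (z₁ t) * w₁ + (starRingEnd ℂ) (z₂ t) * w₂).im = 0)
    {d₁ d₂ : ℂ} (hd : ‖d₁‖ ^ 2 + ‖d₂‖ ^ 2 ≠ 0) (hw : herm d₁ d₂ (z₁ t) (z₂ t) ≠ 0) :
    angularSpeed (fun τ => herm d₁ d₂ (z₁ τ) (z₂ τ)) t = poleForm (hopf d₁ d₂) (γ t) v := by
  obtain ⟨hN0, hγt⟩ := he.self_of_nhds
  have hder : deriv (fun τ => herm d₁ d₂ (z₁ τ) (z₂ τ)) t = herm d₁ d₂ w₁ w₂ :=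
    ((hz₁.const_mul _).add (hz₂.const_mul _)).deriv
  have hn := norm_sq_herm hd hN0
  have hp : 0 < ‖herm d₁ d₂ (z₁ t) (z₂ t)‖ ^ 2 := by
    have := norm_pos_iff.2 hw
    positivity
  have hre : ∀ {z : ℝ → ℂ} {w : ℂ}, HasDerivAt z w t → HasDerivAt (fun τ => (z τ).re) w.re t :=
    fun h => Complex.reCLM.hasFDerivAt.comp_hasDerivAt t h
  have him : ∀ {z : ℝ → ℂ} {w : ℂ}, HasDerivAt z w t → HasDerivAt (fun τ => (z τ).im) w.im t :=
    fun h => Complex.imCLM.hasFDerivAt.comp_hasDerivAt t h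
  have hγk : ∀ k, HasDerivAt (fun τ => γ τ k) (v k) t := fun k =>
    (EuclideanSpace.proj (𝕜 := ℝ) k).hasFDerivAt.comp_hasDerivAt t hγ
  have x1 := hre hz₁
  have y1 := him hz₁
  have x2 := hre hz₂
  have y2 := him hz₂
  have dN := ((x1.mul x1).add (y1.mul y1)).add ((x2.mul x2).add (y2.mul y2))
  -- Clearing the denominator makes the Hopf map quadratic, so that its velocity follows from the
  -- product rule alone.
  have hcoord : ∀ {a b : ℂ}, ‖a‖ ^ 2 + ‖b‖ ^ 2 ≠ 0 →
      2 * (a.re * a.re + a.im * a.im + (b.re * b.re + b.im * b.im)) * hopf a b 0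
        = a.re * a.re + a.im * a.im - (b.re * b.re + b.im * b.im) ∧
      2 * (a.re * a.re + a.im * a.im + (b.re * b.re + b.im * b.im)) * hopf a b 1
        = 2 * (a.re * b.re + a.im * b.im) ∧
      2 * (a.re * a.re + a.im * a.im + (b.re * b.re + b.im * b.im)) * hopf a b 2
        = 2 * (b.re * a.im - b.im * a.re) := by
    intro a b hab
    have key : ∀ k, 2 * (a.re * a.re + a.im * a.im + (b.re * b.re + b.im * b.im)) * hopf a b k
        = (!₂[‖a‖ ^ 2 - ‖b‖ ^ 2, 2 * ((starRingEnd ℂ) a * b).re,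
          2 * ((starRingEnd ℂ) b * a).im] : E3) k := by
      intro k
      have e : a.re * a.re + a.im * a.im + (b.re * b.re + b.im * b.im) = ‖a‖ ^ 2 + ‖b‖ ^ 2 := by
        simp only [Complex.sq_norm, Complex.normSq_apply]
      rw [e, hopf, PiLp.smul_apply, smul_eq_mul, ← mul_assoc,
        mul_inv_cancel₀ (mul_ne_zero two_ne_zero hab), one_mul]
    refine ⟨(key 0).trans ?_, (key 1).trans ?_, (key 2).trans ?_⟩
    · simp [Complex.sq_norm, Complex.normSq_apply]
    · simp
    · simp; ring
  have hv : ∀ {f : ℝ → ℝ} {f' : ℝ} {k : Fin 3}, HasDerivAt f f' t →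
      (∀ τ, ‖z₁ τ‖ ^ 2 + ‖z₂ τ‖ ^ 2 ≠ 0 → 2 * ((z₁ τ).re * (z₁ τ).re + (z₁ τ).im * (z₁ τ).im +
        ((z₂ τ).re * (z₂ τ).re + (z₂ τ).im * (z₂ τ).im)) * hopf (z₁ τ) (z₂ τ) k = f τ) →
      2 * (w₁.re * (z₁ t).re + (z₁ t).re * w₁.re + (w₁.im * (z₁ t).im + (z₁ t).im * w₁.im)
        + (w₂.re * (z₂ t).re + (z₂ t).re * w₂.re + (w₂.im * (z₂ t).im + (z₂ t).im * w₂.im)))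
        * γ t k + 2 * ((z₁ t).re * (z₁ t).re + (z₁ t).im * (z₁ t).im +
        ((z₂ t).re * (z₂ t).re + (z₂ t).im * (z₂ t).im)) * v k = f' := by
    intro f f' k hf hfe
    have h1 := (dN.const_mul 2).mul (hγk k)
    refine h1.unique (hf.congr_of_eventuallyEq ?_)
    filter_upwards [he] with τ hτ
    rw [← hfe τ hτ.1, ← hτ.2]
    rfl
  have hv0 := hv (k := 0) (((x1.mul x1).add (y1.mul y1)).sub ((x2.mul x2).add (y2.mul y2)))
    (fun τ hτ => (hcoord hτ).1)
  have hv1 := hv (k := 1) (((x1.mul x2).add (y1.mul y2)).const_mul 2)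
    (fun τ hτ => (hcoord hτ).2.1)
  have hv2 := hv (k := 2) (((x2.mul y1).sub (y2.mul x1)).const_mul 2)
    (fun τ hτ => (hcoord hτ).2.2)
  have hg := hcoord hN0
  rw [← hγt] at hg hn
  have hN : ‖z₁ t‖ ^ 2 + ‖z₂ t‖ ^ 2
      = (z₁ t).re ^ 2 + (z₁ t).im ^ 2 + ((z₂ t).re ^ 2 + (z₂ t).im ^ 2) := by
    simp only [Complex.sq_norm, Complex.normSq_apply]; ring
  have aux := hopf_pole_aux (x₁ := (z₁ t).re) (y₁ := (z₁ t).im) (x₂ := (z₂ t).re)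
    (y₂ := (z₂ t).im) (a₁ := w₁.re) (b₁ := w₁.im) (a₂ := w₂.re) (b₂ := w₂.im) (p₁ := d₁.re)
    (q₁ := d₁.im) (p₂ := d₂.re) (q₂ := d₂.im) (g₀ := γ t 0) (g₁ := γ t 1) (g₂ := γ t 2)
    (v₀ := v 0) (v₁ := v 1) (v₂ := v 2)
    (N' := w₁.re * (z₁ t).re + (z₁ t).re * w₁.re + (w₁.im * (z₁ t).im + (z₁ t).im * w₁.im)
      + (w₂.re * (z₂ t).re + (z₂ t).re * w₂.re + (w₂.im * (z₂ t).im + (z₂ t).im * w₂.im))) hN hN0 hd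
    (by simp at hor; linear_combination hor)
    (by rw [hN]; linear_combination hg.1) (by rw [hN]; linear_combination hg.2.1)
    (by rw [hN]; linear_combination hg.2.2)
    (by rw [hN]; linear_combination hv0) (by rw [hN]; linear_combination hv1)
    (by rw [hN]; linear_combination hv2)
  have hb : inner ℝ (hopf d₁ d₂) (cross (γ t) v) = (2 * (‖d₁‖ ^ 2 + ‖d₂‖ ^ 2))⁻¹ *
      ((d₁.re ^ 2 + d₁.im ^ 2 - (d₂.re ^ 2 + d₂.im ^ 2)) * (γ t 1 * v 2 - γ t 2 * v 1)
      + 2 * (d₁.re * d₂.re + d₁.im * d₂.im) * (γ t 2 * v 0 - γ t 0 * v 2)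
      + 2 * (d₂.re * d₁.im - d₂.im * d₁.re) * (γ t 0 * v 1 - γ t 1 * v 0)) := by
    rw [hopf, inner_smul_left, inner_eq]
    simp [Complex.sq_norm, Complex.normSq_apply]
    left
    ring
  -- Dividing this by the squared modulus from `norm_sq_herm` cancels `|d|² |z|²` and leaves the
  -- pole form.
  have him' : ((starRingEnd ℂ) (herm d₁ d₂ (z₁ t) (z₂ t)) * herm d₁ d₂ w₁ w₂).im
      = 2 * (‖d₁‖ ^ 2 + ‖d₂‖ ^ 2) * (‖z₁ t‖ ^ 2 + ‖z₂ t‖ ^ 2)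
        * inner ℝ (hopf d₁ d₂) (cross (γ t) v) := by
    rw [hb, ← mul_assoc, aux]
    simp [herm]
    ring
  rw [angularSpeed, hder, him', hn, poleForm]
  rw [hn] at hp
  have hpos : 1 + 4 * inner ℝ (hopf d₁ d₂) (γ t) ≠ 0 := by
    intro h0
    rw [h0] at hp
    simp at hp
  field_simp
  ring

/-- The case `d = z` of `norm_sq_herm`, where the left side is `|z|⁴`. -/
theorem norm_hopf {z₁ z₂ : ℂ} (hz : ‖z₁‖ ^ 2 + ‖z₂‖ ^ 2 ≠ 0) : ‖hopf z₁ z₂‖ = 1 / 2 := by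
  have h := norm_sq_herm hz hz
  have e : herm z₁ z₂ z₁ z₂ = ((‖z₁‖ ^ 2 + ‖z₂‖ ^ 2 : ℝ) : ℂ) := by
    rw [herm, Complex.conj_mul', Complex.conj_mul']; push_cast; rfl
  rw [e, Complex.norm_real, Real.norm_eq_abs, sq_abs, real_inner_self_eq_norm_sq] at h
  have h2 : ‖hopf z₁ z₂‖ ^ 2 = (1 / 2) ^ 2 := by
    field_simp at h
    linarith
  exact (pow_left_inj₀ (norm_nonneg _) (by norm_num) two_ne_zero).1 h2

theorem exists_hopf_eq {b : E3} (hb : ‖b‖ = 1 / 2) :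
    ∃ d₁ d₂ : ℂ, ‖d₁‖ ^ 2 + ‖d₂‖ ^ 2 ≠ 0 ∧ hopf d₁ d₂ = b := by
  have h : b 0 ^ 2 + b 1 ^ 2 + b 2 ^ 2 = 1 / 4 := by rw [← norm_sq_eq, hb]; norm_num
  by_cases h0 : b 0 = -1 / 2
  · refine ⟨0, 1, by simp, ?_⟩
    rw [h0] at h
    have h1 : b 1 = 0 := by nlinarith [sq_nonneg (b 1), sq_nonneg (b 2)]
    have h2 : b 2 = 0 := by nlinarith [sq_nonneg (b 1), sq_nonneg (b 2)]
    ext k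
    fin_cases k <;> simp [hopf, h0, h1, h2]
    norm_num
  -- A section of the Hopf map with real first coordinate, of squared length `1/2 + b 0`. It breaks
  -- down only at the point treated above, covered by `(0, 1)`.
  · have hx : 1 / 2 + b 0 ≠ 0 := fun e => h0 (by linarith)
    have hN : ‖(⟨1 / 2 + b 0, 0⟩ : ℂ)‖ ^ 2 + ‖(⟨b 1, -b 2⟩ : ℂ)‖ ^ 2 = 1 / 2 + b 0 := by
      simp only [Complex.sq_norm, Complex.normSq_apply]
      linear_combination h
    refine ⟨⟨1 / 2 + b 0, 0⟩, ⟨b 1, -b 2⟩, by rwa [hN], ?_⟩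
    rw [hopf, hN]
    ext k
    fin_cases k
    · simp only [Complex.sq_norm, Complex.normSq_apply]
      simp
      have h1 : 1 + 2 * b 0 ≠ 0 := fun e => h0 (by linarith)
      have h2 : 2⁻¹ + b 0 = (1 + 2 * b 0) / 2 := by ring
      rw [h2]
      field_simp
      linear_combination -4 * h
    · simp
      have h1 : 1 + 2 * b 0 ≠ 0 := fun e => h0 (by linarith)
      have h2 : 2⁻¹ + b 0 = (1 + 2 * b 0) / 2 := by ring
      rw [h2]
      field_simp
    · simp
      have h1 : 1 + 2 * b 0 ≠ 0 := fun e => h0 (by linarith)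
      have h2 : 2⁻¹ + b 0 = (1 + 2 * b 0) / 2 := by ring
      rw [h2]
      field_simp

/-- Vectors of `ℂ²` over the same point of the Hopf sphere are proportional. -/
theorem exists_smul_of_hopf_eq {z₁ z₂ u₁ u₂ : ℂ} (hz : ‖z₁‖ ^ 2 + ‖z₂‖ ^ 2 ≠ 0)
    (hu : ‖u₁‖ ^ 2 + ‖u₂‖ ^ 2 ≠ 0) (h : hopf z₁ z₂ = hopf u₁ u₂) :
    ∃ c : ℂ, u₁ = c * z₁ ∧ u₂ = c * z₂ := by
  -- The Hermitian product of `(-conj z₂, conj z₁)` with `u` is `z₁ u₂ - z₂ u₁`. Its Hopf image is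
  -- the antipode of `hopf z₁ z₂`, so `norm_sq_herm` makes this determinant vanish.
  have hd : ‖-(starRingEnd ℂ) z₂‖ ^ 2 + ‖(starRingEnd ℂ) z₁‖ ^ 2 ≠ 0 := by
    simpa [add_comm] using hz
  have hneg : hopf (-(starRingEnd ℂ) z₂) ((starRingEnd ℂ) z₁) = -hopf z₁ z₂ := by
    ext k
    fin_cases k <;> simp [hopf] <;> rw [add_comm (‖z₂‖ ^ 2)] <;> ring
  have e := norm_sq_herm hd hu
  rw [hneg, ← h, inner_neg_left, real_inner_self_eq_norm_sq, norm_hopf hz] at e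
  have e0 : herm (-(starRingEnd ℂ) z₂) ((starRingEnd ℂ) z₁) u₁ u₂ = 0 := by
    have : ‖herm (-(starRingEnd ℂ) z₂) ((starRingEnd ℂ) z₁) u₁ u₂‖ ^ 2 = 0 := by
      rw [e]; norm_num
    exact norm_eq_zero.1 (pow_eq_zero_iff two_ne_zero |>.1 this)
  simp [herm] at e0
  by_cases h1 : z₁ = 0
  · have h2 : z₂ ≠ 0 := by
      rintro rfl
      simp [h1] at hz
    refine ⟨u₂ / z₂, ?_, by field_simp⟩
    rw [h1] at e0 ⊢
    simpa [h2] using e0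
  · refine ⟨u₁ / z₁, by field_simp, ?_⟩
    field_simp
    linear_combination e0

/-! ### The exterior derivative of the kinematic form -/

/-- With `u` and `v` extended as constant fields, the left side is the exterior derivative. Put `k =
s · (u × v)` and `σ = b · s`: after the quotient rule the numerator is `4k (1 + 4σ)²`, which cancels
the denominator. -/
theorem poleForm_fderiv {b s : E3} (hb : ‖b‖ = 1 / 2) (hs : ‖s‖ = 1 / 2) (hne : s ≠ -b)
    {u v : E3} (hu : inner ℝ s u = 0) (hv : inner ℝ s v = 0) :
    fderiv ℝ (fun p => poleForm b p v) s u - fderiv ℝ (fun p => poleForm b p u) s v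
      = 2 * areaForm s u v := by
  have hpos := one_add_four_inner_pos hb hs hne
  have hd : ∀ u v : E3, fderiv ℝ (fun p => poleForm b p v) s u =
      (4 * inner ℝ b (cross u v) * (1 + 4 * inner ℝ b s)
        - 4 * inner ℝ b (cross s v) * (4 * inner ℝ b u)) / (1 + 4 * inner ℝ b s) ^ 2 := by
    intro u v
    have e : ∀ p, poleForm b p v = 4 * inner ℝ (cross v b) p / (1 + 4 * inner ℝ b p) := by
      intro p
      rw [poleForm]
      congr 2
      simp only [inner_eq, cross_zero, cross_one, cross_two]; ring
    have e' : ∀ p, inner ℝ b (cross p v) = inner ℝ (cross v b) p := by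
      intro p
      simp only [inner_eq, cross_zero, cross_one, cross_two]; ring
    have hdiff : DifferentiableAt ℝ (fun p => poleForm b p v) s := by
      rw [funext e]
      have d : ∀ w : E3, DifferentiableAt ℝ (fun p : E3 => 4 * inner ℝ w p) s := fun w =>
        ((differentiableAt_const w).inner ℝ differentiableAt_id).const_mul 4
      simp only [div_eq_mul_inv]
      exact (d (cross v b)).mul (((d b).const_add 1).inv hpos.ne')
    rw [← hdiff.lineDeriv_eq_fderiv, lineDeriv]
    simp only [e, inner_add_right, inner_smul_right]
    have h1 : ∀ c d : ℝ, HasDerivAt (fun t : ℝ => 4 * (c + t * d)) (4 * d) 0 := fun c d => by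
      simpa using (((hasDerivAt_id (0 : ℝ)).mul_const d).const_add c).const_mul 4
    have h2 := (h1 (inner ℝ (cross v b) s) (inner ℝ (cross v b) u)).div
      ((h1 (inner ℝ b s) (inner ℝ b u)).const_add 1) (by simpa using hpos.ne')
    refine h2.deriv.trans ?_
    rw [e' u, e' s]
    simp
  -- The product of two tangent vectors is normal; the factor `4` is `|s|⁻²`.
  have hk : cross u v = (4 * inner ℝ s (cross u v)) • s := by
    have hs2 : s 0 ^ 2 + s 1 ^ 2 + s 2 ^ 2 = 1 / 4 := by rw [← norm_sq_eq, hs]; norm_num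
    rw [inner_eq] at hu hv
    ext k
    fin_cases k <;> simp [inner_eq]
    · linear_combination (-4 * (u 1 * v 2 - u 2 * v 1)) * hs2
        + 4 * (s 1 * v 2 - s 2 * v 1) * hu - 4 * (s 1 * u 2 - s 2 * u 1) * hv
    · linear_combination (-4 * (u 2 * v 0 - u 0 * v 2)) * hs2
        + 4 * (s 2 * v 0 - s 0 * v 2) * hu - 4 * (s 2 * u 0 - s 0 * u 2) * hv
    · linear_combination (-4 * (u 0 * v 1 - u 1 * v 0)) * hs2
        + 4 * (s 0 * v 1 - s 1 * v 0) * hu - 4 * (s 0 * u 1 - s 1 * u 0) * hv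
  have hvu : inner ℝ b (cross v u) = -inner ℝ b (cross u v) := by
    simp only [inner_eq, cross_zero, cross_one, cross_two]; ring
  have hbuv : inner ℝ b (cross u v) = 4 * inner ℝ s (cross u v) * inner ℝ b s := by
    conv_lhs => rw [hk]
    rw [inner_smul_right]
  have hcross : inner ℝ b (cross s v) * inner ℝ b u - inner ℝ b (cross s u) * inner ℝ b v
      = -(4 * inner ℝ s (cross u v) * (1 / 16 - inner ℝ b s ^ 2)) := by
    have e1 : inner ℝ b (cross s v) * inner ℝ b u - inner ℝ b (cross s u) * inner ℝ b v
        = -inner ℝ (cross b s) (cross b (cross u v)) := by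
      simp only [inner_eq, cross_zero, cross_one, cross_two]; ring
    have e2 : ∀ c : ℝ, inner ℝ (cross b s) (cross b (c • s)) = c * ‖cross b s‖ ^ 2 := by
      intro c
      simp only [norm_sq_eq, inner_eq, cross_zero, cross_one, cross_two, PiLp.smul_apply,
        smul_eq_mul]
      ring
    rw [e1, hk, e2, ← hk, norm_sq_cross, hb, hs]
    norm_num
  rw [hd, hd, hvu, hbuv, areaForm, inner_smul_left, div_sub_div_same, div_eq_iff (by positivity)]
  simp only [conj_trivial]
  linear_combination -16 * hcross

/-! ### The kinematic angular velocity -/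

/-- Expanding the central angle rates gives `I ω_i⁰ = I ω_i - ∑ I_j ω_j`, and the last sum is the
normal component of the angular momentum. -/
theorem omegaZero_eq {m : Fin 3 → ℝ} (hm : IsMassDistribution m) {X V : Fin 3 → E3} (n : E3)
    (hX : X ≠ 0) (hΩ : angularMomentum m X V = 0) (i : Fin 3) :
    omegaZero m X V n i = angularVelocity X V n i := by
  have hI := totalInertia_pos hm hX
  have hω : ∀ j, inertia m X j * angularVelocity X V n j = m j * inner ℝ n (cross (X j) (V j)) := by
    intro j
    rw [inertia, angularVelocity]
    -- At a vanishing vertex vector `ω_j` is `0` by convention and both sides vanish.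
    by_cases h : X j = 0
    · have : cross (X j) (V j) = 0 := by rw [h]; ext k; fin_cases k <;> simp
      rw [this]; simp
    · have := norm_pos_iff.2 h
      field_simp
  have hs : ∑ j, inertia m X j * angularVelocity X V n j = 0 := by
    have : inner ℝ n (angularMomentum m X V) = 0 := by rw [hΩ, inner_zero_right]
    rw [angularMomentum, inner_sum] at this
    simpa only [hω, inner_smul_right] using this
  have hI' : totalInertia m X = inertia m X 0 + inertia m X 1 + inertia m X 2 := by
    rw [totalInertia, Fin.sum_univ_three]
  rw [Fin.sum_univ_three] at hs
  rw [omegaZero, div_eq_iff hI.ne', hI']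
  fin_cases i <;> simp [centralAngleRate] <;> linear_combination -hs

/-! ### Jacobi coordinates -/

/-- Passage to Jacobi vectors preserves the bilinear form weighted by the masses. This carries both
angular momentum and linear coordinates over to `ℂ²`. -/
theorem jacobi_bilinear {m : Fin 3 → ℝ} (hm : IsMassDistribution m) {x y : Fin 3 → ℝ}
    (hx : ∑ j, m j * x j = 0) (hy : ∑ j, m j * y j = 0) :
    m 0 / (1 - m 0) * (x 0 * y 0) + m 1 * m 2 / (1 - m 0) * ((x 2 - x 1) * (y 2 - y 1))
      = ∑ j, m j * (x j * y j) := by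
  have h0 := (hm.pos 0).2.ne'
  have hs := hm.2
  rw [Fin.sum_univ_three] at hx hy hs ⊢
  field_simp
  have e : 1 - m 0 = m 1 + m 2 := by linarith
  rw [e]
  linear_combination (m 0 * y 0) * hx - (m 1 * x 1 + m 2 * x 2) * hy - m 0 * x 0 * y 0 * hs

/-- The squares of the Jacobi weights. -/
theorem jacobi_weights {m : Fin 3 → ℝ} (hm : IsMassDistribution m) :
    Real.sqrt (m 0 / (1 - m 0)) ^ 2 = m 0 / (1 - m 0) ∧
    Real.sqrt (m 1 * m 2 / (1 - m 0)) ^ 2 = m 1 * m 2 / (1 - m 0) := by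
  have h0 := (hm.pos 0).2
  have := hm.1 0
  have := hm.1 1
  have := hm.1 2
  exact ⟨Real.sq_sqrt (by positivity), Real.sq_sqrt (by positivity)⟩

/-- The plane coordinate as a continuous linear map. -/
def planeCoordL (e₁ e₂ : E3) : E3 →L[ℝ] ℂ :=
  Complex.ofRealCLM.comp (innerSL ℝ e₁) + Complex.I • Complex.ofRealCLM.comp (innerSL ℝ e₂)

theorem planeCoordL_apply (e₁ e₂ v : E3) : planeCoordL e₁ e₂ v = planeCoord e₁ e₂ v := by
  apply Complex.ext <;> simp [planeCoordL, planeCoord, real_inner_comm]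

theorem sum_planeCoord {m : Fin 3 → ℝ} {X : Fin 3 → E3} (hX : ∑ j, m j • X j = 0) (e₁ e₂ : E3) :
    ∑ j, m j * (planeCoord e₁ e₂ (X j)).re = 0 ∧ ∑ j, m j * (planeCoord e₁ e₂ (X j)).im = 0 := by
  constructor
  · have := congrArg (fun v => inner ℝ v e₁) hX
    simpa [sum_inner, inner_smul_left, planeCoord] using this
  · have := congrArg (fun v => inner ℝ v e₂) hX
    simpa [sum_inner, inner_smul_left, planeCoord] using this

theorem planeCoord_jacobi (m : Fin 3 → ℝ) (X : Fin 3 → E3) (e₁ e₂ : E3) :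
    planeCoord e₁ e₂ (jacobi₁ m X) = Real.sqrt (m 0 / (1 - m 0)) * planeCoord e₁ e₂ (X 0) ∧
    planeCoord e₁ e₂ (jacobi₂ m X) = Real.sqrt (m 1 * m 2 / (1 - m 0)) *
      (planeCoord e₁ e₂ (X 2) - planeCoord e₁ e₂ (X 1)) := by
  rw [jacobi₁, jacobi₂, planeCoord_smul, planeCoord_smul, planeCoord_sub]
  exact ⟨rfl, rfl⟩

theorem inner_jacobi {m : Fin 3 → ℝ} {X : Fin 3 → E3} {n : E3} (h : ∀ i, inner ℝ n (X i) = 0) :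
    inner ℝ n (jacobi₁ m X) = 0 ∧ inner ℝ n (jacobi₂ m X) = 0 := by
  simp [jacobi₁, jacobi₂, inner_smul_right, inner_sub_right, h]

section PlanarMotion

variable {m : Fin 3 → ℝ} (hm : IsMassDistribution m) {e₁ e₂ : E3} (h₁ : ‖e₁‖ = 1) (h₂ : ‖e₂‖ = 1)
  (h : inner ℝ e₁ e₂ = 0)
include hm h₁ h₂ h

theorem totalInertia_eq_planeCoord {X : Fin 3 → E3}
    (hX : IsOrientedTriangle m X (cross e₁ e₂)) : ‖planeCoord e₁ e₂ (jacobi₁ m X)‖ ^ 2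
      + ‖planeCoord e₁ e₂ (jacobi₂ m X)‖ ^ 2 = totalInertia m X := by
  obtain ⟨i1, i2⟩ := inner_jacobi (m := m) hX.2.2
  rw [norm_sq_planeCoord h₁ h₂ h i1, norm_sq_planeCoord h₁ h₂ h i2, norm_sq_jacobi hm hX.1]

theorem shape_eq_hopf {X : Fin 3 → E3} (hX : IsOrientedTriangle m X (cross e₁ e₂)) :
    shape m X (cross e₁ e₂)
      = hopf (planeCoord e₁ e₂ (jacobi₁ m X)) (planeCoord e₁ e₂ (jacobi₂ m X)) := by
  obtain ⟨i1, i2⟩ := inner_jacobi (m := m) hX.2.2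
  rw [shape, hopf, totalInertia_eq_planeCoord hm h₁ h₂ h hX, re_conj_planeCoord h₁ h₂ h i1,
    im_conj_planeCoord h₁ h₂ h, norm_sq_planeCoord h₁ h₂ h i1, norm_sq_planeCoord h₁ h₂ h i2]

/-- Vanishing angular momentum is orthogonality to the circle orbits of the Hopf fibration. -/
theorem im_conj_jacobi {X V : Fin 3 → E3} (hX : ∑ j, m j • X j = 0) (hV : ∑ j, m j • V j = 0) :
    ((starRingEnd ℂ) (planeCoord e₁ e₂ (jacobi₁ m X)) * planeCoord e₁ e₂ (jacobi₁ m V)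
      + (starRingEnd ℂ) (planeCoord e₁ e₂ (jacobi₂ m X)) * planeCoord e₁ e₂ (jacobi₂ m V)).im
      = inner ℝ (cross e₁ e₂) (angularMomentum m X V) := by
  obtain ⟨x1, x2⟩ := sum_planeCoord hX e₁ e₂
  obtain ⟨v1, v2⟩ := sum_planeCoord hV e₁ e₂
  obtain ⟨w1, w2⟩ := jacobi_weights hm
  have b1 := jacobi_bilinear hm x1 v2
  have b2 := jacobi_bilinear hm x2 v1
  obtain ⟨p1, p2⟩ := planeCoord_jacobi m X e₁ e₂
  obtain ⟨q1, q2⟩ := planeCoord_jacobi m V e₁ e₂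
  have hsum : inner ℝ (cross e₁ e₂) (angularMomentum m X V)
      = ∑ j, m j * ((planeCoord e₁ e₂ (X j)).re * (planeCoord e₁ e₂ (V j)).im)
        - ∑ j, m j * ((planeCoord e₁ e₂ (X j)).im * (planeCoord e₁ e₂ (V j)).re) := by
    rw [angularMomentum, inner_sum, ← Finset.sum_sub_distrib]
    refine Finset.sum_congr rfl fun j _ => ?_
    rw [inner_smul_right, ← im_conj_planeCoord h₁ h₂ h]
    simp
    ring
  rw [hsum, ← b1, ← b2, p1, p2, q1, q2, ← w1, ← w2]
  simp
  ring

/-- The Jacobi coordinates of the binary collision `a_{i+1} = a_{i+2}`. -/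
def collisionCoord (m : Fin 3 → ℝ) (i : Fin 3) : ℂ × ℂ :=
  let x : Fin 3 → ℝ := fun j => if j = i then 1 - m i else -m i
  ((Real.sqrt (m 0 / (1 - m 0)) * x 0 : ℝ), (Real.sqrt (m 1 * m 2 / (1 - m 0)) * (x 2 - x 1) : ℝ))

omit h₁ h₂ h in
theorem sum_collision (i : Fin 3) :
    ∑ j, m j * (if j = i then 1 - m i else -m i) = 0 := by
  have hs := hm.2
  rw [Fin.sum_univ_three] at hs ⊢
  fin_cases i <;> simp
  · linear_combination (-m 0) * hs
  · linear_combination (-m 1) * hs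
  · linear_combination (-m 2) * hs

-- On triples with centre of mass `0`, the mass-weighted product with `j ↦ δ_ij - m_i` is `y ↦ m_i
-- y_i`; Jacobi coordinates preserve this product.
omit h₁ h₂ h in
theorem herm_collisionCoord {X : Fin 3 → E3} (hX : ∑ j, m j • X j = 0) (i : Fin 3) :
    herm (collisionCoord m i).1 (collisionCoord m i).2 (planeCoord e₁ e₂ (jacobi₁ m X))
      (planeCoord e₁ e₂ (jacobi₂ m X)) = m i * planeCoord e₁ e₂ (X i) := by
  obtain ⟨x1, x2⟩ := sum_planeCoord hX e₁ e₂
  obtain ⟨w1, w2⟩ := jacobi_weights hm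
  obtain ⟨p1, p2⟩ := planeCoord_jacobi m X e₁ e₂
  have hred : ∀ y : Fin 3 → ℝ, ∑ j, m j * y j = 0 →
      ∑ j, m j * ((if j = i then 1 - m i else -m i) * y j) = m i * y i := by
    intro y hy
    rw [Fin.sum_univ_three] at hy ⊢
    fin_cases i <;> simp
    · linear_combination (-m 0) * hy
    · linear_combination (-m 1) * hy
    · linear_combination (-m 2) * hy
  have b1 := (jacobi_bilinear hm (sum_collision hm i) x1).trans (hred _ x1)
  have b2 := (jacobi_bilinear hm (sum_collision hm i) x2).trans (hred _ x2)
  rw [← w1, ← w2] at b1 b2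
  rw [p1, p2]
  apply Complex.ext
  · simp only [herm, collisionCoord, Complex.conj_ofReal, Complex.add_re, Complex.re_ofReal_mul,
      Complex.sub_re]
    rw [← b1]; ring
  · simp only [herm, collisionCoord, Complex.conj_ofReal, Complex.add_im, Complex.im_ofReal_mul,
      Complex.sub_im]
    rw [← b2]; ring

-- This identifies the form that measures the turning of `a_i` as the one based at the binary
-- collision, that is, as the kinematic form. The standard frame realizes the triangle in the
-- definition of `binaryCollision`.
omit h₁ h₂ h in
theorem hopf_collisionCoord (i : Fin 3) :
    ‖(collisionCoord m i).1‖ ^ 2 + ‖(collisionCoord m i).2‖ ^ 2 ≠ 0 ∧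
    hopf (collisionCoord m i).1 (collisionCoord m i).2 = binaryCollision m i := by
  set X : Fin 3 → E3 := fun j => (if j = i then 1 - m i else -m i) • !₂[1, 0, 0] with hXd
  have f₁ : ‖(!₂[1, 0, 0] : E3)‖ = 1 := by simp [EuclideanSpace.norm_eq, Fin.sum_univ_three]
  have f₂ : ‖(!₂[0, 1, 0] : E3)‖ = 1 := by simp [EuclideanSpace.norm_eq, Fin.sum_univ_three]
  have f : inner ℝ (!₂[1, 0, 0] : E3) !₂[0, 1, 0] = 0 := by simp [inner_eq]
  have fc : cross (!₂[1, 0, 0] : E3) !₂[0, 1, 0] = !₂[0, 0, 1] := by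
    ext k; fin_cases k <;> simp
  have hX : IsOrientedTriangle m X (cross (!₂[1, 0, 0] : E3) !₂[0, 1, 0]) := by
    rw [fc]
    refine ⟨?_, ?_, fun j => ?_⟩
    · simp only [hXd, smul_smul]
      rw [← Finset.sum_smul, sum_collision hm i, zero_smul]
    · simp [EuclideanSpace.norm_eq, Fin.sum_univ_three]
    · simp only [hXd]
      split_ifs <;> simp [inner_eq]
  have hX0 : X ≠ 0 := by
    intro e
    have := congrArg (fun v : E3 => v 0) (congrFun e i)
    have h' := (hm.pos i).2
    simp [hXd] at this
    linarith
  obtain ⟨p1, p2⟩ := planeCoord_jacobi m X !₂[1, 0, 0] !₂[0, 1, 0]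
  have hp : ∀ j, planeCoord !₂[1, 0, 0] !₂[0, 1, 0] (X j)
      = ((if j = i then 1 - m i else -m i : ℝ) : ℂ) := by
    intro j
    simp only [hXd]
    apply Complex.ext <;> split_ifs <;> simp [planeCoord, inner_eq]
  have c1 : (collisionCoord m i).1 = planeCoord !₂[1, 0, 0] !₂[0, 1, 0] (jacobi₁ m X) := by
    rw [p1, hp, collisionCoord]; push_cast; rfl
  have c2 : (collisionCoord m i).2 = planeCoord !₂[1, 0, 0] !₂[0, 1, 0] (jacobi₂ m X) := by
    rw [p2, hp, hp, collisionCoord]; push_cast; rfl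
  rw [c1, c2]
  refine ⟨?_, ?_⟩
  · rw [totalInertia_eq_planeCoord hm f₁ f₂ f hX]
    exact (totalInertia_pos hm hX0).ne'
  · rw [← shape_eq_hopf hm f₁ f₂ f hX, fc]
    rfl

end PlanarMotion

/-! ### Horizontal curves over the Hopf sphere -/

theorem contDiffOn_hopf {z₁ z₂ : ℝ → ℂ} {s : Set ℝ} (h₁ : ContDiffOn ℝ 1 z₁ s)
    (h₂ : ContDiffOn ℝ 1 z₂ s) (h0 : ∀ t ∈ s, ‖z₁ t‖ ^ 2 + ‖z₂ t‖ ^ 2 ≠ 0) :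
    ContDiffOn ℝ 1 (fun t => hopf (z₁ t) (z₂ t)) s := by
  have n₁ : ContDiffOn ℝ 1 (fun t => ‖z₁ t‖ ^ 2) s := h₁.norm_sq ℝ
  have n₂ : ContDiffOn ℝ 1 (fun t => ‖z₂ t‖ ^ 2) s := h₂.norm_sq ℝ
  have c₁ : ContDiffOn ℝ 1 (fun t => (starRingEnd ℂ) (z₁ t)) s :=
    Complex.conjCLE.contDiff.comp_contDiffOn h₁
  have c₂ : ContDiffOn ℝ 1 (fun t => (starRingEnd ℂ) (z₂ t)) s :=
    Complex.conjCLE.contDiff.comp_contDiffOn h₂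
  have hr : ContDiffOn ℝ 1 (fun t => (2 * (‖z₁ t‖ ^ 2 + ‖z₂ t‖ ^ 2))⁻¹) s :=
    (contDiffOn_const.mul (n₁.add n₂)).inv fun t ht => mul_ne_zero two_ne_zero (h0 t ht)
  have hv : ContDiffOn ℝ 1 (fun t => (!₂[‖z₁ t‖ ^ 2 - ‖z₂ t‖ ^ 2,
      2 * ((starRingEnd ℂ) (z₁ t) * z₂ t).re, 2 * ((starRingEnd ℂ) (z₂ t) * z₁ t).im] : E3)) s := by
    rw [contDiffOn_euclidean]
    intro k
    fin_cases k
    · exact n₁.sub n₂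
    · exact contDiffOn_const.mul (Complex.reCLM.contDiff.comp_contDiffOn (c₁.mul h₂))
    · exact contDiffOn_const.mul (Complex.imCLM.contDiff.comp_contDiffOn (c₂.mul h₁))
  exact hr.smul hv

/-- `(z₁, z₂)` is a piecewise `C¹` curve of nonzero vectors of `ℂ²`, orthogonal to the orbits of
the circle action, and `γ` is its image on the Hopf sphere. -/
structure IsHorizontalLift (γ : ℝ → E3) (z₁ z₂ : ℝ → ℂ) (t₀ t₁ : ℝ) : Prop where
  piecewise : PiecewiseC1 (fun t => (z₁ t, z₂ t)) t₀ t₁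
  ne_zero : ∀ t ∈ Icc t₀ t₁, ‖z₁ t‖ ^ 2 + ‖z₂ t‖ ^ 2 ≠ 0
  eq_hopf : ∀ t ∈ Icc t₀ t₁, γ t = hopf (z₁ t) (z₂ t)
  horizontal : ∃ S : Set ℝ, S.Finite ∧ ∀ t ∈ Ioo t₀ t₁ \ S,
    ((starRingEnd ℂ) (z₁ t) * deriv z₁ t + (starRingEnd ℂ) (z₂ t) * deriv z₂ t).im = 0

namespace IsHorizontalLift

variable {γ : ℝ → E3} {z₁ z₂ : ℝ → ℂ} {t₀ t₁ : ℝ} (H : IsHorizontalLift γ z₁ z₂ t₀ t₁)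
include H

theorem norm_eq {t : ℝ} (ht : t ∈ Icc t₀ t₁) : ‖γ t‖ = 1 / 2 := by
  rw [H.eq_hopf t ht, norm_hopf (H.ne_zero t ht)]

theorem piecewiseC1 : PiecewiseC1 γ t₀ t₁ :=
  H.piecewise.comp fun _ hs hz => (contDiffOn_hopf hz.fst hz.snd fun t ht =>
    H.ne_zero t (hs ht)).congr fun t ht => H.eq_hopf t (hs ht)

theorem piecewiseC1_herm (d₁ d₂ : ℂ) :
    PiecewiseC1 (fun t => herm d₁ d₂ (z₁ t) (z₂ t)) t₀ t₁ :=
  H.piecewise.comp fun _ _ hz =>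
    (contDiffOn_const.mul hz.fst).add (contDiffOn_const.mul hz.snd)

theorem herm_ne_zero {d₁ d₂ : ℂ} (hd : ‖d₁‖ ^ 2 + ‖d₂‖ ^ 2 ≠ 0) {t : ℝ} (ht : t ∈ Icc t₀ t₁)
    (hne : γ t ≠ -hopf d₁ d₂) : herm d₁ d₂ (z₁ t) (z₂ t) ≠ 0 := by
  intro h0
  have hz := H.ne_zero t ht
  have e := norm_sq_herm hd hz
  have hp := one_add_four_inner_pos (norm_hopf hd) (H.norm_eq ht) hne
  rw [← H.eq_hopf t ht, h0, norm_zero] at e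
  have h2 : (‖d₁‖ ^ 2 + ‖d₂‖ ^ 2) * (‖z₁ t‖ ^ 2 + ‖z₂ t‖ ^ 2)
      * (1 + 4 * inner ℝ (hopf d₁ d₂) (γ t)) ≠ 0 := mul_ne_zero (mul_ne_zero hd hz) hp.ne'
  apply h2
  linarith

theorem ae_angularSpeed_eq {d₁ d₂ : ℂ} (ht : t₀ ≤ t₁) (hd : ‖d₁‖ ^ 2 + ‖d₂‖ ^ 2 ≠ 0)
    (hne : ∀ t ∈ Icc t₀ t₁, γ t ≠ -hopf d₁ d₂) :
    ∀ᵐ t ∂(volume.restrict (uIoc t₀ t₁)), angularSpeed (fun τ => herm d₁ d₂ (z₁ τ) (z₂ τ)) t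
      = poleForm (hopf d₁ d₂) (γ t) (deriv γ t) := by
  obtain ⟨S, hS, hhor⟩ := H.horizontal
  obtain ⟨S₁, hS₁, _, hz⟩ := H.piecewise.exists_regular
  obtain ⟨S₂, hS₂, _, hγ⟩ := H.piecewiseC1.exists_regular
  refine ae_restrict_uIoc_of_finite ((hS.union hS₁).union hS₂) ht ?_
  rintro t ⟨htt, hts⟩
  simp only [mem_union, not_or] at hts
  have hI := Ioo_subset_Icc_self htt
  have dz := (hz t ⟨htt, hts.1.2⟩).1
  have d₁ : DifferentiableAt ℝ z₁ t := dz.differentiableAt.fst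
  have d₂ : DifferentiableAt ℝ z₂ t := dz.differentiableAt.snd
  refine angularSpeed_herm d₁.hasDerivAt d₂.hasDerivAt (hγ t ⟨htt, hts.2⟩).1 ?_
    (hhor t ⟨htt, hts.1.1⟩) hd (H.herm_ne_zero hd hI (hne t hI))
  filter_upwards [Icc_mem_nhds htt.1 htt.2] with τ hτ
  exact ⟨H.ne_zero τ hτ, H.eq_hopf τ hτ⟩

/-- The holonomy of a horizontal curve over the boundary of a region. -/
theorem exists_holonomy (ht : t₀ ≤ t₁) {D : Set ShapeSphere} {ε : ℤ}
    (hD : IsOrientedBoundary γ t₀ t₁ D ε) :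
    ∃ r : ℝ, 0 ≤ r ∧ ∀ d₁ d₂ : ℂ, herm d₁ d₂ (z₁ t₁) (z₂ t₁)
      = r * Complex.exp ((ε * (2 * shapeArea.real D) : ℝ) * Complex.I)
        * herm d₁ d₂ (z₁ t₀) (z₂ t₀) := by
  have m₀ : t₀ ∈ Icc t₀ t₁ := ⟨le_rfl, ht⟩
  have m₁ : t₁ ∈ Icc t₀ t₁ := ⟨ht, le_rfl⟩
  obtain ⟨p, hp⟩ := hD.2.1.nonempty
  have hpn : ‖(p : E3)‖ = 1 / 2 := by simp
  -- A coordinate vanishing only over a point `p` of `D` never vanishes along the curve, since `D`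
  -- is open and `γ` runs in its frontier.
  obtain ⟨d₁, d₂, hd, hdp⟩ := exists_hopf_eq (b := -(p : E3)) (by rw [norm_neg, hpn])
  have hpγ : ∀ t ∈ Icc t₀ t₁, γ t ≠ p := by
    intro t htt e
    have : γ t ∈ (Subtype.val '' frontier D : Set E3) := hD.2.2.2.1 ▸ mem_image_of_mem γ htt
    rw [e] at this
    obtain ⟨q, hq, hqp⟩ := this
    rw [Subtype.ext hqp, hD.1.frontier_eq] at hq
    exact hq.2 hp
  have hne : ∀ t ∈ Icc t₀ t₁, γ t ≠ -hopf d₁ d₂ := by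
    rw [hdp, neg_neg]; exact hpγ
  have hI := (poleIntegral_eq ht H.piecewiseC1 (fun t => H.norm_eq) hD hpn hpγ).1
    (mem_image_of_mem _ hp)
  have hw := intervalIntegral.integral_congr_ae_restrict (H.ae_angularSpeed_eq ht hd hne)
  rw [hdp] at hw
  rw [poleIntegral, ← hw] at hI
  have hturn := (turning ht (H.piecewiseC1_herm d₁ d₂)
    fun t htt => H.herm_ne_zero hd htt (hne t htt)).2.2 t₁ m₁
  rw [hI] at hturn
  -- The lost full turn `2πε` is invisible to the exponential.
  have hexp : Complex.exp ((ε * (2 * shapeArea.real D - 2 * Real.pi) : ℝ) * Complex.I)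
      = Complex.exp ((ε * (2 * shapeArea.real D) : ℝ) * Complex.I) := by
    rw [Complex.exp_eq_exp_iff_exists_int]
    refine ⟨-ε, ?_⟩
    push_cast
    ring
  rw [hexp] at hturn
  -- Both endpoints lie over the same shape, so one complex factor serves all coordinates and can be
  -- read off from the chosen one.
  obtain ⟨c, hc₁, hc₂⟩ := exists_smul_of_hopf_eq (H.ne_zero t₀ m₀) (H.ne_zero t₁ m₁)
    (by rw [← H.eq_hopf t₀ m₀, ← H.eq_hopf t₁ m₁, hD.2.2.1])
  have hc : ∀ d₁ d₂, herm d₁ d₂ (z₁ t₁) (z₂ t₁) = c * herm d₁ d₂ (z₁ t₀) (z₂ t₀) := by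
    intro d₁ d₂
    rw [herm, herm, hc₁, hc₂]; ring
  refine ⟨‖herm d₁ d₂ (z₁ t₁) (z₂ t₁)‖ / ‖herm d₁ d₂ (z₁ t₀) (z₂ t₀)‖, by positivity,
    fun d₁' d₂' => ?_⟩
  rw [hc, ← mul_right_cancel₀ (H.herm_ne_zero hd m₀ (hne t₀ m₀)) ((hc d₁ d₂).symm.trans hturn)]

end IsHorizontalLift

/-! ### Planar motions -/

theorem hasDerivAt_planeCoord (e₁ e₂ : E3) {x : ℝ → E3} {v : E3} {t : ℝ} (hx : HasDerivAt x v t) :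
    HasDerivAt (fun τ => planeCoord e₁ e₂ (x τ)) (planeCoord e₁ e₂ v) t := by
  simpa only [Function.comp_def, planeCoordL_apply]
    using (planeCoordL e₁ e₂).hasFDerivAt.comp_hasDerivAt t hx

theorem hasDerivAt_planeCoord_jacobi (m : Fin 3 → ℝ) (e₁ e₂ : E3) {X : ℝ → Fin 3 → E3}
    {V : Fin 3 → E3} {t : ℝ} (hX : HasDerivAt X V t) :
    HasDerivAt (fun τ => planeCoord e₁ e₂ (jacobi₁ m (X τ))) (planeCoord e₁ e₂ (jacobi₁ m V)) t ∧
    HasDerivAt (fun τ => planeCoord e₁ e₂ (jacobi₂ m (X τ)))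
      (planeCoord e₁ e₂ (jacobi₂ m V)) t := by
  have d := hasDerivAt_pi.1 hX
  exact ⟨hasDerivAt_planeCoord e₁ e₂ ((d 0).fun_const_smul _),
    hasDerivAt_planeCoord e₁ e₂ (((d 2).fun_sub (d 1)).fun_const_smul _)⟩

section PlanarMotion

variable {m : Fin 3 → ℝ} (hm : IsMassDistribution m) {e₁ e₂ : E3} (h₁ : ‖e₁‖ = 1) (h₂ : ‖e₂‖ = 1)
  (h : inner ℝ e₁ e₂ = 0) {t₀ t₁ : ℝ} {X : ℝ → Fin 3 → E3}
  (hM : ∀ t ∈ Icc t₀ t₁, IsOrientedTriangle m (X t) (cross e₁ e₂))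
include hm h₁ h₂ h hM

theorem isHorizontalLift_jacobi (h0 : ∀ t ∈ Icc t₀ t₁, X t ≠ 0) (hX : PiecewiseC1 X t₀ t₁)
    (hΩ : ∀ t ∈ Ioo t₀ t₁, angularMomentum m (X t) (deriv X t) = 0) {γ : ℝ → E3}
    (hγ : ∀ t ∈ Icc t₀ t₁, γ t = shape m (X t) (cross e₁ e₂)) :
    IsHorizontalLift γ (fun t => planeCoord e₁ e₂ (jacobi₁ m (X t)))
      (fun t => planeCoord e₁ e₂ (jacobi₂ m (X t))) t₀ t₁ where
  piecewise := hX.comp fun s _ hs => by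
    simp only [← planeCoordL_apply]
    have h := contDiffOn_pi.1 hs
    have j₁ : ContDiffOn ℝ 1 (fun t => jacobi₁ m (X t)) s := (h 0).const_smul _
    have j₂ : ContDiffOn ℝ 1 (fun t => jacobi₂ m (X t)) s := ((h 2).sub (h 1)).const_smul _
    exact ((planeCoordL e₁ e₂).contDiff.comp_contDiffOn j₁).prodMk
      ((planeCoordL e₁ e₂).contDiff.comp_contDiffOn j₂)
  ne_zero t ht := by
    rw [totalInertia_eq_planeCoord hm h₁ h₂ h (hM t ht)]
    exact (totalInertia_pos hm (h0 t ht)).ne'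
  eq_hopf t ht := by rw [hγ t ht, shape_eq_hopf hm h₁ h₂ h (hM t ht)]
  horizontal := by
    obtain ⟨S, hS, _, hd⟩ := hX.exists_regular
    refine ⟨S, hS, fun t htt => ?_⟩
    have dX := hasDerivAt_pi.1 (hd t htt).1
    have hI := Ioo_subset_Icc_self htt.1
    have hV : ∑ j, m j • deriv X t j = 0 := by
      have d : HasDerivAt (fun τ => ∑ j, m j • X τ j) (∑ j, m j • deriv X t j) t :=
        HasDerivAt.fun_sum fun j _ => (dX j).const_smul (m j)
      refine d.unique ((hasDerivAt_const t (0 : E3)).congr_of_eventuallyEq ?_)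
      filter_upwards [Icc_mem_nhds htt.1.1 htt.1.2] with τ hτ
      exact (hM τ hτ).1
    obtain ⟨d₁, d₂⟩ := hasDerivAt_planeCoord_jacobi m e₁ e₂ (hd t htt).1
    rw [d₁.deriv, d₂.deriv, im_conj_jacobi hm h₁ h₂ h (hM t hI).1 hV, hΩ t htt.1, inner_zero_right]

/-- The kinematic angular velocity is the angular speed of the plane coordinate. -/
theorem ae_omegaZero_eq (ht : t₀ ≤ t₁) (h0 : ∀ t ∈ Icc t₀ t₁, X t ≠ 0) (hX : PiecewiseC1 X t₀ t₁)
    (hΩ : ∀ t ∈ Ioo t₀ t₁, angularMomentum m (X t) (deriv X t) = 0) {n : ℝ → E3}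
    (hn : ∀ t ∈ Icc t₀ t₁, n t = cross e₁ e₂) (i : Fin 3) :
    ∀ᵐ t ∂(volume.restrict (uIoc t₀ t₁)), omegaZero m (X t) (deriv X t) (n t) i
      = angularSpeed (fun τ => planeCoord e₁ e₂ (X τ i)) t := by
  obtain ⟨S, hS, _, hd⟩ := hX.exists_regular
  refine ae_restrict_uIoc_of_finite hS ht fun t htt => ?_
  have hI := Ioo_subset_Icc_self htt.1
  have dX := hasDerivAt_pi.1 (hd t htt).1 i
  rw [omegaZero_eq hm _ (h0 t hI) (hΩ t htt.1), angularVelocity, hn t hI, angularSpeed,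
    (hasDerivAt_planeCoord e₁ e₂ dX).deriv,
    im_conj_planeCoord h₁ h₂ h, norm_sq_planeCoord h₁ h₂ h ((hM t hI).2.2 i)]

theorem position_change (ht : t₀ ≤ t₁) (h0 : ∀ t ∈ Icc t₀ t₁, X t ≠ 0) (hX : PiecewiseC1 X t₀ t₁)
    (hΩ : ∀ t ∈ Ioo t₀ t₁, angularMomentum m (X t) (deriv X t) = 0) {γ : ℝ → E3}
    (hγ : ∀ t ∈ Icc t₀ t₁, γ t = shape m (X t) (cross e₁ e₂)) {D : Set ShapeSphere} {ε : ℤ}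
    (hD : IsOrientedBoundary γ t₀ t₁ D ε) (i : Fin 3) :
    X t₁ i = (size m (X t₁) / size m (X t₀)) •
      rot (cross e₁ e₂) (ε * (2 * shapeArea.real D)) (X t₀ i) := by
  have m₀ : t₀ ∈ Icc t₀ t₁ := ⟨le_rfl, ht⟩
  have m₁ : t₁ ∈ Icc t₀ t₁ := ⟨ht, le_rfl⟩
  obtain ⟨r, hr, hol⟩ :=
    (isHorizontalLift_jacobi hm h₁ h₂ h hM h0 hX hΩ hγ).exists_holonomy ht hD
  have hn : ∀ d₁ d₂ : ℂ, ‖herm d₁ d₂ (planeCoord e₁ e₂ (jacobi₁ m (X t₁)))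
      (planeCoord e₁ e₂ (jacobi₂ m (X t₁)))‖ ^ 2 = r ^ 2 *
      ‖herm d₁ d₂ (planeCoord e₁ e₂ (jacobi₁ m (X t₀))) (planeCoord e₁ e₂ (jacobi₂ m (X t₀)))‖ ^ 2 := by
    intro d₁ d₂
    rw [hol, norm_mul, norm_mul, Complex.norm_exp_ofReal_mul_I, Complex.norm_real, Real.norm_eq_abs,
      mul_one, mul_pow, sq_abs]
  -- The coordinates `(1, 0)` and `(0, 1)` are the Jacobi coordinates themselves; their squared
  -- moduli add up to the inertia.
  have hsize : size m (X t₁) / size m (X t₀) = r := by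
    have e := congrArg₂ (· + ·) (hn 1 0) (hn 0 1)
    simp only [herm, map_one, map_zero, one_mul, zero_mul, add_zero, zero_add, ← mul_add] at e
    rw [totalInertia_eq_planeCoord hm h₁ h₂ h (hM t₀ m₀),
      totalInertia_eq_planeCoord hm h₁ h₂ h (hM t₁ m₁)] at e
    have := Real.sqrt_pos.2 (totalInertia_pos hm (h0 t₀ m₀))
    rw [size, size, e, Real.sqrt_mul (sq_nonneg r), Real.sqrt_sq hr, mul_div_assoc,
      div_self this.ne', mul_one]
  rw [hsize, rot_eq_iff h₁ h₂ h ((hM t₁ m₁).2.2 i) ((hM t₀ m₀).2.2 i)]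
  have e := hol (collisionCoord m i).1 (collisionCoord m i).2
  rw [herm_collisionCoord hm (hM t₀ m₀).1, herm_collisionCoord hm (hM t₁ m₁).1, mul_left_comm] at e
  exact mul_left_cancel₀ (by exact_mod_cast (hm.1 i).ne') e

theorem angularSpeed_planeCoord (ht : t₀ ≤ t₁) (h0 : ∀ t ∈ Icc t₀ t₁, X t ≠ 0)
    (hX : PiecewiseC1 X t₀ t₁)
    (hΩ : ∀ t ∈ Ioo t₀ t₁, angularMomentum m (X t) (deriv X t) = 0) {γ : ℝ → E3}
    (hγ : ∀ t ∈ Icc t₀ t₁, γ t = shape m (X t) (cross e₁ e₂)) {i : Fin 3}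
    (hi : ∀ t ∈ Icc t₀ t₁, X t i ≠ 0) :
    ∀ᵐ t ∂(volume.restrict (uIoc t₀ t₁)),
      angularSpeed (fun τ => planeCoord e₁ e₂ (X τ i)) t
        = kinematicForm m i (γ t) (deriv γ t) := by
  obtain ⟨hd, hb⟩ := hopf_collisionCoord hm i
  have hne : ∀ t ∈ Icc t₀ t₁, γ t ≠ -hopf (collisionCoord m i).1 (collisionCoord m i).2 := by
    intro t htt e
    rw [hb, hγ t htt, shape_eq_neg_iff hm (hM t htt) (h0 t htt)] at e
    exact hi t htt e
  have H := isHorizontalLift_jacobi hm h₁ h₂ h hM h0 hX hΩ hγ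
  have key := H.ae_angularSpeed_eq ht hd hne
  obtain ⟨S, hS, _, hdX⟩ := hX.exists_regular
  filter_upwards [key, ae_restrict_uIoc_of_finite (p := fun t => t ∈ Ioo t₀ t₁ \ S) hS ht
    fun t ht => ht] with t hk htt
  rw [kinematicForm_eq_poleForm, ← hb, ← hk]
  have he : (fun τ => herm (collisionCoord m i).1 (collisionCoord m i).2
      (planeCoord e₁ e₂ (jacobi₁ m (X τ))) (planeCoord e₁ e₂ (jacobi₂ m (X τ))))
      =ᶠ[nhds t] fun τ => m i * planeCoord e₁ e₂ (X τ i) := by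
    filter_upwards [Icc_mem_nhds htt.1.1 htt.1.2] with τ hτ
    exact herm_collisionCoord hm (hM τ hτ).1 i
  -- The constant factor `m_i` cancels in the logarithmic derivative.
  rw [angularSpeed_eq, angularSpeed_eq, he.deriv_eq,
    herm_collisionCoord hm (hM t (Ioo_subset_Icc_self htt.1)).1, deriv_const_mul_field,
    mul_div_mul_left _ _ (by exact_mod_cast (hm.1 i).ne')]

omit hm in
theorem hasTotalRotation_planeCoord (ht : t₀ ≤ t₁) (hX : PiecewiseC1 X t₀ t₁) {i : Fin 3}
    (hi : ∀ t ∈ Icc t₀ t₁, X t i ≠ 0) :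
    IntervalIntegrable (angularSpeed fun t => planeCoord e₁ e₂ (X t i)) volume t₀ t₁ ∧
    HasTotalRotation (cross e₁ e₂) (fun t => X t i) t₀ t₁
      (∫ t in t₀..t₁, angularSpeed (fun τ => planeCoord e₁ e₂ (X τ i)) t) := by
  have hc : PiecewiseC1 (fun t => planeCoord e₁ e₂ (X t i)) t₀ t₁ := hX.comp fun s _ hs => by
    simp only [← planeCoordL_apply]
    exact (planeCoordL e₁ e₂).contDiff.comp_contDiffOn (contDiffOn_pi.1 hs i)
  have hnorm : ∀ t ∈ Icc t₀ t₁, ‖planeCoord e₁ e₂ (X t i)‖ = ‖X t i‖ := fun t htt =>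
    norm_planeCoord h₁ h₂ h ((hM t htt).2.2 i)
  have m₀ : t₀ ∈ Icc t₀ t₁ := ⟨le_rfl, ht⟩
  obtain ⟨hint, hcont, hturn⟩ := turning ht hc fun t htt => by
    rw [← norm_ne_zero_iff, hnorm t htt]
    exact norm_ne_zero_iff.2 (hi t htt)
  -- The angle function is the primitive of the angular speed from `turning`, which starts at `0`.
  refine ⟨hint, _, hcont, intervalIntegral.integral_same, rfl, fun t htt => ?_⟩
  have hp : ∀ t ∈ Icc t₀ t₁, inner ℝ (cross e₁ e₂) (‖X t i‖⁻¹ • X t i) = 0 := fun t htt => by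
    rw [inner_smul_right, (hM t htt).2.2 i, mul_zero]
  rw [← one_smul ℝ (rot _ _ _), rot_eq_iff h₁ h₂ h (hp t htt) (hp t₀ m₀), planeCoord_smul,
    planeCoord_smul, hturn t htt, hnorm t htt, hnorm t₀ m₀]
  have n₁ : (‖X t i‖ : ℂ) ≠ 0 := by exact_mod_cast norm_ne_zero_iff.2 (hi t htt)
  push_cast
  field_simp

end PlanarMotion

end ThreeBody

end

/-! ### The main theorem -/

theorem theoremC2
    (m : Fin 3 → ℝ) (hm : ThreeBody.IsMassDistribution m)
    (t₀ t₁ : ℝ) (ht : t₀ < t₁)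
    -- a piecewise differentiable motion of nonzero oriented m-triangles
    (X : ℝ → Fin 3 → ThreeBody.E3) (n : ℝ → ThreeBody.E3)
    (hM : ∀ t ∈ Set.Icc t₀ t₁, ThreeBody.IsOrientedTriangle m (X t) (n t) ∧ X t ≠ 0)
    (hC1 : ThreeBody.PiecewiseC1 (fun t => (X t, n t)) t₀ t₁)
    -- vanishing angular momentum
    (hΩ : ∀ t ∈ Set.Ioo t₀ t₁, ThreeBody.angularMomentum m (X t) (deriv X t) = 0)
    -- the normal, which a collinear configuration does not determine, does not spin about its line
    (hn : ∀ t ∈ Set.Ioo t₀ t₁, ThreeBody.IsEclipse (X t) → deriv n t = 0)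
    -- the shape curve bounds the region `D`, with orientation `ε`
    (D : Set ThreeBody.ShapeSphere) (ε : ℤ) (hε : ε = 1 ∨ ε = -1)
    (hD : ThreeBody.IsOrientedBoundary (fun t => ThreeBody.shape m (X t) (n t)) t₀ t₁ D ε) :
    -- the plane of the motion is fixed
    (∀ t ∈ Set.Icc t₀ t₁, n t = n t₀) ∧
    -- the total change of position is the rotation through twice the oriented area
    (∀ i, X t₁ i = (ThreeBody.size m (X t₁) / ThreeBody.size m (X t₀)) •
      ThreeBody.rot (n t₀) (ε * ∫ _ in D, (2 : ℝ) ∂ThreeBody.shapeArea) (X t₀ i)) ∧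
    -- `dΘ_i = 2 dA`
    (∀ i, ∀ s : ThreeBody.ShapeSphere, (s : ThreeBody.E3) ≠ ThreeBody.vertexAtCenter m i →
      ∀ u v : ThreeBody.E3, inner ℝ (s : ThreeBody.E3) u = 0 → inner ℝ (s : ThreeBody.E3) v = 0 →
        fderiv ℝ (fun p => ThreeBody.kinematicForm m i p v) s u
          - fderiv ℝ (fun p => ThreeBody.kinematicForm m i p u) s v
          = 2 * ThreeBody.areaForm s u v) ∧
    -- the total rotation of each vertex vector
    (∀ i, (∀ t ∈ Set.Icc t₀ t₁, X t i ≠ 0) →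
      IntervalIntegrable (fun t => ThreeBody.omegaZero m (X t) (deriv X t) (n t) i)
        MeasureTheory.volume t₀ t₁ ∧
      IntervalIntegrable (fun t => ThreeBody.kinematicForm m i (ThreeBody.shape m (X t) (n t))
        (deriv (fun τ => ThreeBody.shape m (X τ) (n τ)) t)) MeasureTheory.volume t₀ t₁ ∧
      ThreeBody.HasTotalRotation (n t₀) (fun t => X t i) t₀ t₁
        (∫ t in t₀..t₁, ThreeBody.omegaZero m (X t) (deriv X t) (n t) i) ∧
      (∫ t in t₀..t₁, ThreeBody.omegaZero m (X t) (deriv X t) (n t) i)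
        = ∫ t in t₀..t₁, ThreeBody.kinematicForm m i (ThreeBody.shape m (X t) (n t))
            (deriv (fun τ => ThreeBody.shape m (X τ) (n τ)) t) ∧
      -- equality with twice the oriented area; a full turn is lost if `D` contains the point `a_i = 0`
      ((∀ p ∈ D, (p : ThreeBody.E3) ≠ ThreeBody.vertexAtCenter m i) →
        ∫ t in t₀..t₁, ThreeBody.kinematicForm m i (ThreeBody.shape m (X t) (n t))
            (deriv (fun τ => ThreeBody.shape m (X τ) (n τ)) t)
          = ε * ∫ _ in D, (2 : ℝ) ∂ThreeBody.shapeArea) ∧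
      ((∃ p ∈ D, (p : ThreeBody.E3) = ThreeBody.vertexAtCenter m i) →
        ∫ t in t₀..t₁, ThreeBody.kinematicForm m i (ThreeBody.shape m (X t) (n t))
            (deriv (fun τ => ThreeBody.shape m (X τ) (n τ)) t)
          = ε * ((∫ _ in D, (2 : ℝ) ∂ThreeBody.shapeArea) - 2 * Real.pi))) := by

  have hX : ThreeBody.PiecewiseC1 X t₀ t₁ := hC1.comp fun _ _ h => h.fst
  have hnC : ThreeBody.PiecewiseC1 n t₀ t₁ := hC1.comp fun _ _ h => h.snd
  have m₀ : t₀ ∈ Set.Icc t₀ t₁ := ⟨le_rfl, ht.le⟩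
  have hconst := ThreeBody.normal_eq hm (fun t h => (hM t h).1) hX hnC hΩ hn
  -- A frame of the fixed plane, oriented by the initial normal, turns the motion into one in `ℂ`.
  obtain ⟨e₁, e₂, h₁, h₂, h, he⟩ := ThreeBody.exists_frame (hM t₀ m₀).1.2.1
  have hne : ∀ t ∈ Set.Icc t₀ t₁, n t = ThreeBody.cross e₁ e₂ := fun t htt => by
    rw [hconst t htt, he]
  have hT : ∀ t ∈ Set.Icc t₀ t₁, ThreeBody.IsOrientedTriangle m (X t) (ThreeBody.cross e₁ e₂) :=
    fun t htt => hne t htt ▸ (hM t htt).1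
  have h0 : ∀ t ∈ Set.Icc t₀ t₁, X t ≠ 0 := fun t htt => (hM t htt).2
  set γ : ℝ → ThreeBody.E3 := fun t => ThreeBody.shape m (X t) (n t) with hγd
  have hγ : ∀ t ∈ Set.Icc t₀ t₁, γ t = ThreeBody.shape m (X t) (ThreeBody.cross e₁ e₂) :=
    fun t htt => by rw [← hne t htt]
  have H := ThreeBody.isHorizontalLift_jacobi hm h₁ h₂ h hT h0 hX hΩ hγ
  have hA : ∫ _ in D, (2 : ℝ) ∂ThreeBody.shapeArea = 2 * ThreeBody.shapeArea.real D := by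
    rw [MeasureTheory.setIntegral_const, smul_eq_mul, mul_comm]
  rw [hA]
  refine ⟨hconst, fun i => ?_, fun i s hs u v hu hv => ?_, fun i hi => ?_⟩
  · rw [← he]
    exact ThreeBody.position_change hm h₁ h₂ h hT ht.le h0 hX hΩ hγ hD i
  · rw [ThreeBody.vertexAtCenter_eq hm] at hs
    exact ThreeBody.poleForm_fderiv (ThreeBody.norm_binaryCollision hm i) (by simp) hs hu hv
  · have hvc := ThreeBody.vertexAtCenter_eq hm i
    have hb := ThreeBody.norm_binaryCollision hm i
    have hbγ : ∀ t ∈ Set.Icc t₀ t₁, γ t ≠ -ThreeBody.binaryCollision m i := by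
      intro t htt e
      rw [hγ t htt, ThreeBody.shape_eq_neg_iff hm (hT t htt) (h0 t htt)] at e
      exact hi t htt e
    have ae₁ := ThreeBody.ae_omegaZero_eq hm h₁ h₂ h hT ht.le h0 hX hΩ hne i
    have ae₂ := ThreeBody.angularSpeed_planeCoord hm h₁ h₂ h hT ht.le h0 hX hΩ hγ hi
    obtain ⟨hint, hrot⟩ := ThreeBody.hasTotalRotation_planeCoord h₁ h₂ h hT ht.le hX hi
    have i₁ := intervalIntegral.integral_congr_ae_restrict ae₁
    have i₂ := intervalIntegral.integral_congr_ae_restrict ae₂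
    -- The pole of `Θ_i` is the shape with `a_i = 0`, which the curve avoids because `a_i` never
    -- vanishes.
    have hpole := ThreeBody.poleIntegral_eq ht.le H.piecewiseC1 (fun t => H.norm_eq) hD
      (q := ThreeBody.vertexAtCenter m i) (by rw [hvc, norm_neg, hb]) (by rwa [hvc])
    have hform : ∫ t in t₀..t₁, ThreeBody.kinematicForm m i (γ t) (deriv γ t)
        = ThreeBody.poleIntegral γ t₀ t₁ (ThreeBody.vertexAtCenter m i) := by
      simp only [ThreeBody.poleIntegral, hvc, neg_neg, ThreeBody.kinematicForm_eq_poleForm]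
    refine ⟨hint.congr_ae (ae₁.mono fun _ h => h.symm), ?_, ?_, i₁.trans i₂, fun hp => ?_, ?_⟩
    · exact ThreeBody.intervalIntegrable_poleForm ht.le H.piecewiseC1 (fun t => H.norm_eq) hb hbγ
    · rwa [i₁, ← he]
    · rw [hform]
      exact hpole.2 fun ⟨p, hpD, e⟩ => hp p hpD e
    · rintro ⟨p, hpD, e⟩
      rw [hform]
      exact hpole.1 ⟨p, hpD, e⟩
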